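/- **Setting.** Let $n\ge 0$, $a>1$, let $V\subset\mathbb C^n$ be an open neighbourhood of $p=0$, and let $\phi:V\to\mathbb R$ be a Kähler potential (smooth, with positive definite complex Hessian $(\partial^2\phi/\partial x_i\partial\bar x_j)$ on $V$) of Gevrey class $G^a(V)$: for some constants $C_0,C_1>0$, $$|D_x^\alpha D_{\bar x}^\beta\phi(x)|\le C_0C_1^{|\alpha|+|\beta|}(\alpha!\,\beta!)^a\qquad\text{for all }x\in V\text{ and all multi-indices }\alpha,\beta .$$ For $\varepsilon>0$ let $\chi\in G^{1+\varepsilon}(\mathbb R)$ be a real cut-off function, i.e. $\chi$ is smooth, $|\chi^{(k)}|\le A_0A_1^k\,k!^{1+\varepsilon}$ on $\mathbb R$ for all $k$ and some $A_0,A_1>0$, $\chi(t)=1$ for $|t|\le\frac12$ and $\chi(t)=0$ for $|t|\ge1$. Let $\psi=F(\phi)$ be the almost holomorphic extension $$\psi(y,z)=\sum_{\alpha,\beta\ge0}\frac{D_x^\alpha D_{\bar x}^\beta\phi}{\alpha!\,\beta!}\Big(\frac{y+\bar z}2\Big)\Big(\frac{y-\bar z}2\Big)^\alpha\Big(\frac{z-\bar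 y}2\Big)^\beta\chi\big(|\alpha+\beta|^{2(a-1)}4^{a-1}C_1^2|y-\bar z|^2\big),$$ and put $$\theta(x,y,z)=\int_0^1(D_x\psi)(tx+(1-t)y,z)\,dt,\qquad \Delta_0=\frac{\det\psi_{yz}(y,z)}{\det\theta_z(x,y,z)} ,$$ where $D$ and the subscripts denote holomorphic (Wirtinger) derivatives. Given a diffeomorphism $(x,y,z)\mapsto(x,y,\theta(x,y,z))$ from an open neighbourhood $\Omega$ of the origin in $\mathbb C^{3n}$ onto an open set, with inverse $(x,y,\theta)\mapsto(x,y,z(x,y,\theta))$, write $\Delta_0(x,y,\theta)$ for $\Delta_0$ at $z=z(x,y,\theta)$ and define $b_m(x,z)$ for $(x,x,z)\in\Omega$ by $b_0=1$ and, for $m\ge1$, $$b_m(x,z(x,x,\theta))=-\sum_{l=1}^m\frac{(D_y\cdot D_\theta)^l}{l!}\Big(b_{m-l}\big(x,z(x,y,\theta)\big)\,\Delta_0(x,y,\theta)\Big)\Big|_{y=x}.$$ **Theorem.** There is a constant $b>0$, depending neither on $\varepsilon$ nor on $\chi$, such that for every $\varepsilon>0$ and every $\chi$ as above the following holds. Such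 a diffeomorphism exists; and for each one there are an open neighbourhood $U\subset V$ of $0$ with $(x,x,z)\in\Omega$ for all $x,z\in U$, and a constant $C>0$ (which may depend on $\varepsilon$), such that for every $m\in\mathbb N$ the function $b_m$ is smooth on $U\times U$ and $$\|b_m\|_{L^\infty(U\times U)}\le C^m\,m!^{2a+2\varepsilon},$$ and, with $v=(x,z)$, for all multi-indices $\alpha,\beta\in\mathbb Z_{\ge0}^{2n}$ and all $(x,z)\in U\times U$, $$\big|D_v^\alpha D_{\bar v}^\beta b_m(x,z)\big|\le C^{m+|\alpha|+|\beta|}\,m!^{2a+2\varepsilon}\,\alpha!^{a+\varepsilon}\beta!^{a+\varepsilon}\exp\Big(-b\,(1-\delta_0(|\beta|))\,|x-\bar z|^{-\frac1{a-1}}\Big),$$ where $\delta_0(0)=1$, $\delta_0(k)=0$ for $k\ne0$, and for $\beta\ne0$ the exponential is read as $0$ when $z=\bar x$. The constants $b$ and $C$ do not depend on $m,\alpha,\beta$. On the diagonal $z=\bar x$ the last estimate also holds with $\varepsilon=0$ in the exponents: $|D_v^\alpha D_{\bar v}^\beta b_m(x,\bar x)|\le C^{m+|\alpha|+|\beta|}m!^{2a}\alpha!^a\beta!^a$,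 and the left-hand side vanishes if $\beta\ne0$. -/

import Mathlib

open scoped ContDiff

namespace BBS

noncomputable section

/-! ### Wirtinger derivatives and multi-indices -/

/-- The holomorphic Wirtinger derivative `∂f/∂v_i = (∂f/∂(Re v_i) - √-1 ∂f/∂(Im v_i)) / 2`. -/
def dHol {ι : Type} [Fintype ι] [DecidableEq ι] (i : ι) (f : (ι → ℂ) → ℂ) (v : ι → ℂ) : ℂ :=
  (fderiv ℝ f v (Pi.single i 1) - Complex.I * fderiv ℝ f v (Pi.single i Complex.I)) / 2

/-- The antiholomorphic Wirtinger derivative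
`∂f/∂v̄_i = (∂f/∂(Re v_i) + √-1 ∂f/∂(Im v_i)) / 2`. -/
def dAnti {ι : Type} [Fintype ι] [DecidableEq ι] (i : ι) (f : (ι → ℂ) → ℂ) (v : ι → ℂ) : ℂ :=
  (fderiv ℝ f v (Pi.single i 1) + Complex.I * fderiv ℝ f v (Pi.single i Complex.I)) / 2

/-- `D_v^α D_v̄^β f`. The order in which the coordinates are processed is immaterial for the
smooth functions to which this is applied. -/
def wirtinger {ι : Type} [Fintype ι] [DecidableEq ι] (α β : ι → ℕ) (f : (ι → ℂ) → ℂ) :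
    (ι → ℂ) → ℂ :=
  (Finset.univ : Finset ι).toList.foldr (fun i g => (dHol i)^[α i] g)
    ((Finset.univ : Finset ι).toList.foldr (fun i g => (dAnti i)^[β i] g) f)

/-- `|α| = ∑ α_i`. -/
def size {ι : Type} [Fintype ι] (α : ι → ℕ) : ℕ := ∑ i, α i

/-- `α! = ∏ α_i!`. -/
def mfact {ι : Type} [Fintype ι] (α : ι → ℕ) : ℕ := ∏ i, (α i).factorial

/-! ### Gevrey classes, Kähler potentials, cut-off functions -/

/-- `f` is smooth on the open set `V` and
`|D_x^α D_x̄^β f| ≤ C₀ C₁^(|α|+|β|) (α! β!)^a` on `V` for all `α, β`. -/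
structure GevreyWith {n : ℕ} (a C₀ C₁ : ℝ) (V : Set (Fin n → ℂ)) (f : (Fin n → ℂ) → ℂ) :
    Prop where
  smooth : ContDiffOn ℝ ∞ f V
  bound : ∀ (α β : Fin n → ℕ), ∀ x ∈ V,
    ‖wirtinger α β f x‖ ≤ C₀ * C₁ ^ (size α + size β) * ((mfact α * mfact β : ℕ) : ℝ) ^ a

/-- The complex Hessian `(∂²φ/∂x_i∂x̄_j)`. -/
def complexHessian {n : ℕ} (φ : (Fin n → ℂ) → ℂ) (x : Fin n → ℂ) : Matrix (Fin n) (Fin n) ℂ :=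
  Matrix.of fun i j => dHol i (dAnti j φ) x

open scoped ComplexOrder in
/-- The real function `φ` is a Kähler potential on `V`: its complex Hessian is positive definite
at every point of `V` (smoothness is part of `GevreyWith`). -/
def IsKahlerPotential {n : ℕ} (V : Set (Fin n → ℂ)) (φ : (Fin n → ℂ) → ℝ) : Prop :=
  ∀ x ∈ V, (complexHessian (fun w => (φ w : ℂ)) x).PosDef

/-- A cut-off function of Gevrey class `G^{1+ε}(ℝ)`, equal to `1` for `|t| ≤ 1/2` and to `0`
for `|t| ≥ 1`. -/
structure IsGevreyCutoff (ε : ℝ) (χ : ℝ → ℝ) : Prop where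
  smooth : ContDiff ℝ ∞ χ
  bound : ∃ A₀ A₁ : ℝ, 0 < A₀ ∧ 0 < A₁ ∧ ∀ (k : ℕ) (t : ℝ),
    |iteratedDeriv k χ t| ≤ A₀ * A₁ ^ k * (k.factorial : ℝ) ^ (1 + ε)
  eq_one : ∀ t : ℝ, |t| ≤ 1 / 2 → χ t = 1
  eq_zero : ∀ t : ℝ, 1 ≤ |t| → χ t = 0

/-! ### The almost holomorphic extension -/

/-- The Euclidean length `|y - z̄|` in `ℂⁿ`. -/
def conjDist {n : ℕ} (y z : Fin n → ℂ) : ℝ := Real.sqrt (∑ i, ‖y i - star (z i)‖ ^ 2)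

/-- The almost holomorphic extension
`F(f)(y,z) = ∑_{α,β} (D_x^α D_x̄^β f)((y+z̄)/2) / (α! β!) ((y-z̄)/2)^α ((z-ȳ)/2)^β
  χ(|α+β|^{2(a-1)} 4^{a-1} C₁² |y-z̄|²)`.
For every `(y,z)` only finitely many terms are nonzero. -/
def ahe {n : ℕ} (a C₁ : ℝ) (χ : ℝ → ℝ) (f : (Fin n → ℂ) → ℂ) (y z : Fin n → ℂ) : ℂ :=
  ∑' p : (Fin n → ℕ) × (Fin n → ℕ),
    wirtinger p.1 p.2 f (fun i => (y i + star (z i)) / 2) / ((mfact p.1 * mfact p.2 : ℕ) : ℂ)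
      * (∏ i, ((y i - star (z i)) / 2) ^ p.1 i) * (∏ i, ((z i - star (y i)) / 2) ^ p.2 i)
      * (χ ((size (p.1 + p.2) : ℝ) ^ (2 * (a - 1)) * (4 : ℝ) ^ (a - 1) * C₁ ^ 2
          * conjDist y z ^ 2) : ℂ)

/-! ### The recursion for the coefficients -/

/-- `θ(x,y,z) = ∫₀¹ (D_x ψ)(t x + (1-t) y, z) dt`. -/
def theta {n : ℕ} (ψ : (Fin n → ℂ) → (Fin n → ℂ) → ℂ) (x y z : Fin n → ℂ) : Fin n → ℂ :=
  fun i => ∫ t in (0 : ℝ)..1, dHol i (fun w => ψ w z) (t • x + (1 - t) • y)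

/-- `e` is a diffeomorphism between two open sets of `ℂ³ⁿ`, the first one containing the origin,
and it is given by `(x,y,z) ↦ (x,y,θ(x,y,z))`. -/
structure IsThetaChart {n : ℕ} (ψ : (Fin n → ℂ) → (Fin n → ℂ) → ℂ)
    (e : OpenPartialHomeomorph ((Fin n → ℂ) × (Fin n → ℂ) × (Fin n → ℂ))
      ((Fin n → ℂ) × (Fin n → ℂ) × (Fin n → ℂ))) : Prop where
  zero_mem : (0, 0, 0) ∈ e.source
  apply_eq : ∀ x y z, (x, y, z) ∈ e.source → e (x, y, z) = (x, y, theta ψ x y z)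
  smooth : ContDiffOn ℝ ∞ e e.source
  smooth_symm : ContDiffOn ℝ ∞ e.symm e.target

/-- The function `z(x,y,θ)` belonging to a chart `(x,y,z) ↦ (x,y,θ)`. -/
def zOf {n : ℕ} (e : OpenPartialHomeomorph ((Fin n → ℂ) × (Fin n → ℂ) × (Fin n → ℂ))
    ((Fin n → ℂ) × (Fin n → ℂ) × (Fin n → ℂ))) (x y θ : Fin n → ℂ) : Fin n → ℂ :=
  (e.symm (x, y, θ)).2.2

/-- `Δ₀ = det ψ_{yz}(y,z) / det θ_z(x,y,z)`, as a function of `(x,y,z)`. -/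
def delta0 {n : ℕ} (ψ : (Fin n → ℂ) → (Fin n → ℂ) → ℂ) (x y z : Fin n → ℂ) : ℂ :=
  (Matrix.of fun i j : Fin n => dHol i (fun y' => dHol j (fun z' => ψ y' z') z) y).det /
    (Matrix.of fun i j : Fin n => dHol j (fun z' => theta ψ x y z' i) z).det

/-- The operator `D_y · D_θ = ∑ᵢ ∂²/∂y_i∂θ_i` on functions of `(y,θ)`. -/
def dyDtheta {n : ℕ} (f : (Fin n → ℂ) → (Fin n → ℂ) → ℂ) (y θ : Fin n → ℂ) : ℂ :=
  ∑ i, dHol i (fun y' => dHol i (fun θ' => f y' θ') θ) y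

/-- The coefficients `b_m(x,z)`: `b₀ = 1` and, for `m ≥ 1`,
`b_m(x,z(x,x,θ)) = - ∑_{l=1}^m (1/l!) (D_y·D_θ)^l (b_{m-l}(x,z(x,y,θ)) Δ₀(x,y,θ)) |_{y=x}`,
evaluated at `θ = θ(x,x,z)`, for which `z(x,x,θ) = z`. Here `l` runs through
`k + 1`, `0 ≤ k ≤ m - 1`. -/
def bbsCoeff {n : ℕ} (ψ : (Fin n → ℂ) → (Fin n → ℂ) → ℂ)
    (e : OpenPartialHomeomorph ((Fin n → ℂ) × (Fin n → ℂ) × (Fin n → ℂ))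
      ((Fin n → ℂ) × (Fin n → ℂ) × (Fin n → ℂ))) : ℕ → (Fin n → ℂ) → (Fin n → ℂ) → ℂ
  | 0 => fun _ _ => 1
  | m + 1 => fun x z =>
      -∑ k : Fin (m + 1), (1 / ((k.1 + 1).factorial : ℂ)) *
        (dyDtheta^[k.1 + 1] (fun y θ =>
          bbsCoeff ψ e (m - k.1) x (zOf e x y θ) * delta0 ψ x y (zOf e x y θ)))
          x (theta ψ x x z)
  termination_by m => m
  decreasing_by omega

/-! ### The quantities in the estimate -/

/-- A function of `(x,z)` as a function of `v = (x,z) ∈ ℂ²ⁿ`. -/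
def joint {n : ℕ} (f : (Fin n → ℂ) → (Fin n → ℂ) → ℂ) (v : Fin n ⊕ Fin n → ℂ) : ℂ :=
  f (fun i => v (Sum.inl i)) (fun i => v (Sum.inr i))

/-- The factor `exp(-b (1 - δ₀(|β|)) r^{-1/(a-1)})`: it is `1` for `β = 0`, and for `β ≠ 0` it is
`exp(-b r^{-1/(a-1)})`, which means `0` at `r = 0`. -/
def flatFactor {n : ℕ} (a b : ℝ) (β : Fin n ⊕ Fin n → ℕ) (r : ℝ) : ℝ :=
  if size β = 0 then 1 else if r = 0 then 0 else Real.exp (-b * r ^ (-(1 / (a - 1))))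

end

end BBS

/-! All estimates are carried by pointwise majorants: at a given point every Wirtinger derivative of
length k is at most C R^k (k+N)!^s times a weight, which is 1 for purely holomorphic derivatives and
the flat factor E = exp(-b|x - z̄|^{-1/(a-1)}) as soon as an antiholomorphic one occurs (`Maj`,
`gev`, `holWeight`). Since E ≤ 1, a product is flat when one factor is; by the Leibniz rule these
functions form a ring, which also contains reciprocals of its members that stay away from zero.

The extension ψ lies in this class with s = a + ε (`ExtData.isGev`). Where its cut-off does not
vanish, a term of degree N has size about 2^{-aN}, and half of this decay pays for all derivatives.
An antiholomorphic derivative of a Taylor polynomial telescopes to terms of top degree M. A degree M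
of order |y - z̄|^{-1/(a-1)}, at which the cut-offs are still 1, makes the derivative flat, with a
rate b depending only on a and C₁. On the diagonal each cut-off is locally 1, the jet is that of φ
with vanishing antiholomorphic part, and s = a suffices (`ExtData.isGev_diag`).

The chart is never inverted inside a Gevrey class. In coordinates (x, w, z) with y = x + w, the
derivations along y_i and θ_i become first-order operators in ∂_w, ∂_z, ∂_z̄, whose coefficients
solve a linear system built from θ_z, θ_z̄ and their conjugates. As θ_z̄ is flat, elimination by a
Schur complement puts the coefficients of ∂_z in the class. Those of ∂_z̄ are merely Gevrey, but
they multiply an antiholomorphic derivative, which is flat already (`exists_solution_isGev`,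
`GoodDom.exists_transport`). Bounds are needed only at w = 0, where the segment defining θ collapses
to a point, so weights at different points never have to be compared.

Hence D_y·D_θ raises the shift N by 2 at a fixed radius R, at the price of a constant
(`GoodDom.exists_dyDtheta`). The recursion yields by induction the bound M^m R^k (k+2m)!^s for b_m
(`GoodDom.coeff_bound`), and (k+2m)! is at most geometric factors times k! m!^2, whence m!^{2s}. The
induction is run twice: at all points with s = a + ε, and at diagonal points with s = a.
Invertibility near the origin holds because there θ_z is the complex Hessian of φ and θ_z̄ = 0. -/

namespace BBS

noncomputable section

variable {ι κ : Type} [Fintype ι] [DecidableEq ι] [Fintype κ] [DecidableEq κ]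

/-! ### Words of Wirtinger derivatives -/

/-- The Wirtinger component of a real linear form: the coefficient of `dv_i` (for `false`) or
`dv̄_i` (for `true`). -/
def wirForm (c : ι × Bool) : ((ι → ℂ) →L[ℝ] ℂ) →L[ℝ] ℂ :=
  (1 / 2 : ℂ) • (ContinuousLinearMap.apply ℝ ℂ (Pi.single c.1 (1 : ℂ) : ι → ℂ) +
    (if c.2 then Complex.I else -Complex.I) •
      ContinuousLinearMap.apply ℝ ℂ (Pi.single c.1 Complex.I : ι → ℂ))

theorem wirForm_apply (c : ι × Bool) (A : (ι → ℂ) →L[ℝ] ℂ) :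
    wirForm c A = (A (Pi.single c.1 1) + (if c.2 then Complex.I else -Complex.I) *
      A (Pi.single c.1 Complex.I)) / 2 := by
  simp only [wirForm, smul_apply, add_apply,
    ContinuousLinearMap.apply_apply, smul_eq_mul]
  ring

/-- The Wirtinger derivative `∂/∂v_i` (for `(i, false)`) or `∂/∂v̄_i` (for `(i, true)`). -/
def dW (c : ι × Bool) (f : (ι → ℂ) → ℂ) (v : ι → ℂ) : ℂ := wirForm c (fderiv ℝ f v)

theorem dW_false (i : ι) (f : (ι → ℂ) → ℂ) : dW (i, false) f = dHol i f := by
  funext v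
  simp [dW, wirForm_apply, dHol, sub_eq_add_neg]

theorem dW_true (i : ι) (f : (ι → ℂ) → ℂ) : dW (i, true) f = dAnti i f := by
  funext v
  simp [dW, wirForm_apply, dAnti]

/-- Iterated Wirtinger derivatives along a word; the head of the word is applied first. -/
def dWord : List (ι × Bool) → ((ι → ℂ) → ℂ) → (ι → ℂ) → ℂ
  | [], f => f
  | c :: L, f => dWord L (dW c f)

@[simp] theorem dWord_nil (f : (ι → ℂ) → ℂ) : dWord [] f = f := rfl

@[simp] theorem dWord_cons (c : ι × Bool) (L : List (ι × Bool)) (f : (ι → ℂ) → ℂ) :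
    dWord (c :: L) f = dWord L (dW c f) := rfl

theorem dWord_append (L L' : List (ι × Bool)) (f : (ι → ℂ) → ℂ) :
    dWord (L ++ L') f = dWord L' (dWord L f) := by
  induction L generalizing f with
  | nil => rfl
  | cons c L ih => simp [ih]

/-- Whether a word contains an antiholomorphic derivative. -/
def hasAnti {ι : Type} (L : List (ι × Bool)) : Bool := L.any Prod.snd

@[simp] theorem hasAnti_nil {ι : Type} : hasAnti ([] : List (ι × Bool)) = false := rfl

@[simp] theorem hasAnti_cons {ι : Type} (c : ι × Bool) (L : List (ι × Bool)) :
    hasAnti (c :: L) = (c.2 || hasAnti L) := rfl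

/-- Expand u in the real basis formed by the vectors 1 and i in each slot. This identity makes the
chain rule, and the passage between smoothness of `fderiv` and of the Wirtinger derivatives, purely
algebraic. -/
theorem form_eq_sum_wirForm (A : (ι → ℂ) →L[ℝ] ℂ) (u : ι → ℂ) :
    A u = ∑ i, (wirForm (i, false) A * u i + wirForm (i, true) A * star (u i)) := by
  have hu : u = ∑ i, ((u i).re • (Pi.single i (1 : ℂ) : ι → ℂ) +
      (u i).im • (Pi.single i Complex.I : ι → ℂ)) := by
    funext j
    simp only [Finset.sum_apply, Pi.add_apply, Pi.smul_apply, Finset.sum_add_distrib]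
    rw [Finset.sum_eq_single j, Finset.sum_eq_single j]
    · simp [Complex.re_add_im]
    · intro i _ h; simp [h.symm]
    · simp
    · intro i _ h; simp [h.symm]
    · simp
  conv_lhs => rw [hu]
  rw [map_sum]
  refine Finset.sum_congr rfl fun i _ => ?_
  rw [map_add, map_smul, map_smul, wirForm_apply, wirForm_apply]
  simp only [Complex.real_smul, if_true, Bool.false_eq_true, if_false]
  have h1 : u i = (u i).re + (u i).im * Complex.I := (Complex.re_add_im _).symm
  have h2 : star (u i) = (u i).re - (u i).im * Complex.I := by
    apply Complex.ext <;> simp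
  rw [h2]
  conv_rhs => rw [h1]
  simp only [Complex.add_re, Complex.ofReal_re, Complex.mul_re, Complex.I_re, Complex.ofReal_im,
    Complex.I_im, Complex.add_im, Complex.mul_im]
  ring_nf
  simp only [Complex.I_sq]
  ring_nf

/-! ### Calculus rules -/

variable {O : Set (ι → ℂ)} {f g : (ι → ℂ) → ℂ} {v : ι → ℂ}

theorem _root_.ContDiffOn.differentiableAt_of_isOpen {E F : Type*} [NormedAddCommGroup E]
    [NormedSpace ℝ E] [NormedAddCommGroup F] [NormedSpace ℝ F] {O : Set E} {f : E → F} {v : E}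
    (hf : ContDiffOn ℝ ∞ f O) (hO : IsOpen O) (hv : v ∈ O) : DifferentiableAt ℝ f v :=
  (hf.contDiffAt (hO.mem_nhds hv)).differentiableAt (by simp)

theorem contDiffOn_dW (hO : IsOpen O) (hf : ContDiffOn ℝ ∞ f O) (c : ι × Bool) :
    ContDiffOn ℝ ∞ (dW c f) O :=
  (wirForm c).contDiff.comp_contDiffOn ((contDiffOn_infty_iff_fderiv_of_isOpen hO).1 hf).2

theorem contDiffOn_dWord (hO : IsOpen O) (hf : ContDiffOn ℝ ∞ f O) (L : List (ι × Bool)) :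
    ContDiffOn ℝ ∞ (dWord L f) O := by
  induction L generalizing f with
  | nil => exact hf
  | cons c L ih => exact ih (contDiffOn_dW hO hf c)

theorem dW_congr (hO : IsOpen O) (h : Set.EqOn f g O) (c : ι × Bool) :
    Set.EqOn (dW c f) (dW c g) O := fun v hv => by
  simp only [dW]
  rw [Filter.EventuallyEq.fderiv_eq (h.eventuallyEq_of_mem (hO.mem_nhds hv))]

theorem dWord_congr (hO : IsOpen O) (h : Set.EqOn f g O) (L : List (ι × Bool)) :
    Set.EqOn (dWord L f) (dWord L g) O := by
  induction L generalizing f g with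
  | nil => exact h
  | cons c L ih => exact ih (dW_congr hO h c)

theorem dWord_congr_nhds (h : f =ᶠ[nhds v] g) (L : List (ι × Bool)) :
    dWord L f v = dWord L g v := by
  obtain ⟨O, hO, hOo, hv⟩ := mem_nhds_iff.1 h
  exact dWord_congr hOo (fun w hw => hO hw) L hv

theorem dW_add (hf : DifferentiableAt ℝ f v) (hg : DifferentiableAt ℝ g v) (c : ι × Bool) :
    dW c (fun w => f w + g w) v = dW c f v + dW c g v := by
  simp only [dW]
  rw [fderiv_fun_add hf hg, map_add]

theorem dW_const (c : ι × Bool) (a : ℂ) : dW c (fun _ : ι → ℂ => a) = fun _ => 0 := by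
  funext v; simp [dW]

theorem dW_mul (hf : DifferentiableAt ℝ f v) (hg : DifferentiableAt ℝ g v) (c : ι × Bool) :
    dW c (fun w => f w * g w) v = dW c f v * g v + f v * dW c g v := by
  simp only [dW, wirForm_apply]
  rw [fderiv_fun_mul hf hg]
  simp only [add_apply, smul_apply, smul_eq_mul]
  ring

theorem dW_const_mul (hf : DifferentiableAt ℝ f v) (c : ι × Bool) (a : ℂ) :
    dW c (fun w => a * f w) v = a * dW c f v := by
  rw [dW_mul (differentiableAt_const a) hf, dW_const]; simp

theorem dW_sum {α : Type*} (s : Finset α) {F : α → (ι → ℂ) → ℂ}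
    (hF : ∀ i ∈ s, DifferentiableAt ℝ (F i) v) (c : ι × Bool) :
    dW c (fun w => ∑ i ∈ s, F i w) v = ∑ i ∈ s, dW c (F i) v := by
  simp only [dW]
  rw [fderiv_fun_sum hF, map_sum]

/-- The real chain rule, with the outer differential decomposed by `form_eq_sum_wirForm`. The
conjugates of the inner components appear because the inner map need not be holomorphic. -/
theorem dW_comp {f : (ι → ℂ) → ℂ} {g : (κ → ℂ) → ι → ℂ} {v : κ → ℂ}
    (hf : DifferentiableAt ℝ f (g v)) (hg : DifferentiableAt ℝ g v) (c : κ × Bool) :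
    dW c (fun w => f (g w)) v = ∑ i, (dW (i, false) f (g v) * dW c (fun w => g w i) v +
      dW (i, true) f (g v) * dW c (fun w => star (g w i)) v) := by
  have hgi : ∀ i, HasFDerivAt (fun w => g w i)
      ((ContinuousLinearMap.proj (R := ℝ) i).comp (fderiv ℝ g v)) v := fun i =>
    (ContinuousLinearMap.proj (R := ℝ) (φ := fun _ : ι => ℂ) i).hasFDerivAt.comp v hg.hasFDerivAt
  have hgs : ∀ i, HasFDerivAt (fun w => star (g w i))
      ((Complex.conjCLE : ℂ →L[ℝ] ℂ).comp
        ((ContinuousLinearMap.proj (R := ℝ) i).comp (fderiv ℝ g v))) v := fun i =>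
    (Complex.conjCLE : ℂ →L[ℝ] ℂ).hasFDerivAt.comp v (hgi i)
  have hfg : HasFDerivAt (fun w => f (g w)) ((fderiv ℝ f (g v)).comp (fderiv ℝ g v)) v :=
    hf.hasFDerivAt.comp v hg.hasFDerivAt
  simp only [dW]
  rw [hfg.fderiv, wirForm_apply c]
  simp only [ContinuousLinearMap.comp_apply]
  rw [form_eq_sum_wirForm (fderiv ℝ f (g v)) (fderiv ℝ g v (Pi.single c.1 1)),
    form_eq_sum_wirForm (fderiv ℝ f (g v)) (fderiv ℝ g v (Pi.single c.1 Complex.I)),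
    Finset.mul_sum, ← Finset.sum_add_distrib, Finset.sum_div]
  refine Finset.sum_congr rfl fun i _ => ?_
  rw [(hgi i).fderiv, (hgs i).fderiv, wirForm_apply c, wirForm_apply c]
  simp only [ContinuousLinearMap.comp_apply, ContinuousLinearMap.proj_apply,
    ContinuousLinearEquiv.coe_coe, Complex.conjCLE_apply, RCLike.star_def]
  ring

theorem dW_star (hf : DifferentiableAt ℝ f v) (c : ι × Bool) :
    dW c (fun w => star (f w)) v = star (dW (c.1, !c.2) f v) := by
  have h : HasFDerivAt (fun w => star (f w))
      ((Complex.conjCLE : ℂ →L[ℝ] ℂ).comp (fderiv ℝ f v)) v :=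
    (Complex.conjCLE : ℂ →L[ℝ] ℂ).hasFDerivAt.comp v hf.hasFDerivAt
  simp only [dW]
  rw [h.fderiv, wirForm_apply, wirForm_apply]
  rcases c with ⟨i, b⟩
  cases b <;> simp [RCLike.star_def]

theorem dW_comm (hO : IsOpen O) (hf : ContDiffOn ℝ ∞ f O) (c d : ι × Bool) :
    Set.EqOn (dW c (dW d f)) (dW d (dW c f)) O := by
  intro v hv
  have hs : IsSymmSndFDerivAt ℝ f v :=
    (hf.contDiffAt (hO.mem_nhds hv)).isSymmSndFDerivAt (by
      rw [minSmoothness_of_isRCLikeNormedField]; exact ENat.LEInfty.out)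
  have h2 : DifferentiableAt ℝ (fderiv ℝ f) v :=
    ((contDiffOn_infty_iff_fderiv_of_isOpen hO).1 hf).2.differentiableAt_of_isOpen hO hv
  have key : ∀ e : ι × Bool, fderiv ℝ (dW e f) v =
      (wirForm e).comp (fderiv ℝ (fderiv ℝ f) v) := fun e =>
    ((wirForm e).hasFDerivAt.comp v h2.hasFDerivAt).fderiv
  change wirForm c (fderiv ℝ (dW d f) v) = wirForm d (fderiv ℝ (dW c f) v)
  rw [key, key]
  simp only [wirForm_apply, ContinuousLinearMap.comp_apply]
  rw [hs.eq (Pi.single c.1 1) (Pi.single d.1 1), hs.eq (Pi.single c.1 1) (Pi.single d.1 Complex.I),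
    hs.eq (Pi.single c.1 Complex.I) (Pi.single d.1 1),
    hs.eq (Pi.single c.1 Complex.I) (Pi.single d.1 Complex.I)]
  ring

/-- Adjacent letters commute by symmetry of the second derivative. Words can thus be sorted into
multi-indices, and a chosen antiholomorphic letter can be brought to the front. -/
theorem dWord_perm (hO : IsOpen O) {L L' : List (ι × Bool)} (h : L.Perm L')
    (hf : ContDiffOn ℝ ∞ f O) : Set.EqOn (dWord L f) (dWord L' f) O := by
  induction h generalizing f with
  | nil => exact fun _ _ => rfl
  | cons c _ ih => exact ih (contDiffOn_dW hO hf c)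
  | swap c d L => exact dWord_congr hO (dW_comm hO hf c d) L
  | trans _ _ ih1 ih2 => exact (ih1 hf).trans (ih2 hf)

theorem dWord_add (hO : IsOpen O) (hf : ContDiffOn ℝ ∞ f O) (hg : ContDiffOn ℝ ∞ g O)
    (L : List (ι × Bool)) :
    Set.EqOn (dWord L (fun w => f w + g w)) (fun w => dWord L f w + dWord L g w) O := by
  induction L generalizing f g with
  | nil => exact fun _ _ => rfl
  | cons c L ih =>
    exact (dWord_congr hO (fun w hw => dW_add (hf.differentiableAt_of_isOpen hO hw)
      (hg.differentiableAt_of_isOpen hO hw) c) L).trans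
        (ih (contDiffOn_dW hO hf c) (contDiffOn_dW hO hg c))

theorem dWord_const_mul (hO : IsOpen O) (hf : ContDiffOn ℝ ∞ f O) (a : ℂ)
    (L : List (ι × Bool)) :
    Set.EqOn (dWord L (fun w => a * f w)) (fun w => a * dWord L f w) O := by
  induction L generalizing f with
  | nil => exact fun _ _ => rfl
  | cons c L ih =>
    exact (dWord_congr hO (fun w hw => dW_const_mul (hf.differentiableAt_of_isOpen hO hw) c a)
      L).trans (ih (contDiffOn_dW hO hf c))

theorem dWord_sum {α : Type*} (hO : IsOpen O) (s : Finset α) {F : α → (ι → ℂ) → ℂ}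
    (hF : ∀ i ∈ s, ContDiffOn ℝ ∞ (F i) O) (L : List (ι × Bool)) :
    Set.EqOn (dWord L (fun w => ∑ i ∈ s, F i w)) (fun w => ∑ i ∈ s, dWord L (F i) w) O := by
  induction L generalizing F with
  | nil => exact fun _ _ => rfl
  | cons c L ih =>
    exact (dWord_congr hO (fun w hw => dW_sum s
      (fun i hi => (hF i hi).differentiableAt_of_isOpen hO hw) c) L).trans
        (ih fun i hi => contDiffOn_dW hO (hF i hi) c)

theorem dWord_const (a : ℂ) (L : List (ι × Bool)) :
    dWord L (fun _ : ι → ℂ => a) = fun _ => if L = [] then a else 0 := by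
  induction L generalizing a with
  | nil => simp
  | cons c L ih => rw [dWord_cons, dW_const, ih]; simp

theorem dWord_star (hO : IsOpen O) (hf : ContDiffOn ℝ ∞ f O) (L : List (ι × Bool)) :
    Set.EqOn (dWord L (fun w => star (f w)))
      (fun w => star (dWord (L.map fun c => (c.1, !c.2)) f w)) O := by
  induction L generalizing f with
  | nil => exact fun _ _ => rfl
  | cons c L ih =>
    exact (dWord_congr hO (fun w hw => dW_star (hf.differentiableAt_of_isOpen hO hw) c) L).trans
      (ih (contDiffOn_dW hO hf (c.1, !c.2)))

/-- Smoothness from differentiability and smoothness of all Wirtinger derivatives. -/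
theorem contDiffOn_succ_of_dW (hO : IsOpen O) {m : ℕ} (hf : DifferentiableOn ℝ f O)
    (h : ∀ c, ContDiffOn ℝ m (dW c f) O) : ContDiffOn ℝ (m + 1 : ℕ) f O := by
  have : ((m + 1 : ℕ) : WithTop ℕ∞) = (m : WithTop ℕ∞) + 1 := by push_cast; rfl
  rw [this, contDiffOn_succ_iff_fderiv_of_isOpen hO]
  refine ⟨hf, by simp, ?_⟩
  -- The differential is ∑ (∂_i f dv_i + ∂̄_i f dv̄_i), so it inherits the regularity of the
  -- Wirtinger derivatives.
  have e : fderiv ℝ f = fun v => ∑ i,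
      (dW (i, false) f v • (ContinuousLinearMap.proj (R := ℝ) (φ := fun _ : ι => ℂ) i) +
        dW (i, true) f v • ((Complex.conjCLE : ℂ →L[ℝ] ℂ).comp
          (ContinuousLinearMap.proj (R := ℝ) (φ := fun _ : ι => ℂ) i))) := by
    funext v
    ext u
    rw [form_eq_sum_wirForm (fderiv ℝ f v) u]
    simp [dW, RCLike.star_def]
  rw [e]
  exact ContDiffOn.sum fun i _ => ((h _).smul contDiffOn_const).add ((h _).smul contDiffOn_const)

end

end BBS

namespace BBS

noncomputable section

variable {ι κ : Type} [Fintype ι] [DecidableEq ι] [Fintype κ] [DecidableEq κ]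

/-! ### Majorants -/

/-- Binomial convolution of two sequences. -/
def conv (M N : ℕ → ℝ) (k : ℕ) : ℝ :=
  ∑ i ∈ Finset.range (k + 1), (k.choose i : ℝ) * (M i * N (k - i))

/-- Pascal's rule, in the shape of the Leibniz rule: one more derivative falls on one of the two
factors. -/
theorem conv_succ (M N : ℕ → ℝ) (k : ℕ) :
    conv M N (k + 1) = conv (fun i => M (i + 1)) N k + conv M (fun i => N (i + 1)) k := by
  unfold conv
  rw [Finset.sum_choose_succ_mul (fun i j => M i * N j) k, add_comm]
  congr 1
  refine Finset.sum_congr rfl fun i hi => ?_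
  rw [Finset.mem_range] at hi
  rw [Nat.succ_sub (by lia)]

/-- Leibniz rule by induction on the word. The first letter c falls on f or on g, and that factor
then continues with the shifted majorant and the weight b ↦ e (c.2 || b). The bounds are requested
only for words no longer than L, so the estimate can be used inside inductions on the length where
longer words are not yet controlled. -/
theorem norm_dWord_mul_le {O : Set (ι → ℂ)} (hO : IsOpen O) {v : ι → ℂ} (hv : v ∈ O)
    (L : List (ι × Bool)) {f g : (ι → ℂ) → ℂ} {e₁ e₂ e : Bool → ℝ} {M N : ℕ → ℝ}
    (hf : ContDiffOn ℝ ∞ f O) (hg : ContDiffOn ℝ ∞ g O)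
    (hM : ∀ k, 0 ≤ M k) (hN : ∀ k, 0 ≤ N k)
    (hfM : ∀ L' : List (ι × Bool), L'.length ≤ L.length →
      ‖dWord L' f v‖ ≤ M L'.length * e₁ (hasAnti L'))
    (hgN : ∀ L' : List (ι × Bool), L'.length ≤ L.length →
      ‖dWord L' g v‖ ≤ N L'.length * e₂ (hasAnti L'))
    (he : ∀ b b', e₁ b * e₂ b' ≤ e (b || b')) :
    ‖dWord L (fun w => f w * g w) v‖ ≤ conv M N L.length * e (hasAnti L) := by
  induction L generalizing f g e₁ e₂ e M N with
  | nil =>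
    have h1 := hfM [] le_rfl
    have h2 := hgN [] le_rfl
    simp only [dWord_nil, List.length_nil, hasAnti_nil] at h1 h2 ⊢
    rw [norm_mul]
    have h3 : conv M N 0 = M 0 * N 0 := by simp [conv]
    rw [h3]
    calc ‖f v‖ * ‖g v‖ ≤ (M 0 * e₁ false) * (N 0 * e₂ false) :=
          mul_le_mul h1 h2 (norm_nonneg _) ((norm_nonneg _).trans h1)
      _ = (M 0 * N 0) * (e₁ false * e₂ false) := by ring
      _ ≤ _ := mul_le_mul_of_nonneg_left (he false false) (mul_nonneg (hM 0) (hN 0))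
  | cons c L ih =>
    have hfc := contDiffOn_dW hO hf c
    have hgc := contDiffOn_dW hO hg c
    have e1 : Set.EqOn (dW c (fun w => f w * g w))
        (fun w => dW c f w * g w + f w * dW c g w) O := fun w hw =>
      dW_mul (hf.differentiableAt_of_isOpen hO hw) (hg.differentiableAt_of_isOpen hO hw) c
    rw [dWord_cons, dWord_congr hO e1 L hv, dWord_add hO (hfc.mul hg) (hf.mul hgc) L hv]
    have h1 := ih (f := dW c f) (g := g) (e₁ := fun b => e₁ (c.2 || b)) (e₂ := e₂)
      (e := fun b => e (c.2 || b)) (M := fun i => M (i + 1)) (N := N) hfc hg (fun k => hM _) hN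
      (fun L' hL' => hfM (c :: L') (by simpa using hL'))
      (fun L' hL' => hgN L' (by simp only [List.length_cons]; lia))
      (fun b b' => by simpa [Bool.or_assoc] using he (c.2 || b) b')
    have h2 := ih (f := f) (g := dW c g) (e₁ := e₁) (e₂ := fun b => e₂ (c.2 || b))
      (e := fun b => e (c.2 || b)) (M := M) (N := fun i => N (i + 1)) hf hgc hM (fun k => hN _)
      (fun L' hL' => hfM L' (by simp only [List.length_cons]; lia))
      (fun L' hL' => hgN (c :: L') (by simpa using hL'))
      (fun b b' => by simpa [Bool.or_left_comm] using he b (c.2 || b'))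
    rw [List.length_cons, conv_succ, add_mul, hasAnti_cons]
    exact (norm_add_le _ _).trans (add_le_add h1 h2)

/-- All Wirtinger derivatives of `f` at `v` are bounded by `M`, with the weight `e true` for those
containing an antiholomorphic derivative and `e false` for the other ones. -/
def Maj (e : Bool → ℝ) (M : ℕ → ℝ) (f : (ι → ℂ) → ℂ) (v : ι → ℂ) : Prop :=
  ∀ L : List (ι × Bool), ‖dWord L f v‖ ≤ M L.length * e (hasAnti L)

/-! ### Rules of calculation for majorants -/

section Maj

variable {O : Set (ι → ℂ)} {f g : (ι → ℂ) → ℂ} {v : ι → ℂ} {e e₁ e₂ : Bool → ℝ} {M N : ℕ → ℝ}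

theorem Maj.mul (hO : IsOpen O) (hv : v ∈ O) (hf : ContDiffOn ℝ ∞ f O)
    (hg : ContDiffOn ℝ ∞ g O) (hM : ∀ k, 0 ≤ M k) (hN : ∀ k, 0 ≤ N k) (hfM : Maj e₁ M f v)
    (hgN : Maj e₂ N g v) (he : ∀ b b', e₁ b * e₂ b' ≤ e (b || b')) :
    Maj e (conv M N) (fun w => f w * g w) v := fun L =>
  norm_dWord_mul_le hO hv L hf hg hM hN (fun L' _ => hfM L') (fun L' _ => hgN L') he

theorem Maj.mono (h : Maj e M f v) (hMN : ∀ k, M k ≤ N k) (he : ∀ b, 0 ≤ e b) : Maj e N f v :=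
  fun L => (h L).trans (mul_le_mul_of_nonneg_right (hMN _) (he _))

theorem Maj.mono_weight (h : Maj e₁ M f v) (hM : ∀ k, 0 ≤ M k) (he : ∀ b, e₁ b ≤ e₂ b) :
    Maj e₂ M f v := fun L => (h L).trans (mul_le_mul_of_nonneg_left (he _) (hM _))

theorem Maj.add (hO : IsOpen O) (hv : v ∈ O) (hf : ContDiffOn ℝ ∞ f O)
    (hg : ContDiffOn ℝ ∞ g O) (hfM : Maj e M f v) (hgN : Maj e N g v) :
    Maj e (fun k => M k + N k) (fun w => f w + g w) v := fun L => by
  rw [dWord_add hO hf hg L hv, add_mul]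
  exact (norm_add_le _ _).trans (add_le_add (hfM L) (hgN L))

theorem Maj.sum {α : Type*} (hO : IsOpen O) (hv : v ∈ O) (s : Finset α) {F : α → (ι → ℂ) → ℂ}
    {M : α → ℕ → ℝ} (hF : ∀ i ∈ s, ContDiffOn ℝ ∞ (F i) O) (h : ∀ i ∈ s, Maj e (M i) (F i) v) :
    Maj e (fun k => ∑ i ∈ s, M i k) (fun w => ∑ i ∈ s, F i w) v := fun L => by
  rw [dWord_sum hO s hF L hv, Finset.sum_mul]
  exact (norm_sum_le _ _).trans (Finset.sum_le_sum fun i hi => h i hi L)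

theorem Maj.const_mul (hO : IsOpen O) (hv : v ∈ O) (hf : ContDiffOn ℝ ∞ f O)
    (hfM : Maj e M f v) (a : ℂ) : Maj e (fun k => ‖a‖ * M k) (fun w => a * f w) v := fun L => by
  rw [dWord_const_mul hO hf a L hv, norm_mul, mul_assoc]
  exact mul_le_mul_of_nonneg_left (hfM L) (norm_nonneg _)

theorem Maj.dW (h : Maj e M f v) (c : ι × Bool) :
    Maj (fun b => e (c.2 || b)) (fun k => M (k + 1)) (dW c f) v := fun L => h (c :: L)

theorem Maj.congr (hO : IsOpen O) (hv : v ∈ O) (h : Maj e M f v) (hfg : Set.EqOn f g O) :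
    Maj e M g v := fun L => by
  rw [← dWord_congr hO hfg L hv]; exact h L

theorem maj_const (a : ℂ) (he : ∀ b, 0 ≤ e b) (h1 : 1 ≤ e false) (hM : ∀ k, 0 ≤ M k)
    (ha : ‖a‖ ≤ M 0) : Maj e M (fun _ => a) v := fun L => by
  rw [dWord_const]
  split_ifs with h
  · subst h
    simpa using ha.trans (le_mul_of_one_le_right (hM 0) h1)
  · simpa using mul_nonneg (hM _) (he _)

/-- Majorants are preserved under composition with a real linear map whose Wirtinger matrix `a`
has rows of `ℓ¹`-norm at most one. -/
theorem Maj.comp_linear {O' : Set (κ → ℂ)} (hO' : IsOpen O') (hO : IsOpen O)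
    {A : (κ → ℂ) → ι → ℂ} (hA : ∀ w ∈ O', DifferentiableAt ℝ A w) (hAs : ContDiffOn ℝ ∞ A O')
    (hm : Set.MapsTo A O' O) (a : κ × Bool → ι × Bool → ℂ)
    (ha : ∀ w ∈ O', ∀ c i, BBS.dW c (fun w => A w i) w = a c (i, false) ∧
      BBS.dW c (fun w => star (A w i)) w = a c (i, true))
    (ha1 : ∀ c, ∑ d, ‖a c d‖ ≤ 1) {v : κ → ℂ} (hv : v ∈ O')
    (hf : ContDiffOn ℝ ∞ f O) (hM : ∀ k, 0 ≤ M k) (he : ∀ b, 0 ≤ e b)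
    (hc : (∀ c d, a c d ≠ 0 → d.2 = c.2) ∨ ∀ b, e b = e false)
    (h : Maj e M f (A v)) : Maj e M (fun w => f (A w)) v := by
  intro L
  induction L generalizing f e M with
  | nil => exact h []
  | cons c L ih =>
    -- The first letter turns into a combination of letters d with coefficients of total norm at
    -- most 1. By `hc`, either d has the same type as c, or the weight does not distinguish the
    -- types, so the weight survives.
    have e1 : Set.EqOn (BBS.dW c (fun w => f (A w)))
        (fun w => ∑ d, a c d * BBS.dW d f (A w)) O' := fun w hw => by
      rw [dW_comp (hf.differentiableAt_of_isOpen hO (hm hw)) (hA w hw)]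
      simp only [Fintype.sum_prod_type, Fintype.sum_bool]
      refine Finset.sum_congr rfl fun i _ => ?_
      rw [(ha w hw c i).1, (ha w hw c i).2]
      ring
    have hs : ∀ d, ContDiffOn ℝ ∞ (fun w => BBS.dW d f (A w)) O' := fun d =>
      (contDiffOn_dW hO hf d).comp hAs hm
    rw [dWord_cons, dWord_congr hO' e1 L hv,
      dWord_sum hO' _ (fun d _ => contDiffOn_const.mul (hs d)) L hv]
    refine (norm_sum_le _ _).trans ?_
    have key : ∀ d, ‖dWord L (fun w => a c d * BBS.dW d f (A w)) v‖ ≤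
        ‖a c d‖ * (M (L.length + 1) * e (c.2 || hasAnti L)) := fun d => by
      rw [dWord_const_mul hO' (hs d) _ L hv, norm_mul]
      by_cases h0 : a c d = 0
      · simp [h0]
      refine mul_le_mul_of_nonneg_left ?_ (norm_nonneg _)
      have := ih (f := BBS.dW d f) (M := fun k => M (k + 1)) (e := fun b => e (d.2 || b))
        (contDiffOn_dW hO hf d) (fun k => hM _) (fun b => he _)
        (hc.imp id fun h b => by simp only [h (d.2 || b), h (d.2 || false)]) (h.dW d)
      refine this.trans (mul_le_mul_of_nonneg_left (le_of_eq ?_) (hM _))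
      rcases hc with hc | hc
      · simp only [hc c d h0]
      · simp only [hc (d.2 || _), hc (c.2 || _)]
    refine (Finset.sum_le_sum fun d _ => key d).trans ?_
    rw [← Finset.sum_mul]
    exact mul_le_of_le_one_left (mul_nonneg (hM _) (he _)) (ha1 c)

end Maj

/-! ### Gevrey majorants -/

/-- The Gevrey sequence `C R^k ((k+N)!)^s`. -/
def gev (s C R : ℝ) (N k : ℕ) : ℝ := C * R ^ k * ((k + N).factorial : ℝ) ^ s

theorem gev_nonneg {s C R : ℝ} (hC : 0 ≤ C) (hR : 0 ≤ R) (N k : ℕ) : 0 ≤ gev s C R N k := by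
  unfold gev; positivity

theorem gev_mono {s C R C' R' : ℝ} (hC : 0 ≤ C) (hR : 0 ≤ R) (hCC : C ≤ C') (hRR : R ≤ R')
    (N k : ℕ) : gev s C R N k ≤ gev s C' R' N k := by
  unfold gev
  have := hC.trans hCC
  gcongr

/-- The binomial theorem together with i! (k-i)! ≤ k!. The radii add, which is harmless for a
bounded number of products but not for the recursion. -/
theorem conv_gev_le {s C₁ R₁ C₂ R₂ : ℝ} (hs : 0 ≤ s) (hC₁ : 0 ≤ C₁) (hR₁ : 0 ≤ R₁)
    (hC₂ : 0 ≤ C₂) (hR₂ : 0 ≤ R₂) (k : ℕ) :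
    conv (gev s C₁ R₁ 0) (gev s C₂ R₂ 0) k ≤ gev s (C₁ * C₂) (R₁ + R₂) 0 k := by
  unfold conv gev
  rw [add_pow, Finset.mul_sum, Finset.sum_mul]
  refine Finset.sum_le_sum fun i hi => ?_
  have hik : i ≤ k := by rw [Finset.mem_range] at hi; lia
  have h1 : ((i.factorial : ℝ)) ^ s * ((k - i).factorial : ℝ) ^ s ≤ (k.factorial : ℝ) ^ s := by
    rw [← Real.mul_rpow (by positivity) (by positivity)]
    refine Real.rpow_le_rpow (by positivity) ?_ hs
    exact_mod_cast Nat.le_of_dvd (Nat.factorial_pos k) (Nat.factorial_mul_factorial_dvd_factorial hik)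
  simp only [add_zero]
  calc (k.choose i : ℝ) * (C₁ * R₁ ^ i * (i.factorial : ℝ) ^ s *
        (C₂ * R₂ ^ (k - i) * ((k - i).factorial : ℝ) ^ s))
      = (k.choose i : ℝ) * (C₁ * R₁ ^ i * (C₂ * R₂ ^ (k - i))) *
        ((i.factorial : ℝ) ^ s * ((k - i).factorial : ℝ) ^ s) := by ring
    _ ≤ (k.choose i : ℝ) * (C₁ * R₁ ^ i * (C₂ * R₂ ^ (k - i))) * (k.factorial : ℝ) ^ s := by
        gcongr
    _ = _ := by ring

/-- The binomial coefficient is absorbed by one power of the quotient of factorials, and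
monotonicity handles the remaining power s - 1. This is where s ≥ 1 enters. -/
theorem choose_mul_rpow_le {s : ℝ} (hs : 1 ≤ s) {k i : ℕ} (hik : i ≤ k) (N : ℕ) :
    (k.choose i : ℝ) * ((i.factorial : ℝ) ^ s * ((k - i + N).factorial : ℝ) ^ s) ≤
      ((k + N).factorial : ℝ) ^ s := by
  set P : ℝ := (i.factorial : ℝ) * ((k - i + N).factorial : ℝ) with hP
  set F : ℝ := ((k + N).factorial : ℝ) with hF
  have hP0 : 0 < P := by positivity
  have hF0 : 0 < F := by positivity
  have h1 : (k.choose i : ℝ) * P ≤ F := by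
    have h2 : (k + N).choose i * i.factorial * (k + N - i).factorial = (k + N).factorial :=
      Nat.choose_mul_factorial_mul_factorial (by lia)
    have h3 : k.choose i ≤ (k + N).choose i := Nat.choose_le_choose i (by lia)
    have h4 : k - i + N = k + N - i := by lia
    rw [hP, hF, ← h2, h4]
    push_cast
    rw [mul_assoc]
    gcongr
  have hc : (1 : ℝ) ≤ k.choose i := by exact_mod_cast Nat.choose_pos hik
  have h5 : P ≤ F := (le_mul_of_one_le_left hP0.le hc).trans h1
  rw [← Real.mul_rpow (by positivity) (by positivity), ← hP]
  have h6 : P ^ s = P * P ^ (s - 1) := by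
    rw [← Real.rpow_one_add' hP0.le (by linarith)]; ring_nf
  have h7 : F ^ s = F * F ^ (s - 1) := by
    rw [← Real.rpow_one_add' hF0.le (by linarith)]; ring_nf
  rw [h6, h7, ← mul_assoc]
  exact mul_le_mul h1 (Real.rpow_le_rpow hP0.le h5 (by linarith)) (by positivity) hF0.le

/-- Multiplication by a Gevrey function of much larger radius only changes the constant. -/
theorem conv_gev_le_of_two_mul_le {s C R₀ A R : ℝ} (hs : 1 ≤ s) (hC : 0 ≤ C) (hR₀ : 0 ≤ R₀)
    (hA : 0 ≤ A) (hR : 2 * R₀ ≤ R) (N k : ℕ) :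
    conv (gev s C R₀ 0) (gev s A R N) k ≤ gev s (2 * C * A) R N k := by
  have hR0 : 0 ≤ R := by linarith
  -- With the binomial coefficient already absorbed, the ratio R₀/R ≤ 1/2 leaves a geometric series
  -- of sum at most 2, so the radius R is not enlarged.
  have key : ∀ i ∈ Finset.range (k + 1), (k.choose i : ℝ) * (gev s C R₀ 0 i * gev s A R N (k - i)) ≤
      (C * A * R ^ k * ((k + N).factorial : ℝ) ^ s) * (1 / 2) ^ i := fun i hi => by
    have hik : i ≤ k := by rw [Finset.mem_range] at hi; lia
    have h1 := choose_mul_rpow_le hs hik N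
    have h2 : R₀ ^ i * R ^ (k - i) ≤ R ^ k * (1 / 2) ^ i := by
      have : R ^ k = R ^ i * R ^ (k - i) := by rw [← pow_add]; congr 1; lia
      rw [this, mul_right_comm, ← mul_pow]
      gcongr
      linarith
    unfold gev
    rw [add_zero]
    calc _ = (C * A) * ((k.choose i : ℝ) * ((i.factorial : ℝ) ^ s *
          ((k - i + N).factorial : ℝ) ^ s)) * (R₀ ^ i * R ^ (k - i)) := by ring
      _ ≤ (C * A) * ((k + N).factorial : ℝ) ^ s * (R ^ k * (1 / 2) ^ i) := by gcongr
      _ = _ := by ring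
  refine (Finset.sum_le_sum key).trans ?_
  rw [← Finset.mul_sum]
  have h3 : ∑ i ∈ Finset.range (k + 1), (1 / 2 : ℝ) ^ i ≤ 2 := by
    have := Summable.sum_le_tsum (Finset.range (k + 1)) (fun i _ => by positivity)
      (summable_geometric_of_lt_one (by norm_num : (0 : ℝ) ≤ 1 / 2) (by norm_num))
    rwa [tsum_geometric_two] at this
  unfold gev
  calc _ ≤ (C * A * R ^ k * ((k + N).factorial : ℝ) ^ s) * 2 := by gcongr
    _ = _ := by ring

/-- Each of the k + 1 summands is at most A² R^k k!^s, and the number of summands is swallowed by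
(k+1)^s. The cost is a shift by one, with the same radius. -/
theorem conv_gev_self_le {s A R : ℝ} (hs : 1 ≤ s) (hR : 0 ≤ R) (k : ℕ) :
    conv (gev s A R 0) (gev s A R 0) k ≤ gev s (A * A) R 1 k := by
  have key : ∀ i ∈ Finset.range (k + 1), (k.choose i : ℝ) * (gev s A R 0 i * gev s A R 0 (k - i)) ≤
      A * A * R ^ k * (k.factorial : ℝ) ^ s := fun i hi => by
    have hik : i ≤ k := by rw [Finset.mem_range] at hi; lia
    have h1 := choose_mul_rpow_le hs hik 0
    have h2 : R ^ k = R ^ i * R ^ (k - i) := by rw [← pow_add]; congr 1; lia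
    unfold gev
    simp only [add_zero] at h1 ⊢
    rw [h2]
    have hAA := mul_self_nonneg A
    calc _ = (A * A * (R ^ i * R ^ (k - i))) * ((k.choose i : ℝ) * ((i.factorial : ℝ) ^ s *
          ((k - i).factorial : ℝ) ^ s)) := by ring
      _ ≤ _ := by gcongr
  refine (Finset.sum_le_sum key).trans ?_
  rw [Finset.sum_const, Finset.card_range, nsmul_eq_mul]
  unfold gev
  rw [Nat.factorial_succ]
  push_cast
  rw [Real.mul_rpow (by positivity) (by positivity)]
  have h3 : ((k : ℝ) + 1) ≤ ((k : ℝ) + 1) ^ s := by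
    conv_lhs => rw [← Real.rpow_one ((k : ℝ) + 1)]
    exact Real.rpow_le_rpow_of_exponent_le (by linarith [(Nat.cast_nonneg k : (0 : ℝ) ≤ k)]) hs
  have hAA := mul_self_nonneg A
  calc _ = (A * A * R ^ k) * (((k : ℝ) + 1) * (k.factorial : ℝ) ^ s) := by ring
    _ ≤ (A * A * R ^ k) * (((k : ℝ) + 1) ^ s * (k.factorial : ℝ) ^ s) := by gcongr

/-- From k + 1 ≤ 2^k. This removes the shift at the price of a larger radius, which is affordable
only for a fixed number of derivatives. -/
theorem gev_succ_le {s C R : ℝ} (hs : 0 ≤ s) (hC : 0 ≤ C) (hR : 0 ≤ R) (k : ℕ) :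
    gev s C R 0 (k + 1) ≤ gev s (C * R) (2 ^ s * R) 0 k := by
  unfold gev
  have h1 : (((k + 1 + 0).factorial : ℕ) : ℝ) ≤ 2 ^ k * (k.factorial : ℝ) := by
    rw [add_zero, Nat.factorial_succ]
    have : k + 1 ≤ 2 ^ k := Nat.lt_two_pow_self
    push_cast
    gcongr
    exact_mod_cast this
  have h2 : (((k + 1 + 0).factorial : ℕ) : ℝ) ^ s ≤ (2 ^ s) ^ k * (k.factorial : ℝ) ^ s := by
    refine (Real.rpow_le_rpow (by positivity) h1 hs).trans (le_of_eq ?_)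
    rw [Real.mul_rpow (by positivity) (by positivity), ← Real.rpow_natCast (2 ^ s) k,
      ← Real.rpow_mul (by norm_num), ← Real.rpow_natCast 2 k, ← Real.rpow_mul (by norm_num),
      mul_comm (k : ℝ)]
  calc C * R ^ (k + 1) * (((k + 1 + 0).factorial : ℕ) : ℝ) ^ s
      ≤ C * R ^ (k + 1) * ((2 ^ s) ^ k * (k.factorial : ℝ) ^ s) := by gcongr
    _ = _ := by rw [mul_pow, pow_succ, add_zero]; ring

/-- The bookkeeping for iterated derivatives: the derivative is recorded in the shift N, and the
radius stays the same. -/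
theorem gev_succ_shift {s A R : ℝ} (N k : ℕ) :
    gev s A R N (k + 1) = gev s (A * R) R (N + 1) k := by
  unfold gev
  rw [pow_succ, show k + 1 + N = k + (N + 1) by lia]; ring

/-- Gevrey bound for the reciprocal. -/
theorem Maj.inv {O : Set (ι → ℂ)} {f : (ι → ℂ) → ℂ} {v : ι → ℂ} {e : Bool → ℝ}
    (hO : IsOpen O) (hv : v ∈ O) (hf : ContDiffOn ℝ ∞ f O) (hf0 : ∀ w ∈ O, f w ≠ 0)
    {s C R₀ c₀ R : ℝ} (hs : 1 ≤ s) (hC : 0 ≤ C) (hR₀ : 0 ≤ R₀) (hc₀ : 0 < c₀)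
    (hfc : c₀ ≤ ‖f v‖) (he1 : e false = 1)
    (hem : ∀ b b', e b * e b' ≤ e (b || b')) (hfM : Maj e (gev s C R₀ 0) f v)
    (hR1 : 2 * (2 ^ s * R₀) ≤ R) (hR2 : 2 * (C * R₀) * c₀⁻¹ ≤ R) :
    Maj e (gev s c₀⁻¹ R 0) (fun w => (f w)⁻¹) v := by
  have hR : 0 ≤ R := le_trans (by positivity) hR1
  have hg : ContDiffOn ℝ ∞ (fun w => (f w)⁻¹) O := hf.inv hf0
  set g := fun w => (f w)⁻¹ with hgdef
  have hgg : ContDiffOn ℝ ∞ (fun w => g w * g w) O := hg.mul hg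
  have hA : 0 ≤ c₀⁻¹ := by positivity
  -- Differentiating f g = 1 gives ∂g = -∂f · g², so a derivative of g of length k + 1 is controlled
  -- by derivatives of g of length at most k.
  have hdg : ∀ c, Set.EqOn (BBS.dW c g) (fun w => (-1 : ℂ) * (BBS.dW c f w * (g w * g w))) O := by
    intro c w hw
    have h1 := dW_mul (hf.differentiableAt_of_isOpen hO hw) (hg.differentiableAt_of_isOpen hO hw) c
    have h2 : Set.EqOn (fun w => f w * g w) (fun _ => 1) O := fun w hw =>
      mul_inv_cancel₀ (hf0 w hw)
    rw [dW_congr hO h2 c hw, dW_const] at h1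
    have h3 : f w * g w = 1 := h2 hw
    have h4 : BBS.dW c g w = (g w) * (f w * BBS.dW c g w) := by
      rw [← mul_assoc, mul_comm (g w), h3, one_mul]
    have h5 : f w * BBS.dW c g w = - (BBS.dW c f w * g w) := by linear_combination -h1
    rw [h4, h5]; ring
  -- Submultiplicativity gives e b · e b ≤ e b, which is impossible for a negative value.
  have h2 : ∀ b, 0 ≤ e b := by
    intro b
    by_contra hneg
    push Not at hneg
    have h8 := hem b b
    rw [Bool.or_self] at h8
    nlinarith
  -- In the induction g² costs a shift by one, which is exactly the shift of a derivative at radius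
  -- R. The two lower bounds on R make multiplication by ∂f harmless and absorb its constant 2 C R₀
  -- / c₀.
  have main : ∀ k, ∀ L : List (ι × Bool), L.length ≤ k →
      ‖dWord L g v‖ ≤ gev s c₀⁻¹ R 0 L.length * e (hasAnti L) := by
    intro k
    induction k with
    | zero =>
      intro L hL
      have : L = [] := List.length_eq_zero_iff.1 (by lia)
      subst this
      simp only [dWord_nil, hgdef, norm_inv, List.length_nil, hasAnti_nil, he1, gev]
      simp only [pow_zero, mul_one, add_zero, Nat.factorial_zero, Nat.cast_one, Real.one_rpow]
      exact inv_anti₀ hc₀ hfc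
    | succ k ih =>
      intro L hL
      cases L with
      | nil => exact ih [] (by simp)
      | cons c L =>
        have hL' : L.length ≤ k := by simpa using hL
        have hdf := contDiffOn_dW hO hf c
        rw [dWord_cons, dWord_congr hO (hdg c) L hv,
          dWord_const_mul hO (hdf.mul hgg) _ L hv, norm_mul, norm_neg, norm_one, one_mul]
        have h1 : ∀ L' : List (ι × Bool), L'.length ≤ L.length →
            ‖dWord L' (fun w => g w * g w) v‖ ≤
              gev s (c₀⁻¹ * c₀⁻¹) R 1 L'.length * e (hasAnti L') := fun L' hLL => by
          have h := norm_dWord_mul_le (M := gev s c₀⁻¹ R 0) (N := gev s c₀⁻¹ R 0) hO hv L' hg hg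
            (gev_nonneg hA hR 0) (gev_nonneg hA hR 0)
            (fun L'' h'' => ih L'' (by lia)) (fun L'' h'' => ih L'' (by lia)) hem
          exact h.trans (mul_le_mul_of_nonneg_right (conv_gev_self_le hs hR _) (h2 _))
        have h3 := norm_dWord_mul_le (f := BBS.dW c f) (g := fun w => g w * g w)
          (M := gev s (C * R₀) (2 ^ s * R₀) 0) (N := gev s (c₀⁻¹ * c₀⁻¹) R 1)
          (e₁ := fun b => e (c.2 || b)) (e₂ := e) (e := fun b => e (c.2 || b)) hO hv L hdf hgg
          (gev_nonneg (by positivity) (by positivity) 0) (gev_nonneg (by positivity) hR 1)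
          (fun L' _ => (hfM.dW c L').trans
            (mul_le_mul_of_nonneg_right (gev_succ_le (by linarith) hC hR₀ _) (h2 _))) h1
          (fun b b' => by simpa [Bool.or_assoc] using hem (c.2 || b) b')
        refine h3.trans (mul_le_mul_of_nonneg_right ?_ (h2 _))
        refine (conv_gev_le_of_two_mul_le hs (by positivity) (by positivity) (by positivity)
          hR1 1 _).trans ?_
        rw [List.length_cons, gev_succ_shift]
        refine gev_mono (by positivity) hR ?_ le_rfl _ _
        calc 2 * (C * R₀) * (c₀⁻¹ * c₀⁻¹) = c₀⁻¹ * (2 * (C * R₀) * c₀⁻¹) := by ring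
          _ ≤ c₀⁻¹ * R := by gcongr
  exact fun L => main L.length L le_rfl

end

end BBS

namespace BBS

noncomputable section

variable {ι κ : Type} [Fintype ι] [DecidableEq ι] [Fintype κ] [DecidableEq κ]

/-! ### Gevrey classes on a set of points -/

/-- `f` is smooth on `O`, and at the points of `S` its Wirtinger derivatives satisfy Gevrey bounds
of order `s`, weighted by `w`. -/
def IsGev (O S : Set (ι → ℂ)) (s : ℝ) (w : (ι → ℂ) → Bool → ℝ) (f : (ι → ℂ) → ℂ) : Prop :=
  ContDiffOn ℝ ∞ f O ∧ ∃ C R : ℝ, 0 ≤ C ∧ 0 ≤ R ∧ ∀ v ∈ S, Maj (w v) (gev s C R 0) f v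

/-- The weight which is `1` on holomorphic derivatives and `E` on the other ones. -/
def holWeight (E : (ι → ℂ) → ℝ) (v : ι → ℂ) (b : Bool) : ℝ := if b then E v else 1

section IsGev

variable {O S : Set (ι → ℂ)} {s : ℝ} {w w₁ w₂ : (ι → ℂ) → Bool → ℝ} {f g : (ι → ℂ) → ℂ}

theorem IsGev.mono_weight (h : IsGev O S s w₁ f) (hw : ∀ v ∈ S, ∀ b, w₁ v b ≤ w₂ v b) :
    IsGev O S s w₂ f := by
  obtain ⟨h1, C, R, hC, hR, h⟩ := h
  exact ⟨h1, C, R, hC, hR, fun v hv => (h v hv).mono_weight (gev_nonneg hC hR 0) (hw v hv)⟩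

theorem IsGev.add (hO : IsOpen O) (hS : S ⊆ O) (hw : ∀ v ∈ S, ∀ b, 0 ≤ w v b)
    (hf : IsGev O S s w f) (hg : IsGev O S s w g) : IsGev O S s w (f + g) := by
  obtain ⟨hf1, C, R, hC, hR, hf⟩ := hf
  obtain ⟨hg1, C', R', hC', hR', hg⟩ := hg
  refine ⟨hf1.add hg1, C + C', max R R', by positivity, by positivity, fun v hv => ?_⟩
  refine Maj.mono ((hf v hv).add hO (hS hv) hf1 hg1 (hg v hv)) (fun k => ?_) (hw v hv)
  have h1 := gev_mono (s := s) hC hR le_rfl (le_max_left R R') 0 k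
  have h2 := gev_mono (s := s) hC' hR' le_rfl (le_max_right R R') 0 k
  refine (add_le_add h1 h2).trans (le_of_eq ?_)
  unfold gev; ring

theorem IsGev.mul (hO : IsOpen O) (hS : S ⊆ O) (hs : 0 ≤ s) (hw : ∀ v ∈ S, ∀ b, 0 ≤ w v b)
    (hww : ∀ v ∈ S, ∀ b b', w₁ v b * w₂ v b' ≤ w v (b || b'))
    (hf : IsGev O S s w₁ f) (hg : IsGev O S s w₂ g) : IsGev O S s w (f * g) := by
  obtain ⟨hf1, C, R, hC, hR, hf⟩ := hf
  obtain ⟨hg1, C', R', hC', hR', hg⟩ := hg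
  refine ⟨hf1.mul hg1, C * C', R + R', by positivity, by positivity, fun v hv => ?_⟩
  exact Maj.mono ((hf v hv).mul hO (hS hv) hf1 hg1 (gev_nonneg hC hR 0) (gev_nonneg hC' hR' 0)
    (hg v hv) (hww v hv)) (fun k => conv_gev_le hs hC hR hC' hR' k) (hw v hv)

theorem isGev_const (hw : ∀ v ∈ S, ∀ b, 0 ≤ w v b) (hw1 : ∀ v ∈ S, 1 ≤ w v false) (a : ℂ) :
    IsGev O S s w (fun _ => a) :=
  ⟨contDiffOn_const, ‖a‖, 0, norm_nonneg _, le_rfl, fun v hv =>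
    maj_const a (hw v hv) (hw1 v hv) (gev_nonneg (norm_nonneg _) le_rfl 0) (by simp [gev])⟩

theorem IsGev.dW (hO : IsOpen O) (hs : 0 ≤ s) (hw : ∀ v ∈ S, ∀ b, 0 ≤ w v b)
    (hf : IsGev O S s w f) (c : ι × Bool) :
    IsGev O S s (fun v b => w v (c.2 || b)) (dW c f) := by
  obtain ⟨hf1, C, R, hC, hR, hf⟩ := hf
  exact ⟨contDiffOn_dW hO hf1 c, C * R, 2 ^ s * R, by positivity, by positivity, fun v hv =>
    ((hf v hv).dW c).mono (gev_succ_le hs hC hR) fun b => hw v hv _⟩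

theorem IsGev.star (hO : IsOpen O) (hS : S ⊆ O) (hf : IsGev O S s (fun _ _ => 1) f) :
    IsGev O S s (fun _ _ => 1) (fun v => star (f v)) := by
  obtain ⟨hf1, C, R, hC, hR, hf⟩ := hf
  refine ⟨(Complex.conjCLE : ℂ →L[ℝ] ℂ).contDiff.comp_contDiffOn hf1, C, R, hC, hR,
    fun v hv L => ?_⟩
  rw [dWord_star hO hf1 L (hS hv)]
  simpa using hf v hv (L.map fun c => (c.1, !c.2))

theorem IsGev.inv (hO : IsOpen O) (hS : S ⊆ O) (hs : 1 ≤ s) (hw1 : ∀ v ∈ S, w v false = 1)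
    (hww : ∀ v ∈ S, ∀ b b', w v b * w v b' ≤ w v (b || b')) (hf : IsGev O S s w f)
    (hf0 : ∀ v ∈ O, f v ≠ 0) {c₀ : ℝ} (hc₀ : 0 < c₀) (hfc : ∀ v ∈ S, c₀ ≤ ‖f v‖) :
    IsGev O S s w (fun v => (f v)⁻¹) := by
  obtain ⟨hf1, C, R, hC, hR, hf⟩ := hf
  refine ⟨hf1.inv hf0, c₀⁻¹, max (2 * (2 ^ s * R)) (2 * (C * R) * c₀⁻¹), by positivity,
    by positivity, fun v hv => ?_⟩
  exact (hf v hv).inv hO (hS hv) hf1 hf0 hs hC hR hc₀ (hfc v hv) (hw1 v hv) (hww v hv)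
    (le_max_left _ _) (le_max_right _ _)

/-- The functions of Gevrey class form a ring. -/
def gevRing (hO : IsOpen O) (hS : S ⊆ O) (hs : 0 ≤ s) (hw : ∀ v ∈ S, ∀ b, 0 ≤ w v b)
    (hw1 : ∀ v ∈ S, w v false = 1) (hww : ∀ v ∈ S, ∀ b b', w v b * w v b' ≤ w v (b || b')) :
    Subring ((ι → ℂ) → ℂ) where
  carrier := {f | IsGev O S s w f}
  mul_mem' hf hg := IsGev.mul hO hS hs hw hww hf hg
  add_mem' hf hg := IsGev.add hO hS hw hf hg
  one_mem' := isGev_const hw (fun v hv => (hw1 v hv).ge) 1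
  zero_mem' := isGev_const hw (fun v hv => (hw1 v hv).ge) 0
  neg_mem' {f} hf := by
    have := IsGev.mul hO hS hs hw hww (isGev_const hw (fun v hv => (hw1 v hv).ge) (-1)) hf
    have h : (fun _ => (-1 : ℂ)) * f = -f := by funext v; simp
    rwa [h] at this

end IsGev

/-- The determinant of a matrix over a subring lies in the subring. -/
theorem det_mem_subring {R : Type*} [CommRing R] {m : Type*} [Fintype m] [DecidableEq m]
    (A : Subring R) {M : Matrix m m R} (hM : ∀ i j, M i j ∈ A) : M.det ∈ A := by
  rw [Matrix.det_apply]
  refine A.sum_mem fun σ _ => ?_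
  rw [Units.smul_def]
  exact A.zsmul_mem (A.prod_mem fun i _ => hM _ _) _

theorem adjugate_mem_subring {R : Type*} [CommRing R] {m : Type*} [Fintype m] [DecidableEq m]
    (A : Subring R) {M : Matrix m m R} (hM : ∀ i j, M i j ∈ A) (i j : m) :
    M.adjugate i j ∈ A := by
  rw [Matrix.adjugate_apply]
  refine det_mem_subring A fun k l => ?_
  rw [Matrix.updateRow_apply]
  split_ifs
  · by_cases h : l = i
    · subst h; simp
    · simp [h]
  · exact hM k l

/-! ### Termwise differentiation -/

theorem norm_fderiv_le_sum_dW (f : (ι → ℂ) → ℂ) (v : ι → ℂ) :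
    ‖fderiv ℝ f v‖ ≤ ∑ i, (‖dW (i, false) f v‖ + ‖dW (i, true) f v‖) := by
  refine ContinuousLinearMap.opNorm_le_bound _ (by positivity) fun u => ?_
  rw [form_eq_sum_wirForm (fderiv ℝ f v) u, Finset.sum_mul]
  refine (norm_sum_le _ _).trans (Finset.sum_le_sum fun i _ => ?_)
  rw [add_mul]
  refine (norm_add_le _ _).trans (add_le_add ?_ ?_)
  · rw [norm_mul]
    exact mul_le_mul_of_nonneg_left (norm_le_pi_norm u i) (norm_nonneg _)
  · rw [norm_mul, norm_star]
    exact mul_le_mul_of_nonneg_left (norm_le_pi_norm u i) (norm_nonneg _)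

section tsum

variable {α : Type*} {O : Set (ι → ℂ)} {F : α → (ι → ℂ) → ℂ}

/-- Differentiation under the sum on a ball, by the Weierstrass test. The summable bound is asked
for every word so that the differentiated series satisfies the same hypothesis and the argument can
be iterated. -/
theorem hasFDerivAt_tsum_of_dWord (hO : IsOpen O) (hF : ∀ p, ContDiffOn ℝ ∞ (F p) O)
    (hb : ∀ L : List (ι × Bool), ∃ u : α → ℝ, Summable u ∧
      ∀ p, ∀ v ∈ O, ‖dWord L (F p) v‖ ≤ u p) {v : ι → ℂ} (hv : v ∈ O) :
    HasFDerivAt (fun w => ∑' p, F p w) (∑' p, fderiv ℝ (F p) v) v ∧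
      Summable fun p => fderiv ℝ (F p) v := by
  obtain ⟨r, hr, hball⟩ := Metric.isOpen_iff.1 hO v hv
  choose u hu hub using hb
  have hU : Summable fun p => ∑ i, (u [(i, false)] p + u [(i, true)] p) :=
    summable_sum fun i _ => (hu _).add (hu _)
  have hbound : ∀ p, ∀ w ∈ O, ‖fderiv ℝ (F p) w‖ ≤ ∑ i, (u [(i, false)] p + u [(i, true)] p) :=
    fun p w hw => (norm_fderiv_le_sum_dW _ _).trans (Finset.sum_le_sum fun i _ =>
      add_le_add (hub [(i, false)] p w hw) (hub [(i, true)] p w hw))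
  refine ⟨?_, Summable.of_norm_bounded hU fun p => hbound p v hv⟩
  exact hasFDerivAt_tsum_of_isPreconnected hU Metric.isOpen_ball
    (convex_ball v r).isPreconnected
    (fun p w hw => ((hF p).differentiableAt_of_isOpen hO (hball hw)).hasFDerivAt)
    (fun p w hw => hbound p w (hball hw)) (Metric.mem_ball_self hr)
    (Summable.of_norm_bounded (hu []) fun p => hub [] p v hv) (Metric.mem_ball_self hr)

theorem dW_tsum (hO : IsOpen O) (hF : ∀ p, ContDiffOn ℝ ∞ (F p) O)
    (hb : ∀ L : List (ι × Bool), ∃ u : α → ℝ, Summable u ∧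
      ∀ p, ∀ v ∈ O, ‖dWord L (F p) v‖ ≤ u p) (c : ι × Bool) :
    Set.EqOn (dW c (fun w => ∑' p, F p w)) (fun w => ∑' p, dW c (F p) w) O := fun v hv => by
  obtain ⟨h1, h2⟩ := hasFDerivAt_tsum_of_dWord hO hF hb hv
  simp only [dW]
  rw [h1.fderiv, (wirForm c).map_tsum h2]

theorem dWord_tsum (hO : IsOpen O) (hF : ∀ p, ContDiffOn ℝ ∞ (F p) O)
    (hb : ∀ L : List (ι × Bool), ∃ u : α → ℝ, Summable u ∧
      ∀ p, ∀ v ∈ O, ‖dWord L (F p) v‖ ≤ u p) (L : List (ι × Bool)) :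
    Set.EqOn (dWord L (fun w => ∑' p, F p w)) (fun w => ∑' p, dWord L (F p) w) O := by
  induction L generalizing F with
  | nil => exact fun _ _ => rfl
  | cons c L ih =>
    exact (dWord_congr hO (dW_tsum hO hF hb c) L).trans
      (ih (fun p => contDiffOn_dW hO (hF p) c) fun L' => hb (c :: L'))

theorem contDiffOn_tsum_of_dWord (hO : IsOpen O) (hF : ∀ p, ContDiffOn ℝ ∞ (F p) O)
    (hb : ∀ L : List (ι × Bool), ∃ u : α → ℝ, Summable u ∧
      ∀ p, ∀ v ∈ O, ‖dWord L (F p) v‖ ≤ u p) : ContDiffOn ℝ ∞ (fun w => ∑' p, F p w) O := by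
  rw [contDiffOn_infty]
  intro m
  have hd : ∀ {F : α → (ι → ℂ) → ℂ}, (∀ p, ContDiffOn ℝ ∞ (F p) O) →
      (∀ L : List (ι × Bool), ∃ u : α → ℝ, Summable u ∧ ∀ p, ∀ v ∈ O, ‖dWord L (F p) v‖ ≤ u p) →
      DifferentiableOn ℝ (fun w => ∑' p, F p w) O := fun hF hb v hv =>
    (hasFDerivAt_tsum_of_dWord hO hF hb hv).1.differentiableAt.differentiableWithinAt
  induction m generalizing F with
  | zero => simpa using (hd hF hb).continuousOn
  | succ m ih =>
    exact contDiffOn_succ_of_dW hO (hd hF hb) fun c =>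
      (ih (fun p => contDiffOn_dW hO (hF p) c) fun L' => hb (c :: L')).congr (dW_tsum hO hF hb c)

end tsum

/-! ### Multi-indices and words -/

/-- A word representing `D_v^α D_v̄^β`. -/
def indexWord (α β : ι → ℕ) : List (ι × Bool) :=
  ((Finset.univ : Finset ι).toList.reverse.flatMap fun i => List.replicate (β i) (i, true)) ++
    ((Finset.univ : Finset ι).toList.reverse.flatMap fun i => List.replicate (α i) (i, false))

theorem dWord_replicate (c : ι × Bool) (k : ℕ) (f : (ι → ℂ) → ℂ) :
    dWord (List.replicate k c) f = (dW c)^[k] f := by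
  induction k generalizing f with
  | zero => rfl
  | succ k ih => rw [List.replicate_succ, dWord_cons, ih, Function.iterate_succ_apply]

/-- The list is reversed because `foldr` lets its last element act first, whereas a word lets its
head act first. -/
theorem foldr_eq_dWord (b : Bool) (α : ι → ℕ) (l : List ι) (f : (ι → ℂ) → ℂ) :
    l.foldr (fun i g => (dW (i, b))^[α i] g) f =
      dWord (l.reverse.flatMap fun i => List.replicate (α i) (i, b)) f := by
  induction l with
  | nil => rfl
  | cons i l ih =>
    rw [List.foldr_cons, ih, List.reverse_cons, List.flatMap_append, dWord_append,
      List.flatMap_singleton, dWord_replicate]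

theorem wirtinger_eq_dWord (α β : ι → ℕ) (f : (ι → ℂ) → ℂ) :
    wirtinger α β f = dWord (indexWord α β) f := by
  have h1 : ∀ i : ι, dHol i = dW (i, false) := fun i => funext fun f => (dW_false i f).symm
  have h2 : ∀ i : ι, dAnti i = dW (i, true) := fun i => funext fun f => (dW_true i f).symm
  unfold wirtinger
  simp only [h1, h2]
  rw [foldr_eq_dWord, foldr_eq_dWord, indexWord, dWord_append]

theorem count_flatMap_replicate {ι : Type} [DecidableEq ι] (b b' : Bool) (α : ι → ℕ) (j : ι) (l : List ι) :
    (l.flatMap fun i => List.replicate (α i) (i, b)).count (j, b') =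
      if b = b' then l.count j * α j else 0 := by
  induction l with
  | nil => simp
  | cons i l ih =>
    rw [List.flatMap_cons, List.count_append, ih, List.count_replicate, List.count_cons]
    by_cases hb : b = b' <;> by_cases hi : i = j <;> simp [hb, hi]
    ring

theorem count_toList_univ (j : ι) : (Finset.univ : Finset ι).toList.reverse.count j = 1 := by
  rw [List.count_reverse]
  exact List.count_eq_one_of_mem (Finset.nodup_toList _) (by simp)

theorem count_indexWord_false (α β : ι → ℕ) (j : ι) :
    (indexWord α β).count (j, false) = α j := by
  rw [indexWord, List.count_append, count_flatMap_replicate, count_flatMap_replicate,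
    count_toList_univ]
  simp

theorem count_indexWord_true (α β : ι → ℕ) (j : ι) :
    (indexWord α β).count (j, true) = β j := by
  rw [indexWord, List.count_append, count_flatMap_replicate, count_flatMap_replicate,
    count_toList_univ]
  simp

theorem length_eq_sum_count (L : List (ι × Bool)) :
    L.length = size (fun j => L.count (j, false)) + size (fun j => L.count (j, true)) := by
  have h : ∑ c : ι × Bool, L.count c = L.length := by
    induction L with
    | nil => simp
    | cons a L ih => simp [List.count_cons, Finset.sum_add_distrib, ih]
  rw [← h, Fintype.sum_prod_type]
  simp only [Fintype.sum_bool, size, Finset.sum_add_distrib]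
  ring

theorem length_indexWord (α β : ι → ℕ) : (indexWord α β).length = size α + size β := by
  rw [length_eq_sum_count]
  simp only [count_indexWord_false, count_indexWord_true]

theorem hasAnti_indexWord (α β : ι → ℕ) : hasAnti (indexWord α β) = !decide (size β = 0) := by
  rw [Bool.eq_iff_iff]
  simp only [hasAnti, List.any_eq_true, Bool.not_eq_true', decide_eq_false_iff_not]
  constructor
  · rintro ⟨⟨i, b⟩, hc, rfl⟩ h
    rw [← List.count_pos_iff, count_indexWord_true] at hc
    have := Finset.sum_eq_zero_iff.1 h i (Finset.mem_univ i)
    lia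
  · intro h
    obtain ⟨i, -, hi⟩ := Finset.exists_ne_zero_of_sum_ne_zero h
    refine ⟨(i, true), ?_, rfl⟩
    rw [← List.count_pos_iff, count_indexWord_true]
    lia

/-- Up to order, every word comes from multi-indices. -/
theorem perm_indexWord (L : List (ι × Bool)) :
    L.Perm (indexWord (fun j => L.count (j, false)) (fun j => L.count (j, true))) := by
  rw [List.perm_iff_count]
  rintro ⟨j, b⟩
  cases b
  · rw [count_indexWord_false]
  · rw [count_indexWord_true]

/-- The factorial weight `α! β!` of a word. -/
def wordFact (L : List (ι × Bool)) : ℕ :=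
  mfact (fun j => L.count (j, false)) * mfact (fun j => L.count (j, true))

theorem wordFact_indexWord (α β : ι → ℕ) : wordFact (indexWord α β) = mfact α * mfact β := by
  simp only [wordFact, count_indexWord_false, count_indexWord_true]

theorem wordFact_eq_prod (L : List (ι × Bool)) :
    wordFact L = ∏ c : ι × Bool, (L.count c).factorial := by
  rw [Fintype.prod_prod_type]
  simp only [Fintype.prod_bool, wordFact, mfact, Finset.prod_mul_distrib]
  ring

theorem wordFact_cons (c : ι × Bool) (L : List (ι × Bool)) :
    wordFact (c :: L) = (L.count c + 1) * wordFact L := by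
  rw [wordFact_eq_prod, wordFact_eq_prod, ← Finset.mul_prod_erase _ _ (Finset.mem_univ c),
    ← Finset.mul_prod_erase _ (fun d => (L.count d).factorial) (Finset.mem_univ c),
    List.count_cons_self, Nat.factorial_succ, mul_assoc]
  congr 2
  refine Finset.prod_congr rfl fun d hd => ?_
  rw [List.count_cons_of_ne (Finset.ne_of_mem_erase hd).symm]

theorem wordFact_cons_le (c : ι × Bool) (L : List (ι × Bool)) :
    wordFact (c :: L) ≤ (L.length + 1) * wordFact L := by
  rw [wordFact_cons]
  exact Nat.mul_le_mul_right _ (Nat.succ_le_succ List.count_le_length)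

/-- Each further letter multiplies the factorial weight by a count that is at most the current
length. This separates j extra derivatives from a fixed Taylor index of degree N, at the cost
(N+j)^j. -/
theorem wordFact_append_le (L W : List (ι × Bool)) :
    wordFact (L ++ W) ≤ (L.length + W.length) ^ L.length * wordFact W := by
  induction L with
  | nil => simp
  | cons c L ih =>
    rw [List.cons_append]
    refine (wordFact_cons_le _ _).trans ?_
    rw [List.length_append, List.length_cons, pow_succ']
    have h : (L.length + W.length) ^ L.length ≤ (L.length + 1 + W.length) ^ L.length :=
      Nat.pow_le_pow_left (by lia) _
    calc (L.length + W.length + 1) * wordFact (L ++ W)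
        ≤ (L.length + 1 + W.length) * ((L.length + 1 + W.length) ^ L.length * wordFact W) :=
          Nat.mul_le_mul (by lia) (ih.trans (Nat.mul_le_mul_right _ h))
      _ = _ := by ring

theorem mfact_mul_mfact_le (α β : ι → ℕ) :
    mfact α * mfact β ≤ (size α + size β) ^ (size α + size β) := by
  have h := wordFact_append_le (indexWord α β) []
  rw [List.append_nil, wordFact_indexWord, length_indexWord] at h
  simpa [wordFact, mfact] using h

theorem mfact_pos {ι : Type} [Fintype ι] (α : ι → ℕ) : 0 < mfact α :=
  Finset.prod_pos fun _ _ => Nat.factorial_pos _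

/-- Iterate (i+j)! ≤ 2^{i+j} i! j!. The factorial of a degree and the multi-factorial thus differ
only by geometric factors, so majorants can be indexed by word length alone. -/
theorem factorial_sum_le {α : Type*} (s : Finset α) (k : α → ℕ) :
    (∑ i ∈ s, k i).factorial ≤ (2 ^ s.card) ^ (∑ i ∈ s, k i) * ∏ i ∈ s, (k i).factorial := by
  classical
  induction s using Finset.induction_on with
  | empty => simp
  | insert a s ha ih =>
    rw [Finset.sum_insert ha, Finset.prod_insert ha, Finset.card_insert_of_notMem ha]
    set K := ∑ i ∈ s, k i
    have h1 : (k a + K).factorial ≤ 2 ^ (k a + K) * ((k a).factorial * K.factorial) := by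
      rw [← Nat.add_choose_mul_factorial_mul_factorial (k a) K, mul_assoc]
      exact Nat.mul_le_mul_right _ (Nat.choose_le_two_pow _ _)
    have h2 : (2 ^ s.card) ^ K ≤ (2 ^ s.card) ^ (k a + K) :=
      Nat.pow_le_pow_right (by positivity) (by lia)
    calc _ ≤ 2 ^ (k a + K) * ((k a).factorial * ((2 ^ s.card) ^ (k a + K) *
          ∏ i ∈ s, (k i).factorial)) :=
          h1.trans (Nat.mul_le_mul_left _ (Nat.mul_le_mul_left _ (ih.trans
            (Nat.mul_le_mul_right _ h2))))
      _ = _ := by rw [pow_succ 2 s.card, mul_pow]; ring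

end

end BBS

namespace BBS

noncomputable section

/-! ### The coordinates of the almost holomorphic extension -/

variable {n : ℕ}

/-- The midpoint `(y + z̄)/2`. -/
def mid (v : Fin n ⊕ Fin n → ℂ) (i : Fin n) : ℂ := (v (Sum.inl i) + star (v (Sum.inr i))) / 2

/-- The increments `(y - z̄)/2` and `(z - ȳ)/2`. -/
def incr (c : Fin n × Bool) (v : Fin n ⊕ Fin n → ℂ) : ℂ :=
  if c.2 then (v (Sum.inr c.1) - star (v (Sum.inl c.1))) / 2
  else (v (Sum.inl c.1) - star (v (Sum.inr c.1))) / 2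

/-- The derivative of the potential to which a derivative of the extension corresponds. -/
def target : (Fin n ⊕ Fin n) × Bool → Fin n × Bool
  | (Sum.inl i, b) => (i, b)
  | (Sum.inr i, b) => (i, !b)

/-- The sign with which a derivative acts on the increments. -/
def incrSign (b : Bool) : ℂ := if b then -1 else 1

theorem norm_incrSign (b : Bool) : ‖incrSign b‖ = 1 := by cases b <;> simp [incrSign]

theorem dW_coord {ι : Type} [Fintype ι] [DecidableEq ι] (c : ι × Bool) (i : ι) (v : ι → ℂ) :
    dW c (fun w => w i) v = if c = (i, false) then 1 else 0 := by
  have h : fderiv ℝ (fun w : ι → ℂ => w i) v = ContinuousLinearMap.proj i :=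
    (ContinuousLinearMap.proj (R := ℝ) (φ := fun _ : ι => ℂ) i).fderiv
  rcases c with ⟨j, b⟩
  simp only [dW, h, wirForm_apply, ContinuousLinearMap.proj_apply, Prod.mk.injEq]
  by_cases hij : j = i
  · subst hij
    cases b <;> simp
  · have : i ≠ j := fun h => hij h.symm
    simp [hij, this]

theorem dW_star_coord {ι : Type} [Fintype ι] [DecidableEq ι] (c : ι × Bool) (i : ι) (v : ι → ℂ) :
    dW c (fun w => star (w i)) v = if c = (i, true) then 1 else 0 := by
  rw [dW_star (f := fun w => w i) (by fun_prop), dW_coord]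
  rcases c with ⟨j, b⟩
  cases b <;> by_cases hij : j = i <;> simp [hij]

theorem contDiff_star_coord {ι : Type} [Fintype ι] (i : ι) :
    ContDiff ℝ ∞ (fun w : ι → ℂ => star (w i)) :=
  (Complex.conjCLE : ℂ →L[ℝ] ℂ).contDiff.comp (contDiff_apply ℝ ℂ i)

theorem contDiff_mid : ContDiff ℝ ∞ (mid : (Fin n ⊕ Fin n → ℂ) → Fin n → ℂ) := by
  rw [contDiff_pi]
  intro i
  exact ((contDiff_apply ℝ ℂ (Sum.inl i)).add (contDiff_star_coord (Sum.inr i))).div_const 2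

theorem contDiff_incr (c : Fin n × Bool) : ContDiff ℝ ∞ (incr c) := by
  rcases c with ⟨i, b⟩
  cases b
  · exact ((contDiff_apply ℝ ℂ (Sum.inl i)).sub (contDiff_star_coord (Sum.inr i))).div_const 2
  · exact ((contDiff_apply ℝ ℂ (Sum.inr i)).sub (contDiff_star_coord (Sum.inl i))).div_const 2

theorem dW_half_add {ι : Type} [Fintype ι] [DecidableEq ι] (c : ι × Bool) (i j : ι) (a : ℂ)
    (v : ι → ℂ) : dW c (fun w => (w i + a * star (w j)) / 2) v =
      ((if c = (i, false) then 1 else 0) + a * (if c = (j, true) then 1 else 0)) / 2 := by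
  have h1 : DifferentiableAt ℝ (fun w : ι → ℂ => star (w j)) v :=
    (contDiff_star_coord j).differentiable (by simp) v
  have h : (fun w : ι → ℂ => (w i + a * star (w j)) / 2) =
      fun w => (1 / 2 : ℂ) * (w i + a * star (w j)) := by funext w; ring
  have h2 : DifferentiableAt ℝ (fun w : ι → ℂ => w i + a * star (w j)) v :=
    (by fun_prop : DifferentiableAt ℝ (fun w : ι → ℂ => w i) v).add (h1.const_mul a)
  rw [h, dW_const_mul h2, dW_add (by fun_prop) (h1.const_mul a), dW_coord, dW_const_mul h1,
    dW_star_coord]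
  ring

/-- Every letter acts on exactly one increment, with sign + if holomorphic and - if antiholomorphic,
while `dW_mid` shows that it acts on the midpoint through the same `target` always with +. The
opposite signs cause the telescoping below. -/
theorem dW_incr (d : (Fin n ⊕ Fin n) × Bool) (c : Fin n × Bool) (v : Fin n ⊕ Fin n → ℂ) :
    dW d (incr c) v = if target d = c then incrSign d.2 / 2 else 0 := by
  rcases c with ⟨i, b⟩
  cases b
  · have : incr (i, false) = fun w : Fin n ⊕ Fin n → ℂ =>
        (w (Sum.inl i) + (-1) * star (w (Sum.inr i))) / 2 := by funext w; simp [incr]; ring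
    rw [this, dW_half_add]
    rcases d with ⟨j | j, b⟩ <;> cases b <;> by_cases h : j = i <;>
      simp [target, incrSign, h]
  · have : incr (i, true) = fun w : Fin n ⊕ Fin n → ℂ =>
        (w (Sum.inr i) + (-1) * star (w (Sum.inl i))) / 2 := by funext w; simp [incr]; ring
    rw [this, dW_half_add]
    rcases d with ⟨j | j, b⟩ <;> cases b <;> by_cases h : j = i <;>
      simp [target, incrSign, h]

theorem dW_mid (d : (Fin n ⊕ Fin n) × Bool) (i : Fin n) (v : Fin n ⊕ Fin n → ℂ) :
    dW d (fun w => mid w i) v = (if target d = (i, false) then 1 / 2 else 0) ∧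
      dW d (fun w => star (mid w i)) v = (if target d = (i, true) then 1 / 2 else 0) := by
  constructor
  · have : (fun w : Fin n ⊕ Fin n → ℂ => mid w i) = fun w =>
        (w (Sum.inl i) + 1 * star (w (Sum.inr i))) / 2 := by funext w; simp [mid]
    rw [this, dW_half_add]
    rcases d with ⟨j | j, b⟩ <;> cases b <;> by_cases h : j = i <;> simp [target, h]
  · have : (fun w : Fin n ⊕ Fin n → ℂ => star (mid w i)) = fun w =>
        (w (Sum.inr i) + 1 * star (w (Sum.inl i))) / 2 := by
      funext w; simp [mid, RCLike.star_def, add_comm]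
    rw [this, dW_half_add]
    rcases d with ⟨j | j, b⟩ <;> cases b <;> by_cases h : j = i <;> simp [target, h]

theorem dW_comp_mid {f : (Fin n → ℂ) → ℂ} {v : Fin n ⊕ Fin n → ℂ}
    (hf : DifferentiableAt ℝ f (mid v)) (d : (Fin n ⊕ Fin n) × Bool) :
    dW d (fun w => f (mid w)) v = 1 / 2 * dW (target d) f (mid v) := by
  rw [dW_comp hf (contDiff_mid.differentiable (by simp) v)]
  rcases h : target d with ⟨j, b⟩
  rw [Finset.sum_eq_single j]
  · rw [(dW_mid d j v).1, (dW_mid d j v).2, h]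
    cases b <;> simp [mul_comm]
  · intro i _ hi
    rw [(dW_mid d i v).1, (dW_mid d i v).2, h]
    simp [hi.symm]
  · simp

theorem maj_comp_mid {O : Set (Fin n ⊕ Fin n → ℂ)} (hO : IsOpen O) {V : Set (Fin n → ℂ)}
    (hV : IsOpen V) (hm : Set.MapsTo mid O V) {v : Fin n ⊕ Fin n → ℂ} (hv : v ∈ O)
    {f : (Fin n → ℂ) → ℂ} (hf : ContDiffOn ℝ ∞ f V) {M : ℕ → ℝ} (hM : ∀ k, 0 ≤ M k)
    (h : Maj (fun _ => 1) M f (mid v)) : Maj (fun _ => 1) M (fun w => f (mid w)) v := by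
  refine Maj.comp_linear hO hV (fun w _ => contDiff_mid.differentiable (by simp) w)
    contDiff_mid.contDiffOn hm (fun d c => if target d = c then 1 / 2 else 0)
    (fun w _ d i => dW_mid d i w) (fun d => ?_) hv hf hM (fun _ => zero_le_one) (Or.inr fun _ => rfl) h
  rw [Finset.sum_eq_single (target d)]
  · norm_num
  · intro c _ hc
    simp [hc.symm]
  · simp

/-! ### The Euclidean distance to the diagonal -/

/-- `|y - z̄|` as a function of `v = (y, z)`. -/
def cdist (v : Fin n ⊕ Fin n → ℂ) : ℝ :=
  conjDist (fun i => v (Sum.inl i)) (fun i => v (Sum.inr i))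

theorem cdist_nonneg (v : Fin n ⊕ Fin n → ℂ) : 0 ≤ cdist v := Real.sqrt_nonneg _

theorem incr_true (i : Fin n) (v : Fin n ⊕ Fin n → ℂ) :
    incr (i, true) v = -star (incr (i, false) v) := by
  simp [incr, RCLike.star_def]; ring

theorem norm_incr_le (c : Fin n × Bool) (v : Fin n ⊕ Fin n → ℂ) : ‖incr c v‖ ≤ cdist v / 2 := by
  have h : ∀ i, ‖incr (i, false) v‖ ≤ cdist v / 2 := fun i => by
    simp only [incr, cdist, conjDist, Bool.false_eq_true, if_false, norm_div, Complex.norm_ofNat]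
    gcongr
    refine Real.le_sqrt_of_sq_le ?_
    exact Finset.single_le_sum (f := fun i => ‖v (Sum.inl i) - star (v (Sum.inr i))‖ ^ 2)
      (fun _ _ => by positivity) (Finset.mem_univ i)
  rcases c with ⟨i, b⟩
  cases b
  · exact h i
  · rw [incr_true, norm_neg, norm_star]; exact h i

theorem cdist_sq (v : Fin n ⊕ Fin n → ℂ) :
    ((cdist v ^ 2 : ℝ) : ℂ) = -4 * ∑ i, incr (i, false) v * incr (i, true) v := by
  rw [cdist, conjDist, Real.sq_sqrt (by positivity), Complex.ofReal_sum, Finset.mul_sum]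
  refine Finset.sum_congr rfl fun i _ => ?_
  rw [incr_true]
  have h : v (Sum.inl i) - star (v (Sum.inr i)) = 2 * incr (i, false) v := by
    simp [incr]; ring
  rw [h, mul_neg, RCLike.star_def, Complex.mul_conj, Complex.normSq_eq_norm_sq, norm_mul,
    Complex.norm_ofNat]
  push_cast
  ring

theorem continuous_cdist : Continuous (cdist : (Fin n ⊕ Fin n → ℂ) → ℝ) := by
  unfold cdist conjDist
  fun_prop

/-- The square of the distance as a complex-valued function. -/
def cdistSq (v : Fin n ⊕ Fin n → ℂ) : ℂ := ((cdist v ^ 2 : ℝ) : ℂ)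

theorem contDiff_cdist_sq : ContDiff ℝ ∞ (fun v : Fin n ⊕ Fin n → ℂ => cdist v ^ 2) := by
  have h : (fun v : Fin n ⊕ Fin n → ℂ => cdist v ^ 2) =
      fun v => (-4 * ∑ i, incr (i, false) v * incr (i, true) v).re := by
    funext v
    rw [← cdist_sq, Complex.ofReal_re]
  rw [h]
  exact Complex.reCLM.contDiff.comp (contDiff_const.mul
    (ContDiff.sum fun i _ => (contDiff_incr _).mul (contDiff_incr _)))

theorem dW_cdistSq (d : (Fin n ⊕ Fin n) × Bool) (v : Fin n ⊕ Fin n → ℂ) :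
    dW d cdistSq v = -2 * incrSign d.2 * incr ((target d).1, !(target d).2) v := by
  have h : (cdistSq : (Fin n ⊕ Fin n → ℂ) → ℂ) =
      fun v => -4 * ∑ i, incr (i, false) v * incr (i, true) v := by
    funext v; exact cdist_sq v
  have hd : ∀ c, DifferentiableAt ℝ (incr c) v := fun c =>
    (contDiff_incr c).differentiable (by simp) v
  have hp : ∀ i : Fin n, DifferentiableAt ℝ (fun w => incr (i, false) w * incr (i, true) w) v :=
    fun i => (hd _).mul (hd _)
  rw [h, dW_const_mul (DifferentiableAt.fun_sum fun i _ => hp i), dW_sum _ fun i _ => hp i]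
  simp only [dW_mul (hd _) (hd _), dW_incr]
  rcases target d with ⟨j, b⟩
  rw [Finset.sum_eq_single j]
  · cases b <;> simp <;> ring
  · intro i _ hi
    simp [hi.symm]
  · simp

/-- An increment is real affine: its first derivatives are 0 or ±1/2, hence at most ρ · ρ⁻¹, and
longer words kill it. No factorials are needed, hence the order 0. -/
theorem maj_incr {c : Fin n × Bool} {v : Fin n ⊕ Fin n → ℂ} {ρ : ℝ} (hρ : 0 < ρ)
    (h : ‖incr c v‖ ≤ ρ) : Maj (fun _ => 1) (gev 0 ρ ρ⁻¹ 0) (incr c) v := by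
  intro L
  rcases L with _ | ⟨d, L⟩
  · simpa [gev] using h
  · have h1 : dW d (incr c) = fun _ => if target d = c then incrSign d.2 / 2 else 0 :=
      funext fun v => dW_incr d c v
    rw [dWord_cons, h1, dWord_const]
    rcases L with _ | ⟨d', L⟩
    · simp only [if_true, gev, List.length_cons, List.length_nil, Real.rpow_zero, mul_one, zero_add,
        pow_one, mul_inv_cancel₀ hρ.ne']
      split_ifs
      · rw [norm_div, norm_incrSign]; norm_num
      · simp
    · simp only [reduceCtorEq, if_false, norm_zero, mul_one]
      exact gev_nonneg hρ.le (by positivity) _ _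

/-- The differential of the squared distance is affine. At scale Λ its value is at most 2l · 1/(2Λ)
≤ Λ, its first derivatives are at most l ≤ Λ², and all others vanish. -/
theorem maj_dW_cdistSq {d : (Fin n ⊕ Fin n) × Bool} {v : Fin n ⊕ Fin n → ℂ} {Λ l : ℝ} (hΛ : 0 < Λ)
    (hl0 : 0 ≤ l) (hl : l ≤ Λ ^ 2) (h : Λ * cdist v ≤ 1) :
    Maj (fun _ => 1) (gev 0 Λ Λ 0) (fun w => (l : ℂ) * dW d cdistSq w) v := by
  have h0 : (fun w : Fin n ⊕ Fin n → ℂ => (l : ℂ) * dW d cdistSq w) = fun w =>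
      ((l : ℂ) * (-2 * incrSign d.2)) * incr ((target d).1, !(target d).2) w := by
    funext w; rw [dW_cdistSq]; ring
  rw [h0]
  have hρ : ‖incr ((target d).1, !(target d).2) v‖ ≤ 1 / (2 * Λ) := by
    refine (norm_incr_le _ _).trans ?_
    rw [div_le_div_iff₀ (by norm_num) (by positivity)]
    linarith
  have h1 := (maj_incr (by positivity) hρ).const_mul isOpen_univ (Set.mem_univ v)
    (contDiff_incr _).contDiffOn ((l : ℂ) * (-2 * incrSign d.2))
  have h2 : ‖(l : ℂ) * (-2 * incrSign d.2)‖ = 2 * l := by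
    rw [norm_mul, norm_mul, norm_incrSign, norm_neg, Complex.norm_ofNat, Complex.norm_real,
      Real.norm_of_nonneg hl0]
    ring
  intro L
  rcases L with _ | ⟨d', L⟩
  · refine (h1 []).trans ?_
    rw [h2]
    simp only [List.length_nil, gev, pow_zero, mul_one, Real.rpow_zero]
    rw [mul_one_div, div_le_iff₀ (by positivity)]
    nlinarith
  · rw [dWord_const_mul isOpen_univ (contDiff_incr _).contDiffOn _ _ (Set.mem_univ v), norm_mul, h2,
      dWord_cons]
    have h1 : dW d' (incr ((target d).1, !(target d).2)) = fun _ =>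
        if target d' = ((target d).1, !(target d).2) then incrSign d'.2 / 2 else 0 :=
      funext fun v => dW_incr d' _ v
    rw [h1, dWord_const]
    rcases L with _ | ⟨d'', L⟩
    · simp only [if_true, gev, List.length_cons, List.length_nil, Real.rpow_zero, mul_one, zero_add,
        pow_one]
      split_ifs
      · rw [norm_div, norm_incrSign, Complex.norm_ofNat]; nlinarith
      · simp only [norm_zero, mul_zero]; positivity
    · simp only [reduceCtorEq, if_false, norm_zero, mul_one, mul_zero]
      exact gev_nonneg hΛ.le hΛ.le _ _

/-! ### The cut-off function -/

theorem dW_ofReal_comp {φ : ℝ → ℝ} {h : (Fin n ⊕ Fin n → ℂ) → ℝ} {v : Fin n ⊕ Fin n → ℂ}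
    (hφ : Differentiable ℝ φ) (hh : DifferentiableAt ℝ h v) (d : (Fin n ⊕ Fin n) × Bool) :
    dW d (fun w => ((φ (h w) : ℝ) : ℂ)) v =
      ((deriv φ (h v) : ℝ) : ℂ) * dW d (fun w => ((h w : ℝ) : ℂ)) v := by
  have h1 : HasFDerivAt (fun w => ((h w : ℝ) : ℂ)) (Complex.ofRealCLM.comp (fderiv ℝ h v)) v :=
    Complex.ofRealCLM.hasFDerivAt.comp v hh.hasFDerivAt
  have h2 : HasFDerivAt (fun w => φ (h w)) (deriv φ (h v) • fderiv ℝ h v) v :=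
    (hφ (h v)).hasDerivAt.comp_hasFDerivAt v hh.hasFDerivAt
  have h3 : HasFDerivAt (fun w => ((φ (h w) : ℝ) : ℂ))
      (Complex.ofRealCLM.comp (deriv φ (h v) • fderiv ℝ h v)) v :=
    Complex.ofRealCLM.hasFDerivAt.comp v h2
  simp only [dW]
  rw [h1.fderiv, h3.fderiv, wirForm_apply, wirForm_apply]
  simp only [ContinuousLinearMap.comp_apply, smul_apply, smul_eq_mul,
    Complex.ofRealCLM_apply, Complex.ofReal_mul]
  ring

theorem contDiff_iteratedDeriv {χ : ℝ → ℝ} (hχ : ContDiff ℝ ∞ χ) (j : ℕ) :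
    ContDiff ℝ ∞ (iteratedDeriv j χ) := by
  induction j with
  | zero => simpa using hχ
  | succ j ih =>
    rw [iteratedDeriv_succ]
    exact (contDiff_infty_iff_deriv.1 ih).2

theorem contDiff_cutoff {χ : ℝ → ℝ} (hχ : ContDiff ℝ ∞ χ) (j : ℕ) (l : ℝ) :
    ContDiff ℝ ∞ (fun w : Fin n ⊕ Fin n → ℂ =>
      ((iteratedDeriv j χ (l * cdist w ^ 2) : ℝ) : ℂ)) := by
  have h1 : ContDiff ℝ ∞ (iteratedDeriv j χ) :=
    contDiff_iteratedDeriv hχ j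
  exact Complex.ofRealCLM.contDiff.comp (h1.comp (contDiff_const.mul contDiff_cdist_sq))

/-- Instead of Faà di Bruno's formula, all derivatives χ^{(j)} are treated at once by induction on
the word: one letter replaces χ^{(j)} by an affine factor times χ^{(j+1)}, and j is recorded as the
shift. In the radius (2 + 2 A₁) Λ, the 2Λ makes the affine factor harmless, and the 2 A₁ Λ pays for
the constants A₁ and 2Λ of one step. -/
theorem maj_cutoff {χ : ℝ → ℝ} (hχ : ContDiff ℝ ∞ χ) {A₀ A₁ σ : ℝ} (hA₀ : 0 < A₀) (hA₁ : 0 < A₁)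
    (hσ : 1 ≤ σ)
    (hb : ∀ (k : ℕ) (t : ℝ), |iteratedDeriv k χ t| ≤ A₀ * A₁ ^ k * (k.factorial : ℝ) ^ σ)
    {v : Fin n ⊕ Fin n → ℂ} {Λ l : ℝ} (hΛ : 0 < Λ) (hl0 : 0 ≤ l) (hl : l ≤ Λ ^ 2)
    (h : Λ * cdist v ≤ 1) :
    Maj (fun _ => 1) (gev σ A₀ ((2 + 2 * A₁) * Λ) 0)
      (fun w => ((χ (l * cdist w ^ 2) : ℝ) : ℂ)) v := by
  have hd : ∀ j d, Set.EqOn (dW d (fun w : Fin n ⊕ Fin n → ℂ =>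
      ((iteratedDeriv j χ (l * cdist w ^ 2) : ℝ) : ℂ)))
      (fun w => ((l : ℂ) * dW d cdistSq w) *
        ((iteratedDeriv (j + 1) χ (l * cdist w ^ 2) : ℝ) : ℂ)) Set.univ := by
    intro j d w _
    have h1 : ContDiff ℝ ∞ (iteratedDeriv j χ) :=
      contDiff_iteratedDeriv hχ j
    have h2 : DifferentiableAt ℝ (fun w : Fin n ⊕ Fin n → ℂ => cdist w ^ 2) w :=
      contDiff_cdist_sq.differentiable (by simp) w
    have h3 : DifferentiableAt ℝ (cdistSq : (Fin n ⊕ Fin n → ℂ) → ℂ) w :=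
      Complex.ofRealCLM.differentiableAt.comp w h2
    have h4 := dW_ofReal_comp (h1.differentiable (by simp)) (h2.const_mul l) d
    rw [h4, iteratedDeriv_succ, mul_comm]
    congr 1
    have h5 : (fun w : Fin n ⊕ Fin n → ℂ => ((l * cdist w ^ 2 : ℝ) : ℂ)) =
        fun w => (l : ℂ) * cdistSq w := by funext w; simp [cdistSq]
    rw [h5, dW_const_mul h3]
  have hcs : ContDiff ℝ ∞ (cdistSq : (Fin n ⊕ Fin n → ℂ) → ℂ) :=
    Complex.ofRealCLM.contDiff.comp contDiff_cdist_sq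
  have main : ∀ k, ∀ j, ∀ L : List ((Fin n ⊕ Fin n) × Bool), L.length ≤ k →
      ‖dWord L (fun w => ((iteratedDeriv j χ (l * cdist w ^ 2) : ℝ) : ℂ)) v‖ ≤
        gev σ (A₀ * A₁ ^ j) ((2 + 2 * A₁) * Λ) j L.length * 1 := by
    intro k
    induction k with
    | zero =>
      intro j L hL
      have : L = [] := List.length_eq_zero_iff.1 (by lia)
      subst this
      simpa [gev] using hb j (l * cdist v ^ 2)
    | succ k ih =>
      intro j L hL
      cases L with
      | nil => exact ih j [] (by simp)
      | cons d L =>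
        have hL' : L.length ≤ k := by simpa using hL
        rw [dWord_cons, dWord_congr isOpen_univ (hd j d) L (Set.mem_univ v)]
        have h1 := norm_dWord_mul_le (e₁ := fun _ => 1) (e₂ := fun _ => 1) (e := fun _ => 1)
          (M := gev σ Λ Λ 0) (N := gev σ (A₀ * A₁ ^ (j + 1)) ((2 + 2 * A₁) * Λ) (j + 1))
          isOpen_univ (Set.mem_univ v) L
          (contDiffOn_const.mul (contDiffOn_dW isOpen_univ hcs.contDiffOn d))
          (contDiff_cutoff hχ (j + 1) l).contDiffOn (gev_nonneg hΛ.le hΛ.le 0)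
          (gev_nonneg (by positivity) (by positivity) _)
          (fun L' _ => (maj_dW_cdistSq hΛ hl0 hl h L').trans
            (mul_le_mul_of_nonneg_right ?_ zero_le_one))
          (fun L' hL'' => ih (j + 1) L' (by lia)) (fun _ _ => by simp)
        · refine h1.trans (mul_le_mul_of_nonneg_right ?_ zero_le_one)
          refine (conv_gev_le_of_two_mul_le hσ hΛ.le hΛ.le (by positivity) (by nlinarith) _ _).trans ?_
          rw [List.length_cons, gev_succ_shift]
          refine gev_mono (by positivity) (by positivity) ?_ le_rfl _ _
          rw [pow_succ]
          have : 0 ≤ A₀ * A₁ ^ j * Λ := by positivity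
          nlinarith
        · unfold gev
          rw [Real.rpow_zero]
          refine mul_le_mul_of_nonneg_left ?_ (by positivity)
          refine Real.one_le_rpow ?_ (by linarith)
          exact_mod_cast Nat.factorial_pos _
  intro L
  simpa [iteratedDeriv_zero] using main L.length 0 L le_rfl

end

end BBS

namespace BBS

noncomputable section

variable {n : ℕ}

/-! ### Taylor terms -/

/-- The word of the multi-index `q`, where `q (i, false) = α_i` and `q (i, true) = β_i`. -/
def qword (q : Fin n × Bool → ℕ) : List (Fin n × Bool) :=
  indexWord (fun i => q (i, false)) (fun i => q (i, true))

theorem length_qword (q : Fin n × Bool → ℕ) : (qword q).length = size q := by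
  rw [qword, length_indexWord]
  simp only [size, Fintype.sum_prod_type, Fintype.sum_bool, Finset.sum_add_distrib]
  ring

theorem mfact_eq_mul (q : Fin n × Bool → ℕ) :
    mfact q = mfact (fun i => q (i, false)) * mfact (fun i => q (i, true)) := by
  simp only [mfact, Fintype.prod_prod_type, Fintype.prod_bool, Finset.prod_mul_distrib]
  ring

theorem count_qword (q : Fin n × Bool → ℕ) (c : Fin n × Bool) : (qword q).count c = q c := by
  rcases c with ⟨i, b⟩
  cases b
  · exact count_indexWord_false _ _ i
  · exact count_indexWord_true _ _ i

/-- The monomial `((y - z̄)/2)^α ((z - ȳ)/2)^β`. -/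
def mono (q : Fin n × Bool → ℕ) (v : Fin n ⊕ Fin n → ℂ) : ℂ := ∏ c, incr c v ^ q c

/-- The Taylor term `(D^α D̄^β f)((y+z̄)/2) / (α! β!) ((y - z̄)/2)^α ((z - ȳ)/2)^β`. -/
def taylorTerm (f : (Fin n → ℂ) → ℂ) (q : Fin n × Bool → ℕ) (v : Fin n ⊕ Fin n → ℂ) : ℂ :=
  (mfact q : ℂ)⁻¹ * (dWord (qword q) f (mid v) * mono q v)

/-- The scale `N^{2(a-1)} 4^{a-1} C₁²` in the cut-off function. -/
def cutScale (a C₁ : ℝ) (N : ℕ) : ℝ := (N : ℝ) ^ (2 * (a - 1)) * (4 : ℝ) ^ (a - 1) * C₁ ^ 2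

/-- Pairs of multi-indices as multi-indices on a product. -/
def indexEquiv : (Fin n × Bool → ℕ) ≃ (Fin n → ℕ) × (Fin n → ℕ) where
  toFun q := (fun i => q (i, false), fun i => q (i, true))
  invFun p c := if c.2 then p.2 c.1 else p.1 c.1
  left_inv q := by
    funext ⟨i, b⟩
    cases b <;> rfl
  right_inv p := rfl

theorem joint_ahe (a C₁ : ℝ) (χ : ℝ → ℝ) (f : (Fin n → ℂ) → ℂ) (v : Fin n ⊕ Fin n → ℂ) :
    joint (ahe a C₁ χ f) v = ∑' q : Fin n × Bool → ℕ,
      taylorTerm f q v * ((χ (cutScale a C₁ (size q) * cdist v ^ 2) : ℝ) : ℂ) := by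
  unfold joint ahe
  rw [← (indexEquiv (n := n)).tsum_eq]
  refine tsum_congr fun q => ?_
  have hs : size ((indexEquiv q).1 + (indexEquiv q).2) = size q := by
    rw [← length_qword, qword, length_indexWord]
    simp [size, indexEquiv, Finset.sum_add_distrib]
  have hm : mono q v = (∏ i, ((v (Sum.inl i) - star (v (Sum.inr i))) / 2) ^ (indexEquiv q).1 i) *
      ∏ i, ((v (Sum.inr i) - star (v (Sum.inl i))) / 2) ^ (indexEquiv q).2 i := by
    simp only [mono, Fintype.prod_prod_type, Fintype.prod_bool, Finset.prod_mul_distrib]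
    rw [mul_comm]
    rfl
  rw [hs, wirtinger_eq_dWord, taylorTerm, hm, mfact_eq_mul]
  have hc : cutScale a C₁ (size q) * cdist v ^ 2 = (size q : ℝ) ^ (2 * (a - 1)) *
      (4 : ℝ) ^ (a - 1) * C₁ ^ 2 *
        conjDist (fun i => v (Sum.inl i)) (fun i => v (Sum.inr i)) ^ 2 := rfl
  rw [hc]
  change dWord (qword q) f (mid v) / ((mfact (fun i => q (i, false)) *
    mfact (fun i => q (i, true)) : ℕ) : ℂ) * _ * _ * _ = _
  rw [div_eq_mul_inv]
  ring

theorem contDiff_mono (q : Fin n × Bool → ℕ) : ContDiff ℝ ∞ (mono q) :=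
  contDiff_prod fun c _ => (contDiff_incr c).pow _

/-- Multiplying k copies of `maj_incr` adds k radii ρ⁻¹. At most j factors k come down after j
derivatives, which matches (k/ρ)^j. -/
theorem maj_incr_pow {c : Fin n × Bool} {v : Fin n ⊕ Fin n → ℂ} {ρ : ℝ} (hρ : 0 < ρ)
    (h : ‖incr c v‖ ≤ ρ) (k : ℕ) :
    Maj (fun _ => 1) (gev 0 (ρ ^ k) (k * ρ⁻¹) 0) (fun w => incr c w ^ k) v := by
  induction k with
  | zero =>
    simp only [pow_zero, CharP.cast_eq_zero, zero_mul]
    exact maj_const 1 (fun _ => zero_le_one) le_rfl (gev_nonneg zero_le_one le_rfl 0)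
      (by simp [gev])
  | succ k ih =>
    have h1 := ih.mul isOpen_univ (Set.mem_univ v) ((contDiff_incr c).pow k).contDiffOn
      (contDiff_incr c).contDiffOn (e := fun _ => 1) (gev_nonneg (by positivity) (by positivity) 0)
      (gev_nonneg hρ.le (by positivity) 0) (maj_incr hρ h) (fun _ _ => by simp)
    have h2 := h1.mono (N := gev 0 (ρ ^ (k + 1)) ((k + 1 : ℕ) * ρ⁻¹) 0) (fun j => ?_)
      (fun _ => zero_le_one)
    · simpa only [pow_succ] using h2
    · refine (conv_gev_le le_rfl (by positivity) (by positivity) hρ.le (by positivity) j).trans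
        (le_of_eq ?_)
      congr 1
      push_cast; ring

theorem maj_mono {v : Fin n ⊕ Fin n → ℂ} {ρ : ℝ} (hρ : 0 < ρ)
    (h : ∀ c, ‖incr c v‖ ≤ ρ) (q : Fin n × Bool → ℕ) :
    Maj (fun _ => 1) (gev 0 (ρ ^ size q) (size q * ρ⁻¹) 0) (mono q) v := by
  have key : ∀ s : Finset (Fin n × Bool), Maj (fun _ => 1)
      (gev 0 (ρ ^ (∑ c ∈ s, q c)) ((∑ c ∈ s, q c : ℕ) * ρ⁻¹) 0)
      (fun w => ∏ c ∈ s, incr c w ^ q c) v := by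
    intro s
    induction s using Finset.induction_on with
    | empty =>
      simp only [Finset.prod_empty, Finset.sum_empty, pow_zero, CharP.cast_eq_zero, zero_mul]
      exact maj_const 1 (fun _ => zero_le_one) le_rfl (gev_nonneg zero_le_one le_rfl 0)
        (by simp [gev])
    | insert c s hc ih =>
      have h1 := (maj_incr_pow hρ (h c) (q c)).mul isOpen_univ (Set.mem_univ v)
        ((contDiff_incr c).pow (q c)).contDiffOn
        (contDiff_prod fun d _ => (contDiff_incr d).pow (q d)).contDiffOn (e := fun _ => 1)
        (gev_nonneg (by positivity) (by positivity) 0)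
        (gev_nonneg (by positivity) (by positivity) 0) ih (fun _ _ => by simp)
      have h2 := h1.mono (N := gev 0 (ρ ^ (q c + ∑ d ∈ s, q d))
        ((q c + ∑ d ∈ s, q d : ℕ) * ρ⁻¹) 0) (fun j => ?_) (fun _ => zero_le_one)
      · rw [Finset.sum_insert hc]
        simpa only [Finset.prod_insert hc] using h2
      · refine (conv_gev_le le_rfl (by positivity) (by positivity) (by positivity)
          (by positivity) j).trans (le_of_eq ?_)
        rw [pow_add]
        congr 1
        push_cast; ring
  exact key Finset.univ

/-! ### Numerical estimates -/

/-- The constant in `(N+j)^j ≤ K^j j! 2^{N/6}`. -/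
def lossConst : ℝ := Real.exp (Real.log 2 / 6) / (Real.log 2 / 6)

theorem lossConst_pos : 0 < lossConst := by
  have := Real.log_pos (by norm_num : (1 : ℝ) < 2)
  unfold lossConst; positivity

/-- Apply x^j / j! ≤ e^x to x = (N+j) log 2 / 6. A power of the degree N is traded for j! at the
cost 2^{N/6}; the 1/6 is chosen so that three such losses, raised to the power a, consume only half
of the decay 2^{-aN}. -/
theorem add_pow_le_lossConst (N j : ℕ) :
    ((N + j : ℕ) : ℝ) ^ j ≤ lossConst ^ j * j.factorial * ((2 : ℝ) ^ (1 / 6 : ℝ)) ^ N := by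
  have hl := Real.log_pos (by norm_num : (1 : ℝ) < 2)
  set t := Real.log 2 / 6 with ht
  have ht0 : 0 < t := by positivity
  have h1 := Real.pow_div_factorial_le_exp (t * ((N + j : ℕ) : ℝ)) (by positivity) j
  have h2 : (2 : ℝ) ^ (1 / 6 : ℝ) = Real.exp t := by
    rw [Real.rpow_def_of_pos (by norm_num), ht]; ring_nf
  have h3 : Real.exp (t * ((N + j : ℕ) : ℝ)) = Real.exp t ^ N * Real.exp t ^ j := by
    rw [← pow_add, ← Real.exp_nat_mul, mul_comm]
  rw [h3, mul_pow, div_le_iff₀ (by positivity)] at h1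
  rw [h2, lossConst, ← ht, div_pow]
  have h4 : ((N + j : ℕ) : ℝ) ^ j = (t ^ j * ((N + j : ℕ) : ℝ) ^ j) / t ^ j := by
    field_simp
  rw [h4, div_le_iff₀ (by positivity)]
  refine h1.trans (le_of_eq ?_)
  field_simp

theorem add_pow_rpow_le {a : ℝ} (ha : 0 ≤ a) (N j : ℕ) :
    (((N + j : ℕ) : ℝ) ^ j) ^ a ≤
      (lossConst ^ a) ^ j * (j.factorial : ℝ) ^ a * ((2 : ℝ) ^ (a / 6)) ^ N := by
  have hK := lossConst_pos
  refine (Real.rpow_le_rpow (by positivity) (add_pow_le_lossConst N j) ha).trans (le_of_eq ?_)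
  rw [Real.mul_rpow (by positivity) (by positivity), Real.mul_rpow (by positivity) (by positivity)]
  congr 1
  · congr 1
    rw [← Real.rpow_natCast, ← Real.rpow_mul hK.le, mul_comm, Real.rpow_mul hK.le,
      Real.rpow_natCast]
  · rw [← Real.rpow_natCast, ← Real.rpow_natCast, ← Real.rpow_mul (by positivity),
      ← Real.rpow_mul (by positivity), ← Real.rpow_mul (by positivity)]
    congr 1; ring

/-- The inverse length scale `Λ_N` of the `N`-th cut-off function. -/
def invScale (a C₁ : ℝ) (N : ℕ) : ℝ := C₁ * 2 ^ (a - 1) * ((max N 1 : ℕ) : ℝ) ^ (a - 1)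

theorem invScale_pos {a C₁ : ℝ} (hC₁ : 0 < C₁) (N : ℕ) : 0 < invScale a C₁ N := by
  unfold invScale
  have : (0 : ℝ) < (max N 1 : ℕ) := by exact_mod_cast (by lia : 0 < max N 1)
  positivity

theorem cutScale_nonneg (a C₁ : ℝ) (N : ℕ) : 0 ≤ cutScale a C₁ N := by
  unfold cutScale; positivity

theorem cutScale_eq {a C₁ : ℝ} {N : ℕ} (hN : 1 ≤ N) :
    cutScale a C₁ N = invScale a C₁ N ^ 2 := by
  unfold cutScale invScale
  rw [max_eq_left hN, mul_pow, mul_pow, ← Real.rpow_natCast (_ ^ (a - 1)) 2, ←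
    Real.rpow_natCast (_ ^ (a - 1)) 2, ← Real.rpow_mul (by norm_num), ← Real.rpow_mul (by positivity),
    show (4 : ℝ) = 2 ^ (2 : ℝ) by norm_num, ← Real.rpow_mul (by norm_num)]
  push_cast
  rw [mul_comm (a - 1) 2]
  ring

theorem cutScale_le {a C₁ : ℝ} (ha : 1 < a) (N : ℕ) :
    cutScale a C₁ N ≤ invScale a C₁ N ^ 2 := by
  rcases Nat.eq_zero_or_pos N with rfl | hN
  · have : cutScale a C₁ 0 = 0 := by
      unfold cutScale
      rw [CharP.cast_eq_zero, Real.zero_rpow (by linarith)]; simp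
    rw [this]; positivity
  · exact (cutScale_eq hN).le

/-- The exponential smallness of the Taylor coefficients at the cut-off scale. -/
theorem taylor_const_le {a C₁ : ℝ} (ha : 1 < a) (hC₁ : 0 < C₁) {N : ℕ} {m : ℝ} (hm0 : 0 < m)
    (hm : m ≤ (N : ℝ) ^ N) :
    m⁻¹ * ((C₁ * 2 ^ (a / 6)) ^ N * m ^ a * ((2 * invScale a C₁ N)⁻¹ ^ N *
      ((2 : ℝ) ^ (a / 6)) ^ (max N 1)) * ((2 : ℝ) ^ (a / 6)) ^ (max N 1)) ≤
      2 ^ (a / 3) * ((2 : ℝ) ^ (-(a / 2))) ^ N := by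
  set Q : ℝ := 2 ^ (a / 6) with hQ
  have hQ1 : 1 ≤ Q := Real.one_le_rpow (by norm_num) (by linarith)
  have hQ0 : 0 < Q := by positivity
  set x : ℝ := ((max N 1 : ℕ) : ℝ) ^ (a - 1) with hx
  have hN0 : (0 : ℝ) < (max N 1 : ℕ) := by exact_mod_cast (by lia : 0 < max N 1)
  have hx0 : 0 < x := by positivity
  -- The Taylor coefficient contributes m^{a-1} ≤ N^{(a-1)N}, which the scale N^{a-1} inside each of
  -- the N increments cancels exactly.
  have h1 : m⁻¹ * m ^ a ≤ x ^ N := by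
    have h2 : m⁻¹ * m ^ a = m ^ (a - 1) := by
      rw [Real.rpow_sub_one hm0.ne']; ring
    rw [h2]
    have h3 : m ≤ ((max N 1 : ℕ) : ℝ) ^ N := hm.trans (by
      gcongr
      exact_mod_cast le_max_left N 1)
    refine (Real.rpow_le_rpow hm0.le h3 (by linarith)).trans (le_of_eq ?_)
    rw [hx, ← Real.rpow_natCast, ← Real.rpow_mul hN0.le, mul_comm, Real.rpow_mul hN0.le,
      Real.rpow_natCast]
  have h4 : (2 * invScale a C₁ N)⁻¹ = (2 ^ (-a)) * C₁⁻¹ * x⁻¹ := by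
    unfold invScale
    rw [← hx, Real.rpow_neg (by norm_num), show (2 : ℝ) ^ a = 2 * 2 ^ (a - 1) by
      rw [Real.rpow_sub_one (by norm_num)]; ring]
    simp only [mul_inv]
    ring
  have h5 : Q ^ (max N 1) ≤ Q ^ (N + 1) := pow_le_pow_right₀ hQ1 (by lia)
  -- The decay 2^{-a} per degree is reduced by three losses of 2^{a/6}, coming from the potential,
  -- the monomial and the cut-off.
  have h6 : Q ^ 3 * 2 ^ (-a) = (2 : ℝ) ^ (-(a / 2)) := by
    rw [hQ, ← Real.rpow_natCast, ← Real.rpow_mul (by norm_num), ← Real.rpow_add (by norm_num)]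
    congr 1; push_cast; ring
  have h7 : Q ^ 2 = 2 ^ (a / 3) := by
    rw [hQ, ← Real.rpow_natCast, ← Real.rpow_mul (by norm_num)]
    congr 1; push_cast; ring
  rw [h4]
  calc m⁻¹ * ((C₁ * Q) ^ N * m ^ a * ((2 ^ (-a) * C₁⁻¹ * x⁻¹) ^ N * Q ^ max N 1) * Q ^ max N 1)
      = (m⁻¹ * m ^ a) * ((C₁ * Q) ^ N * (2 ^ (-a) * C₁⁻¹ * x⁻¹) ^ N) * (Q ^ max N 1 * Q ^ max N 1) := by
        ring
    _ ≤ x ^ N * ((C₁ * Q) ^ N * (2 ^ (-a) * C₁⁻¹ * x⁻¹) ^ N) * (Q ^ (N + 1) * Q ^ (N + 1)) := by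
        gcongr
    _ = (x * (C₁ * Q) * (2 ^ (-a) * C₁⁻¹ * x⁻¹) * Q * Q) ^ N * Q ^ 2 := by
        rw [pow_succ]; simp only [mul_pow]; ring
    _ = (Q ^ 3 * 2 ^ (-a)) ^ N * Q ^ 2 := by
        congr 2; field_simp
    _ = _ := by rw [h6, h7]; ring

/-! ### Bounds for the terms of the extension -/

/-- Gevrey bounds for all derivatives of `f` on `V`, in the form used for Taylor terms. -/
def PotBound (a C₁ C R : ℝ) (V : Set (Fin n → ℂ)) (f : (Fin n → ℂ) → ℂ) : Prop :=
  ContDiffOn ℝ ∞ f V ∧ ∀ q, ∀ u ∈ V, Maj (fun _ => 1)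
    (gev a (C * ((C₁ * 2 ^ (a / 6)) ^ size q * (mfact q : ℝ) ^ a)) R 0) (dWord (qword q) f) u

/-- Append the word to the Taylor index and sort. The joint factorial weight splits by
`wordFact_append_le`, and `add_pow_rpow_le` turns the cross term into j!^a, a radius, and the loss
2^{aN/6}. -/
theorem GevreyWith.potBound {a C₀ C₁ : ℝ} (ha : 0 ≤ a) (hC₀ : 0 ≤ C₀) (hC₁ : 0 ≤ C₁)
    {V : Set (Fin n → ℂ)} (hV : IsOpen V) {f : (Fin n → ℂ) → ℂ} (hf : GevreyWith a C₀ C₁ V f) :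
    PotBound a C₁ C₀ (C₁ * lossConst ^ a) V f := by
  refine ⟨hf.smooth, fun q u hu L => ?_⟩
  rw [← dWord_append, dWord_perm hV (perm_indexWord _) hf.smooth hu, ← wirtinger_eq_dWord]
  refine (hf.bound _ _ u hu).trans ?_
  rw [← length_eq_sum_count]
  have h1 : mfact (fun j => (qword q ++ L).count (j, false)) *
      mfact (fun j => (qword q ++ L).count (j, true)) = wordFact (L ++ qword q) := by
    simp only [wordFact, List.count_append, add_comm]
  have h2 := wordFact_append_le L (qword q)
  have h3 : wordFact (qword q) = mfact q := by
    rw [qword, wordFact_indexWord, mfact_eq_mul]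
  rw [h1, List.length_append, length_qword, mul_one]
  rw [length_qword, h3] at h2
  have h4 : ((wordFact (L ++ qword q) : ℕ) : ℝ) ^ a ≤
      ((lossConst ^ a) ^ L.length * (L.length.factorial : ℝ) ^ a * ((2 : ℝ) ^ (a / 6)) ^ size q) *
        (mfact q : ℝ) ^ a := by
    have h5 : ((wordFact (L ++ qword q) : ℕ) : ℝ) ≤
        ((size q + L.length : ℕ) : ℝ) ^ L.length * (mfact q : ℝ) := by
      rw [add_comm (size q)]; exact_mod_cast h2
    refine (Real.rpow_le_rpow (by positivity) h5 ha).trans ?_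
    rw [Real.mul_rpow (by positivity) (by positivity)]
    gcongr
    exact add_pow_rpow_le ha _ _
  refine (mul_le_mul_of_nonneg_left h4 (by positivity)).trans (le_of_eq ?_)
  unfold gev
  rw [pow_add, mul_pow, mul_pow, add_zero]
  ring

theorem perm_cons_qword (c : Fin n × Bool) (q : Fin n × Bool → ℕ) :
    (c :: qword q).Perm (qword q ++ [c]) := by
  simpa using (List.perm_append_comm : ([c] ++ qword q).Perm (qword q ++ [c]))

theorem PotBound.dW {a C₁ C R : ℝ} (ha : 0 ≤ a) (hC : 0 ≤ C) (hC₁ : 0 ≤ C₁) (hR : 0 ≤ R)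
    {V : Set (Fin n → ℂ)} (hV : IsOpen V) {f : (Fin n → ℂ) → ℂ} (hf : PotBound a C₁ C R V f)
    (c : Fin n × Bool) : PotBound a C₁ (C * R) (2 ^ a * R) V (dW c f) := by
  refine ⟨contDiffOn_dW hV hf.1 c, fun q u hu => ?_⟩
  have h1 : Set.EqOn (BBS.dW c (dWord (qword q) f)) (dWord (qword q) (BBS.dW c f)) V :=
    fun w hw => by
      have := dWord_perm hV (perm_cons_qword c q) hf.1 hw
      rw [dWord_append] at this
      exact this.symm
  refine ((((hf.2 q u hu).dW c).congr hV hu h1)).mono (fun k => ?_) (fun _ => zero_le_one)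
  refine (gev_succ_le ha (by positivity) hR k).trans (le_of_eq ?_)
  congr 1; ring

theorem contDiffOn_taylorTerm {V : Set (Fin n → ℂ)} (hV : IsOpen V) {f : (Fin n → ℂ) → ℂ}
    (hf : ContDiffOn ℝ ∞ f V) {O : Set (Fin n ⊕ Fin n → ℂ)} (hm : Set.MapsTo mid O V)
    (q : Fin n × Bool → ℕ) : ContDiffOn ℝ ∞ (taylorTerm f q) O :=
  contDiffOn_const.mul (((contDiffOn_dWord hV hf _).comp contDiff_mid.contDiffOn hm).mul
    (contDiff_mono q).contDiffOn)

theorem gev_le_gev_exponent {s s' C R : ℝ} (hC : 0 ≤ C) (hR : 0 ≤ R) (h : s ≤ s') (N k : ℕ) :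
    gev s C R N k ≤ gev s' C R N k := by
  unfold gev
  have : (1 : ℝ) ≤ ((k + N).factorial : ℝ) := by exact_mod_cast Nat.factorial_pos _
  gcongr

/-- The radius in the Gevrey bound of the terms of the extension. -/
def termRadius (a C₁ R B : ℝ) : ℝ :=
  R + 2 ^ a * C₁ * lossConst ^ a + B * C₁ * 2 ^ (a - 1) * lossConst ^ (a - 1)

/-- The product of three majorants, of orders a (potential), a (monomial, since a derivative costs N
Λ_N, of order N^a) and a - 1 + σ (the factor g, with radius of order Λ_N). With σ = 1 + ε for the
cut-off the order is a + ε; with g = 1 and σ = 1 it is a. -/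
theorem maj_taylorTerm_mul {a C₁ C R : ℝ} (ha : 1 < a) (hC : 0 ≤ C) (hC₁ : 0 < C₁) (hR : 0 ≤ R)
    {V : Set (Fin n → ℂ)} (hV : IsOpen V) {f : (Fin n → ℂ) → ℂ} (hf : PotBound a C₁ C R V f)
    {O : Set (Fin n ⊕ Fin n → ℂ)} (hO : IsOpen O) (hm : Set.MapsTo mid O V)
    {v : Fin n ⊕ Fin n → ℂ} (hv : v ∈ O) (q : Fin n × Bool → ℕ)
    (hΛ : invScale a C₁ (size q) * cdist v ≤ 1) {g : (Fin n ⊕ Fin n → ℂ) → ℂ}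
    (hg : ContDiffOn ℝ ∞ g O) {σ A B : ℝ} (hσ : 1 ≤ σ) (hA : 0 ≤ A) (hB : 0 ≤ B)
    (hgM : Maj (fun _ => 1) (gev σ A (B * invScale a C₁ (size q)) 0) g v) :
    Maj (fun _ => 1) (gev (a - 1 + σ) (C * A * 2 ^ (a / 3) * ((2 : ℝ) ^ (-(a / 2))) ^ size q)
      (termRadius a C₁ R B) 0) (fun w => taylorTerm f q w * g w) v := by
  have hK := lossConst_pos
  set N := size q with hN
  set N' := max N 1 with hN'
  have hN'0 : (0 : ℝ) < N' := by exact_mod_cast (by lia : 0 < N')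
  set Λ := invScale a C₁ N with hΛdef
  have hΛ0 : 0 < Λ := invScale_pos hC₁ N
  set s := a - 1 + σ with hs
  set Q : ℝ := 2 ^ (a / 6) with hQ
  have hQ1 : 1 ≤ Q := Real.one_le_rpow (by norm_num) (by linarith)
  have hpowN : ∀ {t : ℝ}, 0 ≤ t → ∀ j : ℕ, ((N' : ℝ) ^ j) ^ t ≤
      (lossConst ^ t) ^ j * (j.factorial : ℝ) ^ t * ((2 : ℝ) ^ (t / 6)) ^ N' := fun {t} ht j =>
    (Real.rpow_le_rpow (by positivity) (by gcongr; exact_mod_cast Nat.le_add_right N' j) ht).trans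
      (add_pow_rpow_le ht N' j)
  have hrp : ∀ j : ℕ, ∀ t : ℝ, ((N' : ℝ) ^ t) ^ j = ((N' : ℝ) ^ j) ^ t := fun j t => by
    rw [← Real.rpow_natCast, ← Real.rpow_mul hN'0.le, mul_comm, Real.rpow_mul hN'0.le,
      Real.rpow_natCast]
  have hmf : (0 : ℝ) < mfact q := by exact_mod_cast mfact_pos q
  -- the derivatives of the potential
  have G1 : Maj (fun _ => 1) (gev s (C * ((C₁ * Q) ^ N * (mfact q : ℝ) ^ a)) R 0)
      (fun w => dWord (qword q) f (mid w)) v :=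
    (maj_comp_mid hO hV hm hv (contDiffOn_dWord hV hf.1 _) (gev_nonneg (by positivity) hR 0)
      (hf.2 q _ (hm hv))).mono (gev_le_gev_exponent (by positivity) hR (by linarith) 0)
        fun _ => zero_le_one
  -- the monomial
  have hρ : ∀ c, ‖incr c v‖ ≤ (2 * Λ)⁻¹ := fun c => by
    refine (norm_incr_le c v).trans ?_
    rw [← one_div, div_le_div_iff₀ (by norm_num) (by positivity)]
    linarith
  have G2 : Maj (fun _ => 1) (gev s ((2 * Λ)⁻¹ ^ N * Q ^ N') (2 ^ a * C₁ * lossConst ^ a) 0)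
      (mono q) v := by
    refine (maj_mono (by positivity) hρ q).mono (fun j => ?_) fun _ => zero_le_one
    refine le_trans ?_ (gev_le_gev_exponent (s := a) (by positivity) (by positivity)
      (by linarith) 0 j)
    unfold gev
    rw [Real.rpow_zero, mul_one, inv_inv, ← hN, add_zero]
    -- One derivative of the monomial brings down a factor N and removes an increment of size
    -- 1/(2Λ).
    have h1 : (N : ℝ) * (2 * Λ) ≤ 2 ^ a * C₁ * (N' : ℝ) ^ a := by
      rw [hΛdef, invScale, ← hN']
      have h2 : (2 : ℝ) ^ a = 2 * 2 ^ (a - 1) := by rw [Real.rpow_sub_one (by norm_num)]; ring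
      have h3 : (N' : ℝ) ^ a = N' * (N' : ℝ) ^ (a - 1) := by
        rw [Real.rpow_sub_one hN'0.ne']; field_simp
      have h4 : (N : ℝ) ≤ N' := by exact_mod_cast le_max_left N 1
      rw [h2, h3]
      calc (N : ℝ) * (2 * (C₁ * 2 ^ (a - 1) * (N' : ℝ) ^ (a - 1)))
          ≤ N' * (2 * (C₁ * 2 ^ (a - 1) * (N' : ℝ) ^ (a - 1))) := by gcongr
        _ = _ := by ring
    calc (2 * Λ)⁻¹ ^ N * ((N : ℝ) * (2 * Λ)) ^ j
        ≤ (2 * Λ)⁻¹ ^ N * (2 ^ a * C₁ * (N' : ℝ) ^ a) ^ j := by gcongr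
      _ = (2 * Λ)⁻¹ ^ N * (2 ^ a * C₁) ^ j * ((N' : ℝ) ^ j) ^ a := by
          rw [mul_pow _ ((N' : ℝ) ^ a), hrp]; ring
      _ ≤ (2 * Λ)⁻¹ ^ N * (2 ^ a * C₁) ^ j *
          ((lossConst ^ a) ^ j * (j.factorial : ℝ) ^ a * Q ^ N') := by
          gcongr
          exact hpowN (by linarith) j
      _ = _ := by rw [mul_pow _ (lossConst ^ a)]; ring
  -- the cut-off
  have G3 : Maj (fun _ => 1) (gev s (A * Q ^ N') (B * C₁ * 2 ^ (a - 1) * lossConst ^ (a - 1)) 0)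
      g v := by
    refine hgM.mono (fun j => ?_) fun _ => zero_le_one
    unfold gev
    rw [add_zero, hΛdef, invScale, ← hN', hs,
      Real.rpow_add (by exact_mod_cast Nat.factorial_pos j)]
    have h1 := hpowN (t := a - 1) (by linarith) j
    have h2 : ((2 : ℝ) ^ ((a - 1) / 6)) ^ N' ≤ Q ^ N' := by
      rw [hQ]
      gcongr
      · norm_num
      · linarith
    calc A * (B * (C₁ * 2 ^ (a - 1) * (N' : ℝ) ^ (a - 1))) ^ j * (j.factorial : ℝ) ^ σ
        = A * (B * C₁ * 2 ^ (a - 1)) ^ j * ((N' : ℝ) ^ j) ^ (a - 1) * (j.factorial : ℝ) ^ σ := by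
          rw [← hrp]; simp only [mul_pow]; ring
      _ ≤ A * (B * C₁ * 2 ^ (a - 1)) ^ j * ((lossConst ^ (a - 1)) ^ j *
          (j.factorial : ℝ) ^ (a - 1) * Q ^ N') * (j.factorial : ℝ) ^ σ := by
          gcongr
          exact h1.trans (by gcongr)
      _ = _ := by simp only [mul_pow]; ring
  have hs0 : 0 ≤ s := by linarith
  have hsm1 : ContDiffOn ℝ ∞ (fun w => dWord (qword q) f (mid w)) O :=
    (contDiffOn_dWord hV hf.1 _).comp contDiff_mid.contDiffOn hm
  have hsm2 : ContDiffOn ℝ ∞ (mono q) O := (contDiff_mono q).contDiffOn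
  have hR2 : 0 ≤ 2 ^ a * C₁ * lossConst ^ a := by positivity
  have hR3 : 0 ≤ B * C₁ * 2 ^ (a - 1) * lossConst ^ (a - 1) := by positivity
  have G12 := (G1.mul hO hv hsm1 hsm2 (gev_nonneg (by positivity) hR 0)
    (gev_nonneg (by positivity) hR2 0) G2 (e := fun _ => 1) (fun _ _ => by simp)).mono
      (conv_gev_le hs0 (by positivity) hR (by positivity) hR2) fun _ => zero_le_one
  have G123 := (G12.mul hO hv (hsm1.mul hsm2) hg (gev_nonneg (by positivity) (by positivity) 0)
    (gev_nonneg (by positivity) hR3 0) G3 (e := fun _ => 1) (fun _ _ => by simp)).mono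
      (conv_gev_le hs0 (by positivity) (by positivity) (by positivity) hR3) fun _ => zero_le_one
  have G := G123.const_mul hO hv ((hsm1.mul hsm2).mul hg) (mfact q : ℂ)⁻¹
  have hfin : Maj (fun _ => 1) (gev s (C * A * 2 ^ (a / 3) * ((2 : ℝ) ^ (-(a / 2))) ^ N)
      (termRadius a C₁ R B) 0)
      (fun w => (mfact q : ℂ)⁻¹ * (dWord (qword q) f (mid w) * mono q w * g w)) v := by
    refine G.mono (fun j => ?_) fun _ => zero_le_one
    have hle := taylor_const_le ha hC₁ (N := N) hmf (by
      have := mfact_mul_mfact_le (fun i => q (i, false)) (fun i => q (i, true))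
      rw [← mfact_eq_mul] at this
      have h2 : size (fun i => q (i, false)) + size (fun i => q (i, true)) = N := by
        rw [hN, ← length_qword, qword, length_indexWord]
      rw [h2] at this
      exact_mod_cast this)
    rw [← hQ, ← hN', ← hΛdef] at hle
    rw [norm_inv, Complex.norm_natCast]
    unfold gev termRadius
    calc _ = (C * A * ((mfact q : ℝ)⁻¹ * ((C₁ * Q) ^ N * (mfact q : ℝ) ^ a *
          ((2 * Λ)⁻¹ ^ N * Q ^ N') * Q ^ N'))) *
          (R + 2 ^ a * C₁ * lossConst ^ a + B * C₁ * 2 ^ (a - 1) * lossConst ^ (a - 1)) ^ j *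
            ((j + 0).factorial : ℝ) ^ s := by ring
      _ ≤ (C * A * (2 ^ (a / 3) * ((2 : ℝ) ^ (-(a / 2))) ^ N)) *
          (R + 2 ^ a * C₁ * lossConst ^ a + B * C₁ * 2 ^ (a - 1) * lossConst ^ (a - 1)) ^ j *
            ((j + 0).factorial : ℝ) ^ s := by gcongr
      _ = _ := by ring
  refine hfin.congr isOpen_univ (Set.mem_univ v) fun w _ => ?_
  simp only [taylorTerm]
  ring

end

end BBS

namespace BBS

noncomputable section

variable {n : ℕ}

/-! ### Derivatives of Taylor terms -/

theorem dW_incr_pow (d : (Fin n ⊕ Fin n) × Bool) (c : Fin n × Bool) (k : ℕ)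
    (v : Fin n ⊕ Fin n → ℂ) : dW d (fun w => incr c w ^ k) v =
      if target d = c then incrSign d.2 / 2 * (k * incr c v ^ (k - 1)) else 0 := by
  induction k with
  | zero => simp [dW_const]
  | succ k ih =>
    have h1 : DifferentiableAt ℝ (fun w => incr c w ^ k) v :=
      ((contDiff_incr c).pow k).differentiable (by simp) v
    have h2 : DifferentiableAt ℝ (incr c) v := (contDiff_incr c).differentiable (by simp) v
    simp only [pow_succ]
    rw [dW_mul h1 h2, ih, dW_incr]
    split_ifs
    · rcases k with _ | k
      · simp
      · simp only [Nat.add_sub_cancel, pow_succ]; push_cast; ring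
    · simp

theorem dW_prod_incr_pow (d : (Fin n ⊕ Fin n) × Bool) (q : Fin n × Bool → ℕ)
    (s : Finset (Fin n × Bool)) (hs : target d ∉ s) (v : Fin n ⊕ Fin n → ℂ) :
    dW d (fun w => ∏ c ∈ s, incr c w ^ q c) v = 0 := by
  induction s using Finset.induction_on with
  | empty => simp [dW_const]
  | insert c s hc ih =>
    simp only [Finset.prod_insert hc]
    have h1 : DifferentiableAt ℝ (fun w => incr c w ^ q c) v :=
      ((contDiff_incr c).pow _).differentiable (by simp) v
    have h2 : DifferentiableAt ℝ (fun w => ∏ c ∈ s, incr c w ^ q c) v :=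
      (contDiff_prod fun c _ => (contDiff_incr c).pow _).differentiable (by simp) v
    rw [Finset.mem_insert, not_or] at hs
    rw [dW_mul h1 h2, ih hs.2, dW_incr_pow, if_neg hs.1]
    simp

theorem dW_mono (d : (Fin n ⊕ Fin n) × Bool) (q : Fin n × Bool → ℕ) (v : Fin n ⊕ Fin n → ℂ) :
    dW d (mono q) v = incrSign d.2 / 2 *
      (q (target d) * mono (q - Pi.single (target d) 1) v) := by
  set c := target d with hc
  have h0 : mono q = fun w => incr c w ^ q c * ∏ c' ∈ Finset.univ.erase c, incr c' w ^ q c' := by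
    funext w
    exact (Finset.mul_prod_erase _ _ (Finset.mem_univ c)).symm
  have h1 : DifferentiableAt ℝ (fun w => incr c w ^ q c) v :=
    ((contDiff_incr c).pow _).differentiable (by simp) v
  have h2 : DifferentiableAt ℝ (fun w => ∏ c' ∈ Finset.univ.erase c, incr c' w ^ q c') v :=
    (contDiff_prod fun c _ => (contDiff_incr c).pow _).differentiable (by simp) v
  have h3 : mono (q - Pi.single c 1) v =
      incr c v ^ (q c - 1) * ∏ c' ∈ Finset.univ.erase c, incr c' v ^ q c' := by
    unfold mono
    rw [← Finset.mul_prod_erase _ _ (Finset.mem_univ c)]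
    congr 1
    · simp
    · refine Finset.prod_congr rfl fun c' hc' => ?_
      simp [Finset.ne_of_mem_erase hc']
  rw [h0, dW_mul h1 h2, dW_prod_incr_pow d q _ (Finset.notMem_erase _ _), dW_incr_pow,
    if_pos rfl, h3]
  ring

theorem perm_qword {q : Fin n × Bool → ℕ} {c : Fin n × Bool} (hc : q c ≠ 0) :
    (qword q).Perm (c :: qword (q - Pi.single c 1)) := by
  rw [List.perm_iff_count]
  intro d
  rw [count_qword, List.count_cons, count_qword]
  by_cases h : d = c
  · subst h
    simp
    lia
  · have h' : c ≠ d := fun h' => h h'.symm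
    simp [h, h']

theorem mfact_eq_mul_sub_single {q : Fin n × Bool → ℕ} {c : Fin n × Bool} (hc : q c ≠ 0) :
    mfact q = q c * mfact (q - Pi.single c 1) := by
  have h1 : (q - Pi.single c 1 : Fin n × Bool → ℕ) c = q c - 1 := by simp
  have h2 : ∀ c' ∈ Finset.univ.erase c, (q - Pi.single c 1 : Fin n × Bool → ℕ) c' = q c' :=
    fun c' hc' => by simp [Finset.ne_of_mem_erase hc']
  generalize q - Pi.single c 1 = q' at h1 h2
  unfold mfact
  rw [← Finset.mul_prod_erase _ _ (Finset.mem_univ c),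
    ← Finset.mul_prod_erase _ (fun i => (q' i).factorial) (Finset.mem_univ c),
    ← mul_assoc, h1, Nat.mul_factorial_pred hc]
  congr 1
  exact Finset.prod_congr rfl fun c' hc' => by rw [h2 c' hc']

/-- A derivative hitting the coefficient replaces f by ∂f at the same index. One hitting the
monomial lowers the index, and since q_c / q! = 1 / (q - e_c)! and D^q f = D^{q-e_c} ∂f, the result
is again a Taylor term of ∂f. The two contributions have equal modulus 1/2 and relative sign
`incrSign`. -/
theorem dW_taylorTerm {V : Set (Fin n → ℂ)} (hV : IsOpen V) {f : (Fin n → ℂ) → ℂ}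
    (hf : ContDiffOn ℝ ∞ f V) {v : Fin n ⊕ Fin n → ℂ} (hv : mid v ∈ V)
    (d : (Fin n ⊕ Fin n) × Bool) (q : Fin n × Bool → ℕ) :
    dW d (taylorTerm f q) v = 1 / 2 * taylorTerm (dW (target d) f) q v +
      incrSign d.2 / 2 * (if q (target d) = 0 then 0 else
        taylorTerm (dW (target d) f) (q - Pi.single (target d) 1) v) := by
  have h1 : DifferentiableAt ℝ (dWord (qword q) f) (mid v) :=
    (contDiffOn_dWord hV hf _).differentiableAt_of_isOpen hV hv
  have h2 : DifferentiableAt ℝ (fun w => dWord (qword q) f (mid w)) v :=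
    h1.comp v (contDiff_mid.differentiable (by simp) v)
  have h3 : DifferentiableAt ℝ (mono q) v := (contDiff_mono q).differentiable (by simp) v
  have h4 : dW (target d) (dWord (qword q) f) (mid v) =
      dWord (qword q) (dW (target d) f) (mid v) := by
    have := dWord_perm hV (perm_cons_qword (target d) q) hf hv
    rw [dWord_append] at this
    exact this.symm
  unfold taylorTerm
  have h5 : DifferentiableAt ℝ (fun w => dWord (qword q) f (mid w) * mono q w) v := h2.mul h3
  rw [dW_const_mul h5, dW_mul h2 h3, dW_comp_mid h1, h4, dW_mono]
  split_ifs with h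
  · rw [h]; push_cast; ring
  · have h6 : dWord (qword q) f (mid v) =
        dWord (qword (q - Pi.single (target d) 1)) (dW (target d) f) (mid v) :=
      dWord_perm hV (perm_qword h) hf hv
    rw [h6, mfact_eq_mul_sub_single h]
    have h7 : (q (target d) : ℂ) ≠ 0 := by exact_mod_cast h
    have h8 : (mfact (q - Pi.single (target d) 1) : ℂ) ≠ 0 := by
      exact_mod_cast (mfact_pos _).ne'
    push_cast
    field_simp

/-! ### The jet of the extension on the diagonal -/

/-- Summation over indices with q c ≠ 0, reparametrized by the injection q ↦ q + e_c. -/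
theorem hasSum_shift {κ : Type} [DecidableEq κ] {h : (κ → ℕ) → ℂ} {s : ℂ} (hh : HasSum h s)
    (c : κ) : HasSum (fun q : κ → ℕ => if q c = 0 then 0 else h (q - Pi.single c 1)) s := by
  have hi : Function.Injective fun q : κ → ℕ => q + Pi.single c 1 := add_left_injective _
  refine (hi.hasSum_iff fun q hq => ?_).1 ?_
  · rw [if_pos]
    by_contra h0
    refine hq ⟨q - Pi.single c 1, ?_⟩
    funext d
    by_cases hd : d = c
    · subst hd; simp; lia
    · simp [hd]
  · refine hh.congr_fun fun q => ?_
    simp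

theorem taylorTerm_of_cdist_eq_zero {f : (Fin n → ℂ) → ℂ} {v : Fin n ⊕ Fin n → ℂ}
    (hv : cdist v = 0) : HasSum (fun q => taylorTerm f q v) (f (mid v)) := by
  have h0 : ∀ c, incr c v = 0 := fun c => by
    have := norm_incr_le c v
    rw [hv] at this
    simpa using this
  have h1 : taylorTerm f 0 v = f (mid v) := by
    have : qword (0 : Fin n × Bool → ℕ) = [] := List.length_eq_zero_iff.1 (by
      rw [length_qword]; simp [size])
    simp [taylorTerm, this, mfact, mono]
  rw [← h1]
  refine hasSum_single 0 fun q hq => ?_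
  obtain ⟨c, hc⟩ := Function.ne_iff.1 hq
  have : mono q v = 0 := Finset.prod_eq_zero (Finset.mem_univ c) (by
    rw [h0]; exact zero_pow hc)
  simp [taylorTerm, this]

/-- Induction on the word with f varying: summed over all indices, the first letter acts with factor
1/2 ± 1/2, hence as ∂f for a holomorphic letter and as 0 for an antiholomorphic one. At a diagonal
point the undifferentiated series has only its term q = 0, so convergence is no issue. -/
theorem hasSum_dWord_taylorTerm {V : Set (Fin n → ℂ)} (hV : IsOpen V)
    {O : Set (Fin n ⊕ Fin n → ℂ)} (hO : IsOpen O) (hm : Set.MapsTo mid O V)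
    {v : Fin n ⊕ Fin n → ℂ} (hvO : v ∈ O) (hv : cdist v = 0)
    (L : List ((Fin n ⊕ Fin n) × Bool)) {f : (Fin n → ℂ) → ℂ} (hf : ContDiffOn ℝ ∞ f V) :
    HasSum (fun q => dWord L (taylorTerm f q) v)
      (if hasAnti L then 0 else dWord (L.map target) f (mid v)) := by
  induction L generalizing f with
  | nil => simpa using taylorTerm_of_cdist_eq_zero hv
  | cons d L ih =>
    have hfd := contDiffOn_dW hV hf (target d)
    have hT : ∀ q, ContDiffOn ℝ ∞ (taylorTerm (dW (target d) f) q) O :=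
      contDiffOn_taylorTerm hV hfd hm
    have h1 : ∀ q, dWord (d :: L) (taylorTerm f q) v =
        1 / 2 * dWord L (taylorTerm (dW (target d) f) q) v + incrSign d.2 / 2 *
          (if q (target d) = 0 then 0 else
            dWord L (taylorTerm (dW (target d) f) (q - Pi.single (target d) 1)) v) := fun q => by
      rw [dWord_cons, dWord_congr hO (fun w hw => dW_taylorTerm hV hf (hm hw) d q) L hvO]
      split_ifs with h
      · simp only [mul_zero, add_zero]
        exact dWord_const_mul hO (hT q) _ L hvO
      · rw [dWord_add hO (contDiffOn_const.mul (hT q)) (contDiffOn_const.mul (hT _)) L hvO]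
        beta_reduce
        rw [dWord_const_mul hO (hT _) _ L hvO, dWord_const_mul hO (hT _) _ L hvO]
    simp only [h1]
    have h2 := ih hfd
    have h3 := (h2.mul_left (1 / 2)).add ((hasSum_shift h2 (target d)).mul_left
      (incrSign d.2 / 2))
    have h4 : (if hasAnti (d :: L) then 0 else dWord ((d :: L).map target) f (mid v)) =
        (1 / 2 * if hasAnti L then 0 else dWord (L.map target) (dW (target d) f) (mid v)) +
          incrSign d.2 / 2 *
            if hasAnti L then 0 else dWord (L.map target) (dW (target d) f) (mid v) := by
      rcases d with ⟨i, b⟩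
      cases b
      · simp only [hasAnti_cons, Bool.false_or, List.map_cons, dWord_cons, incrSign,
          Bool.false_eq_true, if_false]
        ring
      · simp only [hasAnti_cons, Bool.true_or, if_true, incrSign]
        ring
    rw [h4]
    exact h3

/-! ### Telescoping -/

/-- The multi-indices of degree less than `M`. -/
def lowDeg (n M : ℕ) : Finset (Fin n × Bool → ℕ) :=
  (Fintype.piFinset fun _ => Finset.range M).filter fun q => size q < M

theorem mem_lowDeg {M : ℕ} {q : Fin n × Bool → ℕ} : q ∈ lowDeg n M ↔ size q < M := by
  simp only [lowDeg, Finset.mem_filter, Fintype.mem_piFinset, Finset.mem_range, and_iff_right_iff_imp]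
  intro h c
  exact lt_of_le_of_lt (Finset.single_le_sum (fun _ _ => Nat.zero_le _) (Finset.mem_univ c)) h

theorem size_add_single (q : Fin n × Bool → ℕ) (c : Fin n × Bool) :
    size (q + Pi.single c 1) = size q + 1 := by
  simp [size, Finset.sum_add_distrib]

/-- Lowering one entry maps the indices of degree at most M with q c ≠ 0 bijectively onto those of
degree less than M. -/
theorem sum_lowDeg_shift (M : ℕ) (c : Fin n × Bool) (h : (Fin n × Bool → ℕ) → ℂ) :
    ∑ q ∈ lowDeg n (M + 1), (if q c = 0 then 0 else h (q - Pi.single c 1)) =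
      ∑ q ∈ lowDeg n M, h q := by
  symm
  have e : ∀ q : Fin n × Bool → ℕ, (if q c = 0 then 0 else h (q - Pi.single c 1)) =
      if ¬ q c = 0 then h (q - Pi.single c 1) else 0 := fun q => (ite_not _ _ _).symm
  simp only [e]
  rw [← Finset.sum_filter]
  refine Finset.sum_bij' (fun q _ => q + Pi.single c 1) (fun q _ => q - Pi.single c 1) ?_ ?_ ?_ ?_ ?_
  · intro q hq
    rw [mem_lowDeg] at hq
    rw [Finset.mem_filter, mem_lowDeg, size_add_single]
    exact ⟨by lia, by simp⟩
  · intro q hq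
    rw [Finset.mem_filter, mem_lowDeg] at hq
    rw [mem_lowDeg]
    have h1 : q - Pi.single c 1 + Pi.single c 1 = q := by
      funext d
      by_cases hd : d = c
      · subst hd; have := hq.2; simp; lia
      · simp [hd]
    have h2 := size_add_single (q - Pi.single c 1) c
    rw [h1] at h2
    lia
  · intro q _
    simp
  · intro q hq
    rw [Finset.mem_filter] at hq
    funext d
    by_cases hd : d = c
    · subst hd; have := hq.2; simp; lia
    · simp [hd]
  · intro q _
    simp

/-- An antiholomorphic derivative of a Taylor polynomial is a sum of terms of top degree. -/
theorem dW_sum_taylorTerm {V : Set (Fin n → ℂ)} (hV : IsOpen V) {f : (Fin n → ℂ) → ℂ}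
    (hf : ContDiffOn ℝ ∞ f V) {O : Set (Fin n ⊕ Fin n → ℂ)} (hO : IsOpen O)
    (hm : Set.MapsTo mid O V) {d : (Fin n ⊕ Fin n) × Bool} (hd : d.2 = true) (M : ℕ) :
    Set.EqOn (dW d (fun w => ∑ q ∈ lowDeg n (M + 1), taylorTerm f q w))
      (fun w => ∑ q ∈ lowDeg n (M + 1) \ lowDeg n M,
        1 / 2 * taylorTerm (dW (target d) f) q w) O := by
  intro v hv
  rw [dW_sum _ fun q _ => (contDiffOn_taylorTerm hV hf hm q).differentiableAt_of_isOpen hO hv]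
  simp only [dW_taylorTerm hV hf (hm hv)]
  rw [Finset.sum_add_distrib, ← Finset.mul_sum, ← Finset.mul_sum,
    sum_lowDeg_shift M (target d) (fun q => taylorTerm (dW (target d) f) q v),
    ← Finset.mul_sum]
  have hsub : lowDeg n M ⊆ lowDeg n (M + 1) := fun q hq => by
    rw [mem_lowDeg] at hq ⊢; lia
  -- For an antiholomorphic letter the shifted sum has coefficient -1/2 and cancels every term of
  -- degree less than M; only degree M remains.
  rw [← Finset.sum_sdiff hsub, hd]
  simp only [incrSign, if_true]
  ring

/-- Any finite set of indices lies in a box, over which the sum factors into partial geometric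
series. -/
theorem summable_pow_size {κ : Type} [Fintype κ] [DecidableEq κ] {θ : ℝ} (h0 : 0 ≤ θ)
    (h1 : θ < 1) : Summable fun q : κ → ℕ => θ ^ size q := by
  refine summable_of_sum_le (c := ∏ _c : κ, (1 - θ)⁻¹) (fun q => by positivity) fun s => ?_
  obtain ⟨K, hK⟩ : ∃ K, ∀ q ∈ s, ∀ c, q c < K := by
    refine ⟨∑ q ∈ s, ∑ c, q c + 1, fun q hq c => Nat.lt_succ_of_le ?_⟩
    exact (Finset.single_le_sum (f := q) (fun _ _ => Nat.zero_le _) (Finset.mem_univ c)).trans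
      (Finset.single_le_sum (f := fun q : κ → ℕ => ∑ c, q c) (fun _ _ => Nat.zero_le _) hq)
  have h2 : s ⊆ Fintype.piFinset fun _ => Finset.range K := fun q hq => by
    simpa using hK q hq
  refine (Finset.sum_le_sum_of_subset_of_nonneg h2 fun _ _ _ => by positivity).trans ?_
  have h3 : ∑ q ∈ Fintype.piFinset fun _ : κ => Finset.range K, θ ^ size q =
      ∏ _c : κ, ∑ j ∈ Finset.range K, θ ^ j := by
    rw [Finset.prod_univ_sum]
    refine Finset.sum_congr rfl fun q _ => ?_
    rw [size, Finset.prod_pow_eq_pow_sum]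
  rw [h3]
  refine Finset.prod_le_prod (fun _ _ => by positivity) fun _ _ => ?_
  rw [← tsum_geometric_of_lt_one h0 h1]
  exact (summable_geometric_of_lt_one h0 h1).sum_le_tsum _ fun _ _ => by positivity

end

end BBS

namespace BBS

noncomputable section

variable {n : ℕ}

/-! ### Estimates for the almost holomorphic extension -/

/-- The terms of the almost holomorphic extension. -/
def aheTerm (a C₁ : ℝ) (χ : ℝ → ℝ) (f : (Fin n → ℂ) → ℂ) (q : Fin n × Bool → ℕ)
    (v : Fin n ⊕ Fin n → ℂ) : ℂ :=
  taylorTerm f q v * ((χ (cutScale a C₁ (size q) * cdist v ^ 2) : ℝ) : ℂ)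

theorem joint_ahe_eq (a C₁ : ℝ) (χ : ℝ → ℝ) (f : (Fin n → ℂ) → ℂ) :
    joint (ahe a C₁ χ f) = fun v => ∑' q, aheTerm a C₁ χ f q v :=
  funext fun v => joint_ahe a C₁ χ f v

theorem contDiffOn_aheTerm {V : Set (Fin n → ℂ)} (hV : IsOpen V) {f : (Fin n → ℂ) → ℂ}
    (hf : ContDiffOn ℝ ∞ f V) {O : Set (Fin n ⊕ Fin n → ℂ)} (hm : Set.MapsTo mid O V)
    {χ : ℝ → ℝ} (hχ : ContDiff ℝ ∞ χ) (a C₁ : ℝ) (q : Fin n × Bool → ℕ) :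
    ContDiffOn ℝ ∞ (aheTerm a C₁ χ f q) O :=
  (contDiffOn_taylorTerm hV hf hm q).mul
    (by simpa using (contDiff_cutoff hχ 0 (cutScale a C₁ (size q))).contDiffOn)

theorem cutScale_mono {a : ℝ} (C₁ : ℝ) (ha : 1 < a) {N M : ℕ} (h : N ≤ M) :
    cutScale a C₁ N ≤ cutScale a C₁ M := by
  unfold cutScale
  gcongr

theorem aheTerm_eventuallyEq {a C₁ : ℝ} {χ : ℝ → ℝ} (hχ : ∀ t : ℝ, |t| ≤ 1 / 2 → χ t = 1)
    (f : (Fin n → ℂ) → ℂ) {q : Fin n × Bool → ℕ} {v : Fin n ⊕ Fin n → ℂ}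
    (h : cutScale a C₁ (size q) * cdist v ^ 2 < 1 / 2) :
    aheTerm a C₁ χ f q =ᶠ[nhds v] taylorTerm f q := by
  have hc : ContinuousAt (fun w : Fin n ⊕ Fin n → ℂ => cutScale a C₁ (size q) * cdist w ^ 2) v :=
    (continuous_const.mul (continuous_cdist.pow 2)).continuousAt
  filter_upwards [hc.eventually_lt continuousAt_const h] with w hw
  have h0 : 0 ≤ cutScale a C₁ (size q) * cdist w ^ 2 :=
    mul_nonneg (cutScale_nonneg _ _ _) (by positivity)
  rw [aheTerm, hχ _ (by rw [abs_of_nonneg h0]; exact hw.le)]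
  simp

/-- The parameters of the extension: a Gevrey potential, and a domain close to the diagonal. -/
structure ExtData (a C₀ C₁ : ℝ) (V : Set (Fin n → ℂ)) (O : Set (Fin n ⊕ Fin n → ℂ))
    (f : (Fin n → ℂ) → ℂ) : Prop where
  one_lt : 1 < a
  C₀_pos : 0 < C₀
  C₁_pos : 0 < C₁
  isOpen_V : IsOpen V
  isOpen_O : IsOpen O
  mapsTo : Set.MapsTo mid O V
  small : ∀ v ∈ O, C₁ * 2 ^ (a - 1) * cdist v ≤ 1
  gevrey : GevreyWith a C₀ C₁ V f

variable {a C₀ C₁ : ℝ} {V : Set (Fin n → ℂ)} {O : Set (Fin n ⊕ Fin n → ℂ)} {f : (Fin n → ℂ) → ℂ}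

theorem ExtData.potBound (D : ExtData a C₀ C₁ V O f) :
    PotBound a C₁ C₀ (C₁ * lossConst ^ a) V f :=
  D.gevrey.potBound (by linarith [D.one_lt]) D.C₀_pos.le D.C₁_pos.le D.isOpen_V

theorem ExtData.radius_nonneg (D : ExtData a C₀ C₁ V O f) : 0 ≤ C₁ * lossConst ^ a := by
  have := lossConst_pos
  have := D.C₁_pos
  positivity

theorem termRadius_nonneg {a C₁ R B : ℝ} (hC₁ : 0 ≤ C₁) (hR : 0 ≤ R) (hB : 0 ≤ B) :
    0 ≤ termRadius a C₁ R B := by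
  have := lossConst_pos
  unfold termRadius
  positivity

theorem ExtData.invScale_mul_le (D : ExtData a C₀ C₁ V O f) {v : Fin n ⊕ Fin n → ℂ} (hv : v ∈ O)
    {N : ℕ} (h : cutScale a C₁ N * cdist v ^ 2 ≤ 1) : invScale a C₁ N * cdist v ≤ 1 := by
  rcases Nat.eq_zero_or_pos N with rfl | hN
  · have := D.small v hv
    simpa [invScale] using this
  · rw [cutScale_eq hN, ← mul_pow] at h
    have h0 : 0 ≤ invScale a C₁ N * cdist v :=
      mul_nonneg (invScale_pos D.C₁_pos N).le (cdist_nonneg v)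
    exact (pow_le_one_iff_of_nonneg h0 two_ne_zero).1 h

/-- Where the argument of the cut-off is at most 1, the distance is at most 1/Λ_N and
`maj_taylorTerm_mul` applies; elsewhere the term vanishes in a neighbourhood. In degree 0 the bound
on the distance comes from `small`, because the cut-off scale is then zero. -/
theorem ExtData.exists_maj_aheTerm (D : ExtData a C₀ C₁ V O f) {ε : ℝ} (hε : 0 < ε) {χ : ℝ → ℝ}
    (hχ : IsGevreyCutoff ε χ) : ∃ C R : ℝ, 0 ≤ C ∧ 0 ≤ R ∧ ∀ v ∈ O, ∀ q,
      Maj (fun _ => 1) (gev (a + ε) (C * ((2 : ℝ) ^ (-(a / 2))) ^ size q) R 0)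
        (aheTerm a C₁ χ f q) v := by
  obtain ⟨A₀, A₁, hA₀, hA₁, hb⟩ := hχ.bound
  have hC₀ := D.C₀_pos
  have hR := termRadius_nonneg (a := a) (B := 2 + 2 * A₁) D.C₁_pos.le D.radius_nonneg (by positivity)
  refine ⟨C₀ * A₀ * 2 ^ (a / 3), termRadius a C₁ (C₁ * lossConst ^ a) (2 + 2 * A₁),
    by positivity, hR, fun v hv q => ?_⟩
  have hsm : ContDiffOn ℝ ∞ (fun w : Fin n ⊕ Fin n → ℂ =>
      ((χ (cutScale a C₁ (size q) * cdist w ^ 2) : ℝ) : ℂ)) O := by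
    simpa using (contDiff_cutoff hχ.smooth 0 (cutScale a C₁ (size q))).contDiffOn
  by_cases h : cutScale a C₁ (size q) * cdist v ^ 2 ≤ 1
  · have hΛ := D.invScale_mul_le hv h
    have h1 := maj_cutoff hχ.smooth hA₀ hA₁ (by linarith) hb (invScale_pos D.C₁_pos (size q))
      (cutScale_nonneg a C₁ (size q)) (cutScale_le D.one_lt (size q)) hΛ
    have h2 := maj_taylorTerm_mul D.one_lt hC₀.le D.C₁_pos D.radius_nonneg D.isOpen_V D.potBound
      D.isOpen_O D.mapsTo hv q hΛ hsm (σ := 1 + ε) (by linarith) hA₀.le (by positivity) h1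
    rwa [show a - 1 + (1 + ε) = a + ε by ring] at h2
  · intro L
    have h0 : aheTerm a C₁ χ f q =ᶠ[nhds v] fun _ => 0 := by
      have hc : ContinuousAt (fun w : Fin n ⊕ Fin n → ℂ =>
          cutScale a C₁ (size q) * cdist w ^ 2) v :=
        (continuous_const.mul (continuous_cdist.pow 2)).continuousAt
      filter_upwards [continuousAt_const.eventually_lt hc (not_le.1 h)] with w hw
      rw [aheTerm, hχ.eq_zero _ (hw.le.trans (le_abs_self _))]
      simp
    rw [dWord_congr_nhds h0, dWord_const]
    simp only [ite_self, norm_zero, mul_one]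
    exact gev_nonneg (by positivity) hR _ _

theorem two_rpow_neg_lt_one {t : ℝ} (ht : 0 < t) : (2 : ℝ) ^ (-t) < 1 :=
  Real.rpow_lt_one_of_one_lt_of_neg (by norm_num) (by linarith)

theorem ExtData.summable_bound (D : ExtData a C₀ C₁ V O f) {ε : ℝ} (hε : 0 < ε) {χ : ℝ → ℝ}
    (hχ : IsGevreyCutoff ε χ) (L : List ((Fin n ⊕ Fin n) × Bool)) :
    ∃ u : (Fin n × Bool → ℕ) → ℝ, Summable u ∧
      ∀ q, ∀ v ∈ O, ‖dWord L (aheTerm a C₁ χ f q) v‖ ≤ u q := by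
  obtain ⟨C, R, -, -, h⟩ := D.exists_maj_aheTerm hε hχ
  have ha := D.one_lt
  refine ⟨fun q => (C * R ^ L.length * ((L.length + 0).factorial : ℝ) ^ (a + ε)) *
    ((2 : ℝ) ^ (-(a / 2))) ^ size q, (summable_pow_size (by positivity)
      (two_rpow_neg_lt_one (by linarith))).mul_left _, fun q v hv => (h v hv q L).trans (le_of_eq ?_)⟩
  unfold gev; ring

theorem ExtData.contDiffOn (D : ExtData a C₀ C₁ V O f) {ε : ℝ} (hε : 0 < ε) {χ : ℝ → ℝ}
    (hχ : IsGevreyCutoff ε χ) : ContDiffOn ℝ ∞ (joint (ahe a C₁ χ f)) O := by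
  rw [joint_ahe_eq]
  exact contDiffOn_tsum_of_dWord D.isOpen_O
    (contDiffOn_aheTerm D.isOpen_V D.gevrey.smooth D.mapsTo hχ.smooth a C₁) (D.summable_bound hε hχ)

theorem ExtData.hasSum_dWord (D : ExtData a C₀ C₁ V O f) {ε : ℝ} (hε : 0 < ε) {χ : ℝ → ℝ}
    (hχ : IsGevreyCutoff ε χ) (L : List ((Fin n ⊕ Fin n) × Bool)) {v : Fin n ⊕ Fin n → ℂ}
    (hv : v ∈ O) : HasSum (fun q => dWord L (aheTerm a C₁ χ f q) v)
      (dWord L (joint (ahe a C₁ χ f)) v) := by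
  obtain ⟨u, hu, hb⟩ := D.summable_bound hε hχ L
  rw [joint_ahe_eq, dWord_tsum D.isOpen_O
    (contDiffOn_aheTerm D.isOpen_V D.gevrey.smooth D.mapsTo hχ.smooth a C₁)
    (D.summable_bound hε hχ) L hv]
  exact (Summable.of_norm_bounded hu fun q => hb q v hv).hasSum

/-- The jet of the extension on the diagonal. -/
theorem ExtData.dWord_diag (D : ExtData a C₀ C₁ V O f) {ε : ℝ} (hε : 0 < ε) {χ : ℝ → ℝ}
    (hχ : IsGevreyCutoff ε χ) (L : List ((Fin n ⊕ Fin n) × Bool)) {v : Fin n ⊕ Fin n → ℂ}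
    (hv : v ∈ O) (h0 : cdist v = 0) : dWord L (joint (ahe a C₁ χ f)) v =
      if hasAnti L then 0 else dWord (L.map target) f (mid v) := by
  refine (D.hasSum_dWord hε hχ L hv).unique ?_
  have h1 := hasSum_dWord_taylorTerm D.isOpen_V D.isOpen_O D.mapsTo hv h0 L D.gevrey.smooth
  refine h1.congr_fun fun q => ?_
  exact dWord_congr_nhds (aheTerm_eventuallyEq hχ.eq_one f (by rw [h0]; norm_num)) L

/-- These are the terms left over after telescoping: Taylor terms of a first derivative of f,
without cut-off. Hence g = 1 and order a. -/
theorem ExtData.norm_dWord_taylorTerm_le (D : ExtData a C₀ C₁ V O f) {v : Fin n ⊕ Fin n → ℂ}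
    (hv : v ∈ O) (c : Fin n × Bool) {q : Fin n × Bool → ℕ}
    (hq : cutScale a C₁ (size q) * cdist v ^ 2 ≤ 1) :
    Maj (fun _ => 1) (gev a (C₀ * (C₁ * lossConst ^ a) * 2 ^ (a / 3) *
      ((2 : ℝ) ^ (-(a / 2))) ^ size q) (termRadius a C₁ (2 ^ a * (C₁ * lossConst ^ a)) 0) 0)
      (taylorTerm (dW c f) q) v := by
  have hR := D.radius_nonneg
  have hC₀ := D.C₀_pos
  have ha := D.one_lt
  have h := maj_taylorTerm_mul D.one_lt (by positivity) D.C₁_pos (by positivity) D.isOpen_V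
    (D.potBound.dW (by linarith) hC₀.le D.C₁_pos.le hR D.isOpen_V c) D.isOpen_O D.mapsTo hv q
    (D.invScale_mul_le hv hq) (g := fun _ => 1) contDiffOn_const (σ := 1) le_rfl zero_le_one
    (B := 0) le_rfl (maj_const 1 (fun _ => zero_le_one) le_rfl
      (gev_nonneg zero_le_one (by simp) 0) (by simp [gev]))
  simpa using h

/-- Antiholomorphic derivatives are exponentially small in the degree up to which the cut-off
functions equal one. -/
theorem ExtData.exists_anti_bound (D : ExtData a C₀ C₁ V O f) {ε : ℝ} (hε : 0 < ε) {χ : ℝ → ℝ}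
    (hχ : IsGevreyCutoff ε χ) : ∃ C R : ℝ, 0 ≤ C ∧ 0 ≤ R ∧ ∀ v ∈ O,
      ∀ L : List ((Fin n ⊕ Fin n) × Bool), hasAnti L = true → ∀ M : ℕ,
        cutScale a C₁ M * cdist v ^ 2 < 1 / 2 →
        ‖dWord L (joint (ahe a C₁ χ f)) v‖ ≤
          gev (a + ε) C R 0 L.length * ((2 : ℝ) ^ (-(a / 4))) ^ M := by
  obtain ⟨C, R, hC, hR, hT⟩ := D.exists_maj_aheTerm hε hχ
  have ha := D.one_lt
  have hC₀ := D.C₀_pos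
  have hR₀ := D.radius_nonneg
  set ϱ : ℝ := 2 ^ (-(a / 4)) with hϱ
  have hϱ0 : 0 ≤ ϱ := by positivity
  have hϱ1 : ϱ < 1 := two_rpow_neg_lt_one (by linarith)
  -- The decay is split in two equal halves: one gives the smallness ϱ^M, the other makes the sum
  -- over indices converge.
  have hϱ2 : (2 : ℝ) ^ (-(a / 2)) = ϱ * ϱ := by
    rw [hϱ, ← Real.rpow_add (by norm_num)]; congr 1; ring
  have hϱs := summable_pow_size (κ := Fin n × Bool) hϱ0 hϱ1
  set S : ℝ := ∑' q : Fin n × Bool → ℕ, ϱ ^ size q with hS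
  have hS0 : 0 ≤ S := tsum_nonneg fun q => by positivity
  set C' : ℝ := C₀ * (C₁ * lossConst ^ a) * 2 ^ (a / 3) with hC'
  set R' : ℝ := termRadius a C₁ (2 ^ a * (C₁ * lossConst ^ a)) 0 with hR'
  have hC'0 : 0 ≤ C' := by positivity
  have hR'0 : 0 ≤ R' := termRadius_nonneg D.C₁_pos.le (by positivity) le_rfl
  refine ⟨(C' + C) * S, max (max R R') 1, by positivity, by positivity, fun v hv L hL M hM => ?_⟩
  set R'' := max (max R R') 1
  have hR''1 : 1 ≤ R'' := le_max_right _ _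
  have hfs := D.gevrey.smooth
  have hTs := contDiffOn_taylorTerm D.isOpen_V hfs D.mapsTo
  -- bring an antiholomorphic derivative to the front
  obtain ⟨d, hdL, hd⟩ : ∃ d ∈ L, d.2 = true := by simpa [hasAnti] using hL
  obtain ⟨L₁, L₂, rfl⟩ := List.append_of_mem hdL
  set L := L₁ ++ d :: L₂
  set L' := L₁ ++ L₂
  have hperm : L.Perm (d :: L') := List.perm_middle
  have hlen : L.length = L'.length + 1 := by simpa using hperm.length_eq
  -- decomposition of the sum
  set F := lowDeg n (M + 1) with hF
  have hlow : ∀ q ∈ F, dWord L (aheTerm a C₁ χ f q) v = dWord L (taylorTerm f q) v := fun q hq => by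
    rw [hF, mem_lowDeg] at hq
    refine dWord_congr_nhds (aheTerm_eventuallyEq hχ.eq_one f ?_) L
    exact lt_of_le_of_lt (mul_le_mul_of_nonneg_right (cutScale_mono C₁ ha (by lia))
      (by positivity)) hM
  have hsum := D.hasSum_dWord hε hχ L hv
  have hfin : HasSum (fun q => if q ∈ F then dWord L (aheTerm a C₁ χ f q) v else 0)
      (∑ q ∈ F, dWord L (taylorTerm f q) v) := by
    have h1 := hasSum_sum_of_ne_finset_zero (s := F)
      (L := SummationFilter.unconditional _)
      (f := fun q => if q ∈ F then dWord L (aheTerm a C₁ χ f q) v else 0)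
      (fun q hq => if_neg hq)
    rwa [Finset.sum_congr rfl fun q hq => (if_pos hq).trans (hlow q hq)] at h1
  have htail := hsum.sub hfin
  -- The tail consists of degrees above M, where the general bound on the terms already contains
  -- ϱ^M.
  have hB : ‖dWord L (joint (ahe a C₁ χ f)) v - ∑ q ∈ F, dWord L (taylorTerm f q) v‖ ≤
      gev (a + ε) C R'' 0 L.length * ϱ ^ M * S := by
    rw [← htail.tsum_eq]
    refine tsum_of_norm_bounded (hϱs.hasSum.mul_left _) fun q => ?_
    by_cases hq : q ∈ F
    · rw [if_pos hq, sub_self, norm_zero]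
      exact mul_nonneg (mul_nonneg (gev_nonneg hC (by positivity) _ _) (by positivity))
        (by positivity)
    · rw [if_neg hq, sub_zero]
      refine (hT v hv q L).trans ?_
      have hqM : M ≤ size q := by
        rw [hF, mem_lowDeg] at hq; lia
      have h2 : ((2 : ℝ) ^ (-(a / 2))) ^ size q ≤ ϱ ^ M * ϱ ^ size q := by
        rw [hϱ2, mul_pow]
        exact mul_le_mul_of_nonneg_right (pow_le_pow_of_le_one hϱ0 hϱ1.le hqM) (by positivity)
      rw [mul_one]
      calc gev (a + ε) (C * ((2 : ℝ) ^ (-(a / 2))) ^ size q) R 0 L.length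
          ≤ gev (a + ε) (C * (ϱ ^ M * ϱ ^ size q)) R'' 0 L.length :=
            gev_mono (by positivity) hR (by gcongr)
              ((le_max_left _ _).trans (le_max_left _ _)) _ _
        _ = _ := by unfold gev; ring
  -- Up to degree M the cut-offs are 1 near v, so the head is a Taylor polynomial; with the
  -- antiholomorphic letter in front it telescopes to terms of degree exactly M.
  have hA : ‖∑ q ∈ F, dWord L (taylorTerm f q) v‖ ≤
      gev (a + ε) C' R'' 0 L.length * ϱ ^ M * S := by
    have h1 := dWord_sum D.isOpen_O F (fun q _ => hTs q) L hv
    beta_reduce at h1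
    rw [← h1, dWord_perm D.isOpen_O hperm (ContDiffOn.sum fun q _ => hTs q) hv, dWord_cons,
      dWord_congr D.isOpen_O (dW_sum_taylorTerm D.isOpen_V hfs D.isOpen_O D.mapsTo hd M) L' hv]
    have hTs' := contDiffOn_taylorTerm D.isOpen_V (contDiffOn_dW D.isOpen_V hfs (target d)) D.mapsTo
    rw [dWord_sum D.isOpen_O _ (fun q _ => contDiffOn_const.mul (hTs' q)) L' hv]
    refine (norm_sum_le _ _).trans ?_
    have h2 : ∀ q ∈ lowDeg n (M + 1) \ lowDeg n M,
        ‖dWord L' (fun w => 1 / 2 * taylorTerm (dW (target d) f) q w) v‖ ≤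
          gev (a + ε) C' R'' 0 L.length * ϱ ^ M * ϱ ^ size q := by
      intro q hq
      rw [Finset.mem_sdiff, mem_lowDeg, mem_lowDeg] at hq
      have hqM : size q = M := by lia
      rw [dWord_const_mul D.isOpen_O (hTs' q) _ L' hv, norm_mul]
      have h3 := D.norm_dWord_taylorTerm_le hv (target d) (q := q) (by rw [hqM]; linarith) L'
      rw [mul_one] at h3
      have h4 : ‖(1 / 2 : ℂ)‖ ≤ 1 := by norm_num
      refine (mul_le_of_le_one_left (norm_nonneg _) h4).trans (h3.trans ?_)
      rw [hlen, hϱ2, hqM, mul_pow]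
      calc gev a (C' * (ϱ ^ M * ϱ ^ M)) R' 0 L'.length
          ≤ gev (a + ε) (C' * (ϱ ^ M * ϱ ^ M)) R'' 0 L'.length :=
            (gev_le_gev_exponent (by positivity) hR'0 (by linarith) _ _).trans
              (gev_mono (by positivity) hR'0 le_rfl
                ((le_max_right _ _).trans (le_max_left _ _)) _ _)
        _ ≤ gev (a + ε) (C' * (ϱ ^ M * ϱ ^ M)) R'' 0 (L'.length + 1) := by
            unfold gev
            gcongr <;> exact Nat.le_succ _
        _ = _ := by unfold gev; ring
    refine (Finset.sum_le_sum h2).trans ?_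
    rw [← Finset.mul_sum]
    refine mul_le_mul_of_nonneg_left ?_ (mul_nonneg (gev_nonneg hC'0 (by positivity) _ _)
      (by positivity))
    exact hϱs.sum_le_tsum _ fun q _ => by positivity
  calc ‖dWord L (joint (ahe a C₁ χ f)) v‖
      = ‖(dWord L (joint (ahe a C₁ χ f)) v - ∑ q ∈ F, dWord L (taylorTerm f q) v) +
          ∑ q ∈ F, dWord L (taylorTerm f q) v‖ := by rw [sub_add_cancel]
    _ ≤ gev (a + ε) C R'' 0 L.length * ϱ ^ M * S + gev (a + ε) C' R'' 0 L.length * ϱ ^ M * S :=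
        (norm_add_le _ _).trans (add_le_add hB hA)
    _ = _ := by unfold gev; ring

/-- The rate of decay of the antiholomorphic derivatives. -/
def flatRate (a C₁ : ℝ) : ℝ := (1 / (2 ^ a * C₁)) ^ (1 / (a - 1)) * (a / 4 * Real.log 2)

theorem flatRate_pos {a C₁ : ℝ} (ha : 1 < a) (hC₁ : 0 < C₁) : 0 < flatRate a C₁ := by
  have := Real.log_pos (by norm_num : (1 : ℝ) < 2)
  unfold flatRate
  positivity

/-- The flat function `exp(-b |y - z̄|^{-1/(a-1)})`, equal to zero on the diagonal. -/
def flat (a b : ℝ) (v : Fin n ⊕ Fin n → ℂ) : ℝ :=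
  if cdist v = 0 then 0 else Real.exp (-b * cdist v ^ (-(1 / (a - 1))))

theorem flat_nonneg (a b : ℝ) (v : Fin n ⊕ Fin n → ℂ) : 0 ≤ flat a b v := by
  unfold flat
  split_ifs
  · exact le_rfl
  · positivity

theorem flat_le_one {a b : ℝ} (hb : 0 ≤ b) (v : Fin n ⊕ Fin n → ℂ) : flat a b v ≤ 1 := by
  unfold flat
  split_ifs
  · exact zero_le_one
  · rw [Real.exp_le_one_iff]
    have : 0 ≤ cdist v ^ (-(1 / (a - 1))) := Real.rpow_nonneg (cdist_nonneg v) _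
    nlinarith

/-- A degree at which the cut-off is still one and which is comparable to the critical one. -/
theorem exists_degree {a C₁ r : ℝ} (ha : 1 < a) (hC₁ : 0 < C₁) (hr : 0 < r) :
    ∃ M : ℕ, cutScale a C₁ M * r ^ 2 < 1 / 2 ∧
      ((2 : ℝ) ^ (-(a / 4))) ^ M ≤
        2 ^ (a / 4) * Real.exp (-flatRate a C₁ * r ^ (-(1 / (a - 1)))) := by
  have ha1 : 0 < a - 1 := by linarith
  set κ : ℝ := (1 / (2 ^ a * C₁)) ^ (1 / (a - 1)) with hκ
  set x : ℝ := κ * r ^ (-(1 / (a - 1))) with hx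
  have hκ0 : 0 ≤ κ := by positivity
  have hx0 : 0 ≤ x := by positivity
  -- The number x satisfies x^{a-1} = 1/(2^a C₁ r), so the cut-off argument at degree x is 1/4,
  -- safely below 1/2. Rounding down loses less than one degree, that is a factor at most 2^{a/4}.
  refine ⟨⌊x⌋₊, ?_, ?_⟩
  · have h1 : (⌊x⌋₊ : ℝ) ≤ x := Nat.floor_le hx0
    have h2 : x ^ (a - 1) = 1 / (2 ^ a * C₁) * r⁻¹ := by
      rw [hx, Real.mul_rpow hκ0 (by positivity), hκ, ← Real.rpow_mul (by positivity),
        ← Real.rpow_mul hr.le, one_div_mul_cancel ha1.ne', Real.rpow_one,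
        show -(1 / (a - 1)) * (a - 1) = -1 by field_simp, Real.rpow_neg_one]
    have h3 : cutScale a C₁ ⌊x⌋₊ ≤ (x ^ (a - 1)) ^ 2 * (2 ^ (a - 1)) ^ 2 * C₁ ^ 2 := by
      unfold cutScale
      have h4 : (4 : ℝ) ^ (a - 1) = (2 ^ (a - 1)) ^ 2 := by
        rw [show (4 : ℝ) = 2 ^ (2 : ℝ) by norm_num, ← Real.rpow_natCast, ← Real.rpow_mul (by norm_num),
          ← Real.rpow_mul (by norm_num)]
        congr 1; push_cast; ring
      have h5 : (⌊x⌋₊ : ℝ) ^ (2 * (a - 1)) ≤ (x ^ (a - 1)) ^ 2 := by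
        rw [← Real.rpow_natCast, ← Real.rpow_mul hx0]
        refine (Real.rpow_le_rpow (by positivity) h1 (by positivity)).trans (le_of_eq ?_)
        congr 1; push_cast; ring
      rw [h4]
      gcongr
    have h6 : (2 : ℝ) ^ a = 2 * 2 ^ (a - 1) := by rw [Real.rpow_sub_one (by norm_num)]; ring
    have h7 : (0 : ℝ) < 2 ^ (a - 1) := by positivity
    calc cutScale a C₁ ⌊x⌋₊ * r ^ 2
        ≤ (x ^ (a - 1)) ^ 2 * (2 ^ (a - 1)) ^ 2 * C₁ ^ 2 * r ^ 2 := by gcongr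
      _ = 1 / 4 := by rw [h2, h6]; field_simp; norm_num
      _ < 1 / 2 := by norm_num
  · have h1 : x < ⌊x⌋₊ + 1 := Nat.lt_floor_add_one x
    have h2 : Real.exp (-flatRate a C₁ * r ^ (-(1 / (a - 1)))) = 2 ^ (-(a / 4) * x) := by
      rw [Real.rpow_def_of_pos (show (0 : ℝ) < 2 by norm_num), flatRate, ← hκ, hx]
      congr 1; ring
    rw [h2, ← Real.rpow_natCast, ← Real.rpow_mul (by norm_num), ← Real.rpow_add (by norm_num)]
    refine Real.rpow_le_rpow_of_exponent_le (by norm_num) ?_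
    nlinarith

/-- Holomorphic words: sum the bounds of the terms. Words with an antiholomorphic letter: take the
degree M of `exists_degree` in `exists_anti_bound`; on the diagonal they vanish by `dWord_diag`. The
exponential rate is `flatRate a C₁`, so ε and χ enter only through the constants. -/
theorem ExtData.isGev (D : ExtData a C₀ C₁ V O f) {ε : ℝ} (hε : 0 < ε) {χ : ℝ → ℝ}
    (hχ : IsGevreyCutoff ε χ) :
    IsGev O O (a + ε) (holWeight (flat a (flatRate a C₁))) (joint (ahe a C₁ χ f)) := by
  refine ⟨D.contDiffOn hε hχ, ?_⟩
  have ha := D.one_lt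
  obtain ⟨C, R, hC, hR, hT⟩ := D.exists_maj_aheTerm hε hχ
  obtain ⟨C', R', hC', hR', hA⟩ := D.exists_anti_bound hε hχ
  have hsum := summable_pow_size (κ := Fin n × Bool) (θ := (2 : ℝ) ^ (-(a / 2))) (by positivity)
    (two_rpow_neg_lt_one (by linarith))
  set S := ∑' q : Fin n × Bool → ℕ, ((2 : ℝ) ^ (-(a / 2))) ^ size q with hS
  have hS0 : 0 ≤ S := tsum_nonneg fun q => by positivity
  refine ⟨C * S + C' * 2 ^ (a / 4), max R R', by positivity, by positivity, fun v hv L => ?_⟩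
  by_cases hL : hasAnti L = true
  · rw [hL]
    by_cases h0 : cdist v = 0
    · rw [D.dWord_diag hε hχ L hv h0, if_pos hL]
      simp [holWeight, flat, h0]
    · obtain ⟨M, hM1, hM2⟩ := exists_degree ha D.C₁_pos (lt_of_le_of_ne (cdist_nonneg v) (Ne.symm h0))
      refine (hA v hv L hL M hM1).trans ?_
      simp only [holWeight, flat, if_true, h0, if_false]
      calc gev (a + ε) C' R' 0 L.length * ((2 : ℝ) ^ (-(a / 4))) ^ M
          ≤ gev (a + ε) C' R' 0 L.length *
            (2 ^ (a / 4) * Real.exp (-flatRate a C₁ * cdist v ^ (-(1 / (a - 1))))) :=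
            mul_le_mul_of_nonneg_left hM2 (gev_nonneg hC' hR' _ _)
        _ = gev (a + ε) (C' * 2 ^ (a / 4)) R' 0 L.length *
            Real.exp (-flatRate a C₁ * cdist v ^ (-(1 / (a - 1)))) := by unfold gev; ring
        _ ≤ _ := by
            refine mul_le_mul_of_nonneg_right ?_ (Real.exp_pos _).le
            exact gev_mono (by positivity) hR' (le_add_of_nonneg_left (by positivity))
              (le_max_right _ _) _ _
  · rw [Bool.not_eq_true] at hL
    rw [hL]
    simp only [holWeight, Bool.false_eq_true, if_false, mul_one]
    rw [← (D.hasSum_dWord hε hχ L hv).tsum_eq]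
    refine (tsum_of_norm_bounded (hsum.hasSum.mul_left (gev (a + ε) C R 0 L.length))
      fun q => (hT v hv q L).trans (le_of_eq (by unfold gev; ring))).trans ?_
    calc gev (a + ε) C R 0 L.length * S = gev (a + ε) (C * S) R 0 L.length := by unfold gev; ring
      _ ≤ _ := gev_mono (by positivity) hR (le_add_of_nonneg_right (by positivity))
          (le_max_left _ _) _ _

/-- On the diagonal no derivative of the cut-off survives: the jet is that of the potential, which
is of order a. This removes the ε there. -/
theorem ExtData.isGev_diag (D : ExtData a C₀ C₁ V O f) {ε : ℝ} (hε : 0 < ε) {χ : ℝ → ℝ}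
    (hχ : IsGevreyCutoff ε χ) (b : ℝ) :
    IsGev O (O ∩ {v | cdist v = 0}) a (holWeight (flat a b)) (joint (ahe a C₁ χ f)) := by
  refine ⟨D.contDiffOn hε hχ, C₀, C₁ * lossConst ^ a, D.C₀_pos.le, D.radius_nonneg,
    fun v hv L => ?_⟩
  have h0 : cdist v = 0 := hv.2
  rw [D.dWord_diag hε hχ L hv.1 h0]
  split_ifs with hL
  · simp [holWeight, hL, flat, h0]
  · have h1 := D.potBound.2 0 (mid v) (D.mapsTo hv.1) (L.map target)
    have hq : qword (0 : Fin n × Bool → ℕ) = [] := List.length_eq_zero_iff.1 (by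
      rw [length_qword]; simp [size])
    rw [Bool.not_eq_true] at hL
    simpa [hq, size, mfact, holWeight, hL] using h1

end

end BBS

namespace BBS

noncomputable section

variable {n : ℕ}

/-! ### Coordinates `(x, w, z)` with `y = x + w` -/

/-- The `x`-part of a point `(x, w, z)`. -/
def px (v : Fin n ⊕ Fin n ⊕ Fin n → ℂ) (i : Fin n) : ℂ := v (Sum.inl i)

/-- The `w`-part of a point `(x, w, z)`. -/
def pw (v : Fin n ⊕ Fin n ⊕ Fin n → ℂ) (i : Fin n) : ℂ := v (Sum.inr (Sum.inl i))

/-- The `z`-part of a point `(x, w, z)`. -/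
def pz (v : Fin n ⊕ Fin n ⊕ Fin n → ℂ) (i : Fin n) : ℂ := v (Sum.inr (Sum.inr i))

/-- The point `y = x + w`. -/
def py (v : Fin n ⊕ Fin n ⊕ Fin n → ℂ) : Fin n → ℂ := px v + pw v

/-- The set `B × B ⊆ ℂ²ⁿ`. -/
def dom2 (B : Set (Fin n → ℂ)) : Set (Fin n ⊕ Fin n → ℂ) :=
  {v | (fun i => v (Sum.inl i)) ∈ B ∧ (fun i => v (Sum.inr i)) ∈ B}

/-- The set of `(x, w, z)` with `x, x + w, z ∈ B`. -/
def dom3 (B : Set (Fin n → ℂ)) : Set (Fin n ⊕ Fin n ⊕ Fin n → ℂ) :=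
  {v | px v ∈ B ∧ py v ∈ B ∧ pz v ∈ B}

theorem continuous_px : Continuous (px : (Fin n ⊕ Fin n ⊕ Fin n → ℂ) → Fin n → ℂ) := by
  unfold px; fun_prop

theorem continuous_pw : Continuous (pw : (Fin n ⊕ Fin n ⊕ Fin n → ℂ) → Fin n → ℂ) := by
  unfold pw; fun_prop

theorem continuous_pz : Continuous (pz : (Fin n ⊕ Fin n ⊕ Fin n → ℂ) → Fin n → ℂ) := by
  unfold pz; fun_prop

theorem continuous_py : Continuous (py : (Fin n ⊕ Fin n ⊕ Fin n → ℂ) → Fin n → ℂ) :=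
  continuous_px.add continuous_pw

theorem isOpen_dom2 {B : Set (Fin n → ℂ)} (hB : IsOpen B) : IsOpen (dom2 B) :=
  (hB.preimage (by fun_prop : Continuous fun v : Fin n ⊕ Fin n → ℂ => fun i => v (Sum.inl i))).inter
    (hB.preimage (by fun_prop : Continuous fun v : Fin n ⊕ Fin n → ℂ => fun i => v (Sum.inr i)))

theorem isOpen_dom3 {B : Set (Fin n → ℂ)} (hB : IsOpen B) : IsOpen (dom3 B) :=
  (hB.preimage continuous_px).inter ((hB.preimage continuous_py).inter (hB.preimage continuous_pz))

/-- The linear map `(x, w, z) ↦ (x, z)`. -/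
def baseL : (Fin n ⊕ Fin n ⊕ Fin n → ℂ) →L[ℝ] (Fin n ⊕ Fin n → ℂ) :=
  ContinuousLinearMap.pi fun k => ContinuousLinearMap.proj (R := ℝ)
    (φ := fun _ : Fin n ⊕ Fin n ⊕ Fin n => ℂ)
      (Sum.elim Sum.inl (fun i => Sum.inr (Sum.inr i)) k)

/-- The linear map `(x, w, z) ↦ (w, 0)`. -/
def shiftL : (Fin n ⊕ Fin n ⊕ Fin n → ℂ) →L[ℝ] (Fin n ⊕ Fin n → ℂ) :=
  ContinuousLinearMap.pi fun k => Sum.elim (fun i => ContinuousLinearMap.proj (R := ℝ)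
    (φ := fun _ : Fin n ⊕ Fin n ⊕ Fin n => ℂ) (Sum.inr (Sum.inl i))) (fun _ => 0) k

/-- The linear map `(x, w, z) ↦ (t x + (1 - t) y, z)`, where `y = x + w`. -/
def seg (t : ℝ) : (Fin n ⊕ Fin n ⊕ Fin n → ℂ) →L[ℝ] (Fin n ⊕ Fin n → ℂ) :=
  baseL + (1 - t) • shiftL

theorem seg_inl (t : ℝ) (v : Fin n ⊕ Fin n ⊕ Fin n → ℂ) (i : Fin n) :
    seg t v (Sum.inl i) = px v i + ((1 - t : ℝ) : ℂ) * pw v i := by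
  simp [seg, baseL, shiftL, px, pw]

theorem seg_inr (t : ℝ) (v : Fin n ⊕ Fin n ⊕ Fin n → ℂ) (i : Fin n) :
    seg t v (Sum.inr i) = pz v i := by
  simp [seg, baseL, shiftL, pz]

theorem seg_eq (t : ℝ) (v : Fin n ⊕ Fin n ⊕ Fin n → ℂ) :
    seg t v = Sum.elim (t • px v + (1 - t) • py v) (pz v) := by
  funext k
  rcases k with i | i
  · rw [seg_inl]
    simp [py]
    ring
  · rw [seg_inr]; simp

/-- For w = 0 the segment from x to y is a single point. Consequently a weight at (x, z) passes
unchanged to averages along the segment, as long as all estimates are taken at w = 0 after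
differentiation. -/
theorem seg_eq_base {v : Fin n ⊕ Fin n ⊕ Fin n → ℂ} (hv : pw v = 0) (t : ℝ) :
    seg t v = baseL v := by
  have : shiftL v = 0 := by
    funext k
    rcases k with i | i
    · simpa [shiftL, pw] using congrFun hv i
    · simp [shiftL]
  simp [seg, this]

theorem continuous_seg : Continuous (seg : ℝ → (Fin n ⊕ Fin n ⊕ Fin n → ℂ) →L[ℝ] _) := by
  unfold seg; fun_prop

theorem mapsTo_seg {B : Set (Fin n → ℂ)} (hB : Convex ℝ B) {t : ℝ} (ht : t ∈ Set.Icc (0 : ℝ) 1) :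
    Set.MapsTo (seg t) (dom3 B) (dom2 B) := by
  intro v hv
  rw [seg_eq]
  exact ⟨hB hv.1 hv.2.1 ht.1 (by linarith [ht.2]) (by ring), hv.2.2⟩

/-- The derivation of `ℂ²ⁿ` to which a derivation of `ℂ³ⁿ` corresponds. -/
def segTarget : (Fin n ⊕ Fin n ⊕ Fin n) × Bool → (Fin n ⊕ Fin n) × Bool
  | (Sum.inl i, b) => (Sum.inl i, b)
  | (Sum.inr (Sum.inl i), b) => (Sum.inl i, b)
  | (Sum.inr (Sum.inr i), b) => (Sum.inr i, b)

theorem segTarget_snd (c : (Fin n ⊕ Fin n ⊕ Fin n) × Bool) : (segTarget c).2 = c.2 := by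
  rcases c with ⟨i | i | i, b⟩ <;> rfl

/-- The factor with which a derivation of `ℂ³ⁿ` acts through `seg t`. -/
def segFactor (c : (Fin n ⊕ Fin n ⊕ Fin n) × Bool) (t : ℝ) : ℝ :=
  match c with
  | (Sum.inr (Sum.inl _), _) => 1 - t
  | _ => 1

theorem continuous_segFactor (c : (Fin n ⊕ Fin n ⊕ Fin n) × Bool) : Continuous (segFactor c) := by
  rcases c with ⟨i | i | i, b⟩ <;> unfold segFactor <;> fun_prop

theorem segFactor_mem (c : (Fin n ⊕ Fin n ⊕ Fin n) × Bool) {t : ℝ} (ht : t ∈ Set.Icc (0 : ℝ) 1) :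
    segFactor c t ∈ Set.Icc (0 : ℝ) 1 := by
  rcases c with ⟨i | i | i, b⟩ <;> simp only [segFactor, Set.mem_Icc] <;>
    constructor <;> linarith [ht.1, ht.2]

theorem dW_seg (t : ℝ) (c : (Fin n ⊕ Fin n ⊕ Fin n) × Bool) (k : Fin n ⊕ Fin n)
    (v : Fin n ⊕ Fin n ⊕ Fin n → ℂ) :
    dW c (fun w => seg t w k) v = (if segTarget c = (k, false) then (segFactor c t : ℂ) else 0) ∧
      dW c (fun w => star (seg t w k)) v =
        (if segTarget c = (k, true) then (segFactor c t : ℂ) else 0) := by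
  have key : ∀ c, dW c (fun w => seg t w k) v =
      (if segTarget c = (k, false) then (segFactor c t : ℂ) else 0) := fun c => by
    rcases k with i | i
    · simp only [seg_inl]
      have h1 : DifferentiableAt ℝ (fun w : Fin n ⊕ Fin n ⊕ Fin n → ℂ => px w i) v := by
        unfold px; fun_prop
      have h2 : DifferentiableAt ℝ (fun w : Fin n ⊕ Fin n ⊕ Fin n → ℂ => pw w i) v := by
        unfold pw; fun_prop
      rw [dW_add h1 (h2.const_mul _), dW_const_mul h2]
      unfold px pw
      rw [dW_coord, dW_coord]
      rcases c with ⟨j | j | j, b⟩ <;> cases b <;> by_cases h : j = i <;>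
        simp [segTarget, segFactor, h]
    · simp only [seg_inr]
      unfold pz
      rw [dW_coord]
      rcases c with ⟨j | j | j, b⟩ <;> cases b <;> by_cases h : j = i <;>
        simp [segTarget, segFactor, h]
  refine ⟨key c, ?_⟩
  rw [dW_star (by fun_prop), key]
  rcases c with ⟨j | j | j, b⟩ <;> rcases k with i | i <;> cases b <;> by_cases h : j = i <;>
    simp [segTarget, segFactor, h]

theorem dW_comp_seg {g : (Fin n ⊕ Fin n → ℂ) → ℂ} {t : ℝ} {v : Fin n ⊕ Fin n ⊕ Fin n → ℂ}
    (hg : DifferentiableAt ℝ g (seg t v)) (c : (Fin n ⊕ Fin n ⊕ Fin n) × Bool) :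
    dW c (fun w => g (seg t w)) v = segFactor c t * dW (segTarget c) g (seg t v) := by
  rw [dW_comp hg (seg t).differentiableAt]
  rcases h : segTarget c with ⟨j, b⟩
  rw [Finset.sum_eq_single j]
  · rw [(dW_seg t c j v).1, (dW_seg t c j v).2, h]
    cases b <;> simp [mul_comm]
  · intro i _ hi
    rw [(dW_seg t c i v).1, (dW_seg t c i v).2, h]
    simp [hi.symm]
  · simp

/-- Majorants are preserved under composition with `seg t`. -/
theorem maj_comp_seg {B : Set (Fin n → ℂ)} (hB : IsOpen B) (hBc : Convex ℝ B) {t : ℝ}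
    (ht : t ∈ Set.Icc (0 : ℝ) 1) {v : Fin n ⊕ Fin n ⊕ Fin n → ℂ} (hv : v ∈ dom3 B)
    {g : (Fin n ⊕ Fin n → ℂ) → ℂ} (hg : ContDiffOn ℝ ∞ g (dom2 B)) {M : ℕ → ℝ}
    (hM : ∀ k, 0 ≤ M k) {e : Bool → ℝ} (he : ∀ b, 0 ≤ e b) (h : Maj e M g (seg t v)) :
    Maj e M (fun w => g (seg t w)) v := by
  refine Maj.comp_linear (isOpen_dom3 hB) (isOpen_dom2 hB) (fun w _ => (seg t).differentiableAt)
    (seg t).contDiff.contDiffOn (mapsTo_seg hBc ht)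
    (fun c d => if segTarget c = d then (segFactor c t : ℂ) else 0)
    (fun w _ c k => dW_seg t c k w) (fun c => ?_) hv hg hM he (Or.inl fun c d hcd => ?_) h
  · rw [Finset.sum_eq_single (segTarget c)]
    · have := segFactor_mem c ht
      rw [if_pos rfl, Complex.norm_real, Real.norm_of_nonneg this.1]
      exact this.2
    · intro d _ hd
      simp [hd.symm]
    · simp
  · by_contra hne
    refine hcd (if_neg fun h => hne ?_)
    rw [← h, segTarget_snd]

/-! ### Averages along segments -/

/-- `∫₀¹ η(t) g(t x + (1 - t) y, z) dt`. -/
def segAvg (η : ℝ → ℝ) (g : (Fin n ⊕ Fin n → ℂ) → ℂ) (v : Fin n ⊕ Fin n ⊕ Fin n → ℂ) : ℂ :=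
  ∫ t in (0 : ℝ)..1, (η t : ℂ) * g (seg t v)

section segAvg

variable {B : Set (Fin n → ℂ)} {η : ℝ → ℝ} {g : (Fin n ⊕ Fin n → ℂ) → ℂ}

/-- Differentiation under the integral; the dominating constant comes from compactness of [0,1]
times a closed ball around v. Convexity of B keeps the segments inside the domain. -/
theorem hasFDerivAt_segAvg (hB : IsOpen B) (hBc : Convex ℝ B) (hη : Continuous η)
    (hg : ContDiffOn ℝ ∞ g (dom2 B)) {v : Fin n ⊕ Fin n ⊕ Fin n → ℂ} (hv : v ∈ dom3 B) :
    HasFDerivAt (segAvg η g)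
      (∫ t in (0 : ℝ)..1, (η t : ℂ) • (fderiv ℝ g (seg t v)).comp (seg t)) v ∧
    IntervalIntegrable (fun t => (η t : ℂ) • (fderiv ℝ g (seg t v)).comp (seg t))
      MeasureTheory.volume 0 1 := by
  have hO2 := isOpen_dom2 hB
  have hO3 := isOpen_dom3 hB
  obtain ⟨r, hr, hball⟩ := Metric.isOpen_iff.1 hO3 v hv
  set K := Set.Icc (0 : ℝ) 1 ×ˢ Metric.closedBall v (r / 2) with hK
  have hKc : IsCompact K := isCompact_Icc.prod (isCompact_closedBall v (r / 2))
  have hsub : ∀ w ∈ Metric.closedBall v (r / 2), w ∈ dom3 B := fun w hw =>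
    hball (Metric.closedBall_subset_ball (by linarith) hw)
  have hcseg : Continuous fun p : ℝ × (Fin n ⊕ Fin n ⊕ Fin n → ℂ) => seg p.1 p.2 :=
    (continuous_seg.comp continuous_fst).clm_apply continuous_snd
  have hmaps : Set.MapsTo (fun p : ℝ × (Fin n ⊕ Fin n ⊕ Fin n → ℂ) => seg p.1 p.2) K (dom2 B) :=
    fun p hp => mapsTo_seg hBc hp.1 (hsub _ hp.2)
  have hdg : ContinuousOn (fderiv ℝ g) (dom2 B) :=
    ((contDiffOn_infty_iff_fderiv_of_isOpen hO2).1 hg).2.continuousOn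
  have hF' : ContinuousOn (fun p : ℝ × (Fin n ⊕ Fin n ⊕ Fin n → ℂ) =>
      (η p.1 : ℂ) • (fderiv ℝ g (seg p.1 p.2)).comp (seg p.1)) K := by
    have h1 : ContinuousOn (fun p : ℝ × (Fin n ⊕ Fin n ⊕ Fin n → ℂ) => (η p.1 : ℂ)) K :=
      (Complex.continuous_ofReal.comp (hη.comp continuous_fst)).continuousOn
    have h2 : ContinuousOn (fun p : ℝ × (Fin n ⊕ Fin n ⊕ Fin n → ℂ) =>
        (fderiv ℝ g (seg p.1 p.2)).comp (seg p.1)) K :=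
      (hdg.comp hcseg.continuousOn hmaps).clm_comp
        (continuous_seg.comp continuous_fst).continuousOn
    exact h1.smul h2
  have hF : ContinuousOn (fun p : ℝ × (Fin n ⊕ Fin n ⊕ Fin n → ℂ) =>
      (η p.1 : ℂ) * g (seg p.1 p.2)) K :=
    (Complex.continuous_ofReal.comp (hη.comp continuous_fst)).continuousOn.mul
      (hg.continuousOn.comp hcseg.continuousOn hmaps)
  obtain ⟨C, hC⟩ := hKc.exists_bound_of_continuousOn hF'
  have hslice : ∀ w ∈ Metric.closedBall v (r / 2),
      ContinuousOn (fun t : ℝ => (η t : ℂ) * g (seg t w)) (Set.Icc 0 1) := fun w hw =>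
    hF.comp (continuous_id.prodMk continuous_const).continuousOn fun t ht => ⟨ht, hw⟩
  have hslice' : ContinuousOn (fun t : ℝ => (η t : ℂ) • (fderiv ℝ g (seg t v)).comp (seg t))
      (Set.Icc 0 1) :=
    hF'.comp (f := fun t : ℝ => (t, v)) (continuous_id.prodMk continuous_const).continuousOn
      fun t ht => ⟨ht, Metric.mem_closedBall_self (by positivity)⟩
  have hIoc : Set.uIoc (0 : ℝ) 1 ⊆ Set.Icc 0 1 := by
    rw [Set.uIoc_of_le zero_le_one]; exact Set.Ioc_subset_Icc_self
  have hInt' : IntervalIntegrable (fun t => (η t : ℂ) • (fderiv ℝ g (seg t v)).comp (seg t))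
      MeasureTheory.volume 0 1 :=
    ContinuousOn.intervalIntegrable (by rwa [Set.uIcc_of_le zero_le_one])
  refine ⟨?_, hInt'⟩
  refine intervalIntegral.hasFDerivAt_integral_of_dominated_of_fderiv_le (s := Metric.ball v (r / 2))
    (F := fun w t => (η t : ℂ) * g (seg t w))
    (F' := fun w t => (η t : ℂ) • (fderiv ℝ g (seg t w)).comp (seg t)) (bound := fun _ => C)
    (Metric.ball_mem_nhds v (by positivity)) ?_ ?_ ?_ ?_ ?_ ?_
  · filter_upwards [Metric.ball_mem_nhds v (by positivity : 0 < r / 2)] with w hw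
    exact ((hslice w (Metric.ball_subset_closedBall hw)).mono hIoc).aestronglyMeasurable
      measurableSet_uIoc
  · exact ContinuousOn.intervalIntegrable (by
      rw [Set.uIcc_of_le zero_le_one]
      exact hslice v (Metric.mem_closedBall_self (by positivity)))
  · exact (hslice'.mono hIoc).aestronglyMeasurable measurableSet_uIoc
  · exact Filter.Eventually.of_forall fun t ht w hw =>
      hC (t, w) ⟨hIoc ht, Metric.ball_subset_closedBall hw⟩
  · exact intervalIntegrable_const
  · refine Filter.Eventually.of_forall fun t ht w hw => ?_
    have h1 : seg t w ∈ dom2 B := mapsTo_seg hBc (hIoc ht)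
      (hsub w (Metric.ball_subset_closedBall hw))
    have h2 : HasFDerivAt (fun w => g (seg t w)) ((fderiv ℝ g (seg t w)).comp (seg t)) w :=
      (hg.differentiableAt_of_isOpen hO2 h1).hasFDerivAt.comp w (seg t).hasFDerivAt
    exact h2.const_mul (η t : ℂ)

/-- A derivative of an average is an average with weight η multiplied by 1 or 1 - t. Allowing a
general η makes the class stable under differentiation. -/
theorem dW_segAvg (hB : IsOpen B) (hBc : Convex ℝ B) (hη : Continuous η)
    (hg : ContDiffOn ℝ ∞ g (dom2 B)) (c : (Fin n ⊕ Fin n ⊕ Fin n) × Bool) :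
    Set.EqOn (dW c (segAvg η g))
      (segAvg (fun t => η t * segFactor c t) (dW (segTarget c) g)) (dom3 B) := by
  intro v hv
  obtain ⟨h1, h2⟩ := hasFDerivAt_segAvg hB hBc hη hg hv
  rw [dW, h1.fderiv, ← ContinuousLinearMap.intervalIntegral_comp_comm _ h2, segAvg]
  refine intervalIntegral.integral_congr fun t ht => ?_
  rw [Set.uIcc_of_le zero_le_one] at ht
  have h3 : DifferentiableAt ℝ g (seg t v) :=
    hg.differentiableAt_of_isOpen (isOpen_dom2 hB) (mapsTo_seg hBc ht hv)
  have h4 := dW_comp_seg h3 c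
  have h5 : HasFDerivAt (fun w => g (seg t w)) ((fderiv ℝ g (seg t v)).comp (seg t)) v :=
    h3.hasFDerivAt.comp v (seg t).hasFDerivAt
  rw [dW, h5.fderiv] at h4
  have h6 : wirForm c ((η t : ℂ) • (fderiv ℝ g (seg t v)).comp (seg t)) =
      (η t : ℂ) * wirForm c ((fderiv ℝ g (seg t v)).comp (seg t)) := by
    rw [wirForm_apply, wirForm_apply]
    simp only [smul_apply, smul_eq_mul]
    ring
  simp only [h6, h4]
  push_cast
  ring

theorem contDiffOn_segAvg (hB : IsOpen B) (hBc : Convex ℝ B) (hη : Continuous η)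
    (hg : ContDiffOn ℝ ∞ g (dom2 B)) : ContDiffOn ℝ ∞ (segAvg η g) (dom3 B) := by
  rw [contDiffOn_infty]
  intro m
  have hd : ∀ {η : ℝ → ℝ} {g : (Fin n ⊕ Fin n → ℂ) → ℂ}, Continuous η →
      ContDiffOn ℝ ∞ g (dom2 B) → DifferentiableOn ℝ (segAvg η g) (dom3 B) := fun hη hg v hv =>
    (hasFDerivAt_segAvg hB hBc hη hg hv).1.differentiableAt.differentiableWithinAt
  induction m generalizing η g with
  | zero => simpa using (hd hη hg).continuousOn
  | succ m ih =>
    exact contDiffOn_succ_of_dW (isOpen_dom3 hB) (hd hη hg) fun c =>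
      (ih (hη.mul (continuous_segFactor c)) (contDiffOn_dW (isOpen_dom2 hB) hg _)).congr
        (dW_segAvg hB hBc hη hg c)

/-- On `w = 0`, averages satisfy the same bounds as the averaged function. -/
theorem maj_segAvg (hB : IsOpen B) (hBc : Convex ℝ B) (hη : Continuous η)
    (hη1 : ∀ t ∈ Set.Icc (0 : ℝ) 1, η t ∈ Set.Icc (0 : ℝ) 1)
    (hg : ContDiffOn ℝ ∞ g (dom2 B)) {v : Fin n ⊕ Fin n ⊕ Fin n → ℂ} (hv : v ∈ dom3 B)
    (hw : pw v = 0) {e : Bool → ℝ} {M : ℕ → ℝ} (h : Maj e M g (baseL v)) :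
    Maj e M (segAvg η g) v := by
  intro L
  induction L generalizing η g e M with
  | nil =>
    refine le_trans ?_ (h [])
    simp only [dWord_nil, segAvg, seg_eq_base hw]
    rw [intervalIntegral.integral_mul_const, norm_mul]
    refine mul_le_of_le_one_left (norm_nonneg _) ?_
    have := intervalIntegral.norm_integral_le_of_norm_le_const (a := 0) (b := 1) (C := 1)
      (f := fun t => (η t : ℂ)) (fun t ht => by
        rw [Set.uIoc_of_le zero_le_one] at ht
        have h1 := hη1 t (Set.Ioc_subset_Icc_self ht)
        rw [Complex.norm_real, Real.norm_of_nonneg h1.1]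
        exact h1.2)
    simpa using this
  | cons c L ih =>
    rw [dWord_cons, dWord_congr (isOpen_dom3 hB) (dW_segAvg hB hBc hη hg c) L hv]
    have h1 := ih (η := fun t => η t * segFactor c t) (hη.mul (continuous_segFactor c)) (fun t ht => by
      have h2 := hη1 t ht
      have h3 := segFactor_mem c ht
      exact ⟨mul_nonneg h2.1 h3.1, mul_le_one₀ h2.2 h3.1 h3.2⟩)
      (contDiffOn_dW (isOpen_dom2 hB) hg (segTarget c)) (h.dW (segTarget c))
    simpa [segTarget_snd] using h1

end segAvg

end

end BBS

namespace BBS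

noncomputable section

variable {ι κ : Type} [Fintype ι] [DecidableEq ι] [Fintype κ] [DecidableEq κ]

/-! ### Slices -/

theorem dW_comp_of_single {F : (ι → ℂ) → ℂ} {g : (κ → ℂ) → ι → ℂ} {u : κ → ℂ}
    {A : (κ → ℂ) →L[ℝ] (ι → ℂ)} (hF : DifferentiableAt ℝ F (g u)) (hg : HasFDerivAt g A u)
    {k : κ} {k' : ι} (hA : ∀ c : ℂ, A (Pi.single k c) = Pi.single k' c) (b : Bool) :
    dW (k, b) (fun w => F (g w)) u = dW (k', b) F (g u) := by
  have h : HasFDerivAt (fun w => F (g w)) ((fderiv ℝ F (g u)).comp A) u :=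
    hF.hasFDerivAt.comp u hg
  simp only [dW]
  rw [h.fderiv, wirForm_apply, wirForm_apply]
  simp [hA]

/-- The linear map which inserts `u` in the slots given by `σ`. -/
def insertL (σ : ι → Option κ) : (κ → ℂ) →L[ℝ] (ι → ℂ) :=
  ContinuousLinearMap.pi fun i => (σ i).elim 0 fun k =>
    ContinuousLinearMap.proj (R := ℝ) (φ := fun _ : κ => ℂ) k

theorem insertL_apply {ι κ : Type} (σ : ι → Option κ) (u : κ → ℂ) (i : ι) :
    insertL σ u i = (σ i).elim 0 u := by
  simp only [insertL, ContinuousLinearMap.pi_apply]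
  cases σ i <;> simp

theorem insertL_single {ι κ : Type} [DecidableEq ι] [DecidableEq κ] {σ : ι → Option κ} {k : κ} {k' : ι} (h : ∀ i, σ i = some k ↔ i = k')
    (c : ℂ) : insertL σ (Pi.single k c) = Pi.single k' c := by
  funext i
  rw [insertL_apply]
  by_cases hi : i = k'
  · rw [(h i).2 hi, hi]; simp
  · rw [Pi.single_eq_of_ne hi]
    rcases hs : σ i with _ | l
    · simp
    · have : l ≠ k := fun hl => hi ((h i).1 (by rw [hs, hl]))
      simp [this]

/-- A Wirtinger derivative of the restriction of a function to an affine coordinate subspace. -/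
theorem dW_slice {F : (ι → ℂ) → ℂ} {g : (κ → ℂ) → ι → ℂ} {u : κ → ℂ}
    (hF : DifferentiableAt ℝ F (g u)) {σ : ι → Option κ} {p : ι → ℂ}
    (hg : ∀ w, g w = p + insertL σ w) {k : κ} {k' : ι} (h : ∀ i, σ i = some k ↔ i = k')
    (b : Bool) : dW (k, b) (fun w => F (g w)) u = dW (k', b) F (g u) := by
  refine dW_comp_of_single (A := insertL σ) hF ?_ (insertL_single h) b
  have : g = fun w => p + insertL σ w := funext hg
  rw [this]
  exact (insertL σ).hasFDerivAt.const_add p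

variable {n : ℕ}

theorem dW_slice_fst {F : (Fin n ⊕ Fin n → ℂ) → ℂ} {y z : Fin n → ℂ}
    (hF : DifferentiableAt ℝ F (Sum.elim y z)) (i : Fin n) (b : Bool) :
    dW (i, b) (fun w => F (Sum.elim w z)) y = dW (Sum.inl i, b) F (Sum.elim y z) :=
  dW_slice (g := fun w => Sum.elim w z) hF (σ := Sum.elim some fun _ => none) (p := Sum.elim 0 z)
    (fun w => by funext k; rcases k with k | k <;> simp [insertL_apply])
    (fun k => by rcases k with k | k <;> simp) b

theorem dW_slice_snd {F : (Fin n ⊕ Fin n → ℂ) → ℂ} {y z : Fin n → ℂ}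
    (hF : DifferentiableAt ℝ F (Sum.elim y z)) (i : Fin n) (b : Bool) :
    dW (i, b) (fun w => F (Sum.elim y w)) z = dW (Sum.inr i, b) F (Sum.elim y z) :=
  dW_slice (g := fun w => Sum.elim y w) hF (σ := Sum.elim (fun _ => none) some) (p := Sum.elim y 0)
    (fun w => by funext k; rcases k with k | k <;> simp [insertL_apply])
    (fun k => by rcases k with k | k <;> simp) b

/-- The point `(x, w, z)` of `ℂ³ⁿ`. -/
def pt (x w z : Fin n → ℂ) : Fin n ⊕ Fin n ⊕ Fin n → ℂ := Sum.elim x (Sum.elim w z)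

@[simp] theorem px_pt (x w z : Fin n → ℂ) : px (pt x w z) = x := rfl
@[simp] theorem pw_pt (x w z : Fin n → ℂ) : pw (pt x w z) = w := rfl
@[simp] theorem pz_pt (x w z : Fin n → ℂ) : pz (pt x w z) = z := rfl
@[simp] theorem py_pt (x w z : Fin n → ℂ) : py (pt x w z) = x + w := rfl

@[simp] theorem pt_eta (v : Fin n ⊕ Fin n ⊕ Fin n → ℂ) : pt (px v) (pw v) (pz v) = v := by
  funext k
  rcases k with k | k | k <;> rfl

theorem dW_slice_pt {F : (Fin n ⊕ Fin n ⊕ Fin n → ℂ) → ℂ} {x w z : Fin n → ℂ}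
    (hF : DifferentiableAt ℝ F (pt x w z)) (i : Fin n) (b : Bool) :
    dW (i, b) (fun u => F (pt x w u)) z = dW (Sum.inr (Sum.inr i), b) F (pt x w z) :=
  dW_slice (g := fun u => pt x w u) hF (σ := Sum.elim (fun _ => none) (Sum.elim (fun _ => none) some))
    (p := pt x w 0)
    (fun u => by funext k; rcases k with k | k | k <;> simp [insertL_apply, pt])
    (fun k => by rcases k with k | k | k <;> simp) b

/-! ### The function `θ` -/

/-- The components of `θ(x, x + w, z)` as functions of `(x, w, z)`. -/
def thetaFun (g : (Fin n ⊕ Fin n → ℂ) → ℂ) (i : Fin n) : (Fin n ⊕ Fin n ⊕ Fin n → ℂ) → ℂ :=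
  segAvg (fun _ => 1) (dW (Sum.inl i, false) g)

/-- The matrix `θ_z`. -/
def thetaZ (g : (Fin n ⊕ Fin n → ℂ) → ℂ) (v : Fin n ⊕ Fin n ⊕ Fin n → ℂ) :
    Matrix (Fin n) (Fin n) ℂ :=
  Matrix.of fun i j => dW (Sum.inr (Sum.inr j), false) (thetaFun g i) v

/-- The matrix `θ_z̄`. -/
def thetaZbar (g : (Fin n ⊕ Fin n → ℂ) → ℂ) (v : Fin n ⊕ Fin n ⊕ Fin n → ℂ) :
    Matrix (Fin n) (Fin n) ℂ :=
  Matrix.of fun i j => dW (Sum.inr (Sum.inr j), true) (thetaFun g i) v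

/-- The mixed Hessian `ψ_yz(y, z)`. -/
def mixedHess (g : (Fin n ⊕ Fin n → ℂ) → ℂ) (v : Fin n ⊕ Fin n ⊕ Fin n → ℂ) :
    Matrix (Fin n) (Fin n) ℂ :=
  Matrix.of fun i j => dW (Sum.inl i, false) (dW (Sum.inr j, false) g) (seg 0 v)

section

variable {B : Set (Fin n → ℂ)} {ψ : (Fin n → ℂ) → (Fin n → ℂ) → ℂ}

theorem pt_mem_dom3 {x w z : Fin n → ℂ} (hx : x ∈ B) (hy : x + w ∈ B) (hz : z ∈ B) :
    pt x w z ∈ dom3 B := ⟨hx, hy, hz⟩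

theorem theta_eq_thetaFun (hB : IsOpen B) (hBc : Convex ℝ B)
    (hψ : ContDiffOn ℝ ∞ (joint ψ) (dom2 B)) {v : Fin n ⊕ Fin n ⊕ Fin n → ℂ} (hv : v ∈ dom3 B)
    (i : Fin n) : theta ψ (px v) (py v) (pz v) i = thetaFun (joint ψ) i v := by
  unfold theta thetaFun segAvg
  refine intervalIntegral.integral_congr fun t ht => ?_
  rw [Set.uIcc_of_le zero_le_one] at ht
  have h1 := mapsTo_seg hBc ht hv
  have h2 := hψ.differentiableAt_of_isOpen (isOpen_dom2 hB) h1
  rw [seg_eq] at h2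
  have := dW_slice_fst h2 i false
  simp only [seg_eq]
  rw [← this, dW_false]
  simp [joint]

/-- Derivatives of slices are the corresponding derivatives of the joint functions. The inner
functions are compared on all of B, since differentiating an equality requires it on a
neighbourhood. -/
theorem delta0_eq (hB : IsOpen B) (hBc : Convex ℝ B)
    (hψ : ContDiffOn ℝ ∞ (joint ψ) (dom2 B)) {v : Fin n ⊕ Fin n ⊕ Fin n → ℂ} (hv : v ∈ dom3 B) :
    delta0 ψ (px v) (py v) (pz v) =
      (mixedHess (joint ψ) v).det * ((thetaZ (joint ψ) v).det)⁻¹ := by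
  have hO2 := isOpen_dom2 hB
  have hO3 := isOpen_dom3 hB
  unfold delta0
  rw [div_eq_mul_inv]
  congr 1
  · congr 1
    ext i j
    simp only [Matrix.of_apply, mixedHess]
    have h0 : seg 0 v = Sum.elim (py v) (pz v) := by rw [seg_eq]; simp
    have hmem : Sum.elim (py v) (pz v) ∈ dom2 B := ⟨hv.2.1, hv.2.2⟩
    rw [h0, ← dW_slice_fst ((contDiffOn_dW hO2 hψ _).differentiableAt_of_isOpen hO2 hmem),
      ← dW_false]
    refine dW_congr hB (fun y' hy' => ?_) _ hv.2.1
    have hm' : Sum.elim y' (pz v) ∈ dom2 B := ⟨hy', hv.2.2⟩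
    rw [← dW_slice_snd (hψ.differentiableAt_of_isOpen hO2 hm'), dW_false]
    rfl
  · congr 2
    ext i j
    simp only [Matrix.of_apply, thetaZ]
    have h1 : ContDiffOn ℝ ∞ (thetaFun (joint ψ) i) (dom3 B) :=
      contDiffOn_segAvg hB hBc continuous_const (contDiffOn_dW hO2 hψ _)
    have h2 := dW_slice_pt (x := px v) (w := pw v) (z := pz v)
      (by rw [pt_eta]; exact h1.differentiableAt_of_isOpen hO3 hv) j false
    rw [pt_eta] at h2
    rw [← h2, ← dW_false]
    refine dW_congr hB (fun z' hz' => ?_) _ hv.2.2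
    exact theta_eq_thetaFun hB hBc hψ (v := pt (px v) (pw v) z') ⟨hv.1, hv.2.1, hz'⟩ i

end

/-! ### Gevrey bounds on `w = 0` -/

/-- The points `(x, 0, z)` with `x, z ∈ B` and `(x, z) ∈ S`. -/
def lift3 (B : Set (Fin n → ℂ)) (S : Set (Fin n ⊕ Fin n → ℂ)) :
    Set (Fin n ⊕ Fin n ⊕ Fin n → ℂ) := {v | v ∈ dom3 B ∧ pw v = 0 ∧ baseL v ∈ S}

theorem lift3_subset (B : Set (Fin n → ℂ)) (S : Set (Fin n ⊕ Fin n → ℂ)) :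
    lift3 B S ⊆ dom3 B := fun _ h => h.1

section

variable {B : Set (Fin n → ℂ)} {S : Set (Fin n ⊕ Fin n → ℂ)} {s : ℝ}
  {w : (Fin n ⊕ Fin n → ℂ) → Bool → ℝ} {g : (Fin n ⊕ Fin n → ℂ) → ℂ}

theorem isGev_segAvg (hB : IsOpen B) (hBc : Convex ℝ B) (h : IsGev (dom2 B) S s w g) :
    IsGev (dom3 B) (lift3 B S) s (fun v => w (baseL v)) (segAvg (fun _ => 1) g) := by
  obtain ⟨h1, C, R, hC, hR, h⟩ := h
  exact ⟨contDiffOn_segAvg hB hBc continuous_const h1, C, R, hC, hR, fun v hv =>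
    maj_segAvg hB hBc continuous_const (by simp) h1 hv.1 hv.2.1 (h _ hv.2.2)⟩

theorem isGev_comp_seg (hB : IsOpen B) (hBc : Convex ℝ B) (hw : ∀ v ∈ S, ∀ b, 0 ≤ w v b)
    (h : IsGev (dom2 B) S s w g) {t : ℝ} (ht : t ∈ Set.Icc (0 : ℝ) 1) :
    IsGev (dom3 B) (lift3 B S) s (fun v => w (baseL v)) (fun v => g (seg t v)) := by
  obtain ⟨h1, C, R, hC, hR, h⟩ := h
  refine ⟨h1.comp (seg t).contDiff.contDiffOn (mapsTo_seg hBc ht), C, R, hC, hR, fun v hv => ?_⟩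
  refine maj_comp_seg hB hBc ht hv.1 h1 (gev_nonneg hC hR 0) (hw _ hv.2.2) ?_
  rw [seg_eq_base hv.2.1]
  exact h _ hv.2.2

end

/-! ### Systems of linear equations with Gevrey coefficients -/

section linear

variable {O S : Set (ι → ℂ)} {s : ℝ} {m : Type} [Fintype m] [DecidableEq m]

/-- The value at a point of a matrix of functions. -/
def evalMat {ι m m' : Type} (M : Matrix m m' ((ι → ℂ) → ℂ)) (v : ι → ℂ) : Matrix m m' ℂ :=
  M.map fun f => f v

theorem evalMat_mul {ι m : Type} [Fintype m] (M N : Matrix m m ((ι → ℂ) → ℂ)) (v : ι → ℂ) :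
    evalMat (M * N) v = evalMat M v * evalMat N v :=
  Matrix.map_mul (f := Pi.evalRingHom (fun _ : ι → ℂ => ℂ) v)

theorem evalMat_mulVec {ι m : Type} [Fintype m] (M : Matrix m m ((ι → ℂ) → ℂ)) (r : m → (ι → ℂ) → ℂ) (v : ι → ℂ) :
    (fun i => (M.mulVec r) i v) = (evalMat M v).mulVec fun i => r i v := by
  funext i
  exact (Pi.evalRingHom (fun _ : ι → ℂ => ℂ) v).map_mulVec M r i

theorem det_evalMat {ι m : Type} [Fintype m] [DecidableEq m] (M : Matrix m m ((ι → ℂ) → ℂ)) (v : ι → ℂ) :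
    (evalMat M v).det = M.det v :=
  ((Pi.evalRingHom (fun _ : ι → ℂ => ℂ) v).map_det M).symm

/-- The entries of an inverse matrix are Gevrey. -/
theorem exists_inv_isGev {w : (ι → ℂ) → Bool → ℝ} (hO : IsOpen O) (hS : S ⊆ O) (hs : 1 ≤ s)
    (hw : ∀ v ∈ S, ∀ b, 0 ≤ w v b) (hw1 : ∀ v ∈ S, w v false = 1)
    (hww : ∀ v ∈ S, ∀ b b', w v b * w v b' ≤ w v (b || b')) {M : Matrix m m ((ι → ℂ) → ℂ)}
    (hM : ∀ i j, IsGev O S s w (M i j)) {c₀ : ℝ} (hc₀ : 0 < c₀)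
    (hdet : ∀ v ∈ O, c₀ ≤ ‖(evalMat M v).det‖) :
    ∃ N : Matrix m m ((ι → ℂ) → ℂ), (∀ i j, IsGev O S s w (N i j)) ∧
      ∀ v ∈ O, evalMat N v = (evalMat M v)⁻¹ := by
  set A := gevRing hO hS (zero_le_one.trans hs) hw hw1 hww
  have hd : IsGev O S s w M.det := det_mem_subring A hM
  have hdet' : ∀ v ∈ O, c₀ ≤ ‖M.det v‖ := fun v hv => by rw [← det_evalMat]; exact hdet v hv
  have hd' : IsGev O S s w (fun v => (M.det v)⁻¹) :=
    hd.inv hO hS hs hw1 hww (fun v hv h0 => by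
      have := hdet' v hv
      rw [h0, norm_zero] at this
      linarith) hc₀ fun v hv => hdet' v (hS hv)
  refine ⟨Matrix.of fun i j => (fun v => (M.det v)⁻¹) * M.adjugate i j,
    fun i j => A.mul_mem hd' (adjugate_mem_subring A hM i j), fun v _ => ?_⟩
  have hadj : (evalMat M v).adjugate = evalMat M.adjugate v :=
    ((Pi.evalRingHom (fun _ : ι → ℂ => ℂ) v).map_adjugate M).symm
  rw [Matrix.inv_def, Ring.inverse_eq_inv', det_evalMat, hadj]
  ext i j
  simp [evalMat]

end linear

end

end BBS

/-! ### Elimination with flat coefficients, and iteration of operators -/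

namespace BBS

noncomputable section

variable {ι : Type} [Fintype ι] [DecidableEq ι]

theorem mulVec_mem_subring {R : Type*} [CommRing R] {m : Type*} [Fintype m] (A : Subring R)
    {M : Matrix m m R} {r : m → R} (hM : ∀ i j, M i j ∈ A) (hr : ∀ j, r j ∈ A) (i : m) :
    M.mulVec r i ∈ A :=
  A.sum_mem fun j _ => A.mul_mem (hM i j) (hr j)

section linear

variable {O S : Set (ι → ℂ)} {s : ℝ} {m : Type} [Fintype m] [DecidableEq m] {E : (ι → ℂ) → ℝ}

theorem holWeight_nonneg {ι : Type} {E : (ι → ℂ) → ℝ} {v : ι → ℂ} (h : 0 ≤ E v) (b : Bool) : 0 ≤ holWeight E v b := by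
  cases b <;> simp [holWeight, h]

theorem holWeight_le_one {ι : Type} {E : (ι → ℂ) → ℝ} {v : ι → ℂ} (h : E v ≤ 1) (b : Bool) : holWeight E v b ≤ 1 := by
  cases b <;> simp [holWeight, h]

theorem le_holWeight {ι : Type} {E : (ι → ℂ) → ℝ} {v : ι → ℂ} (h : E v ≤ 1) (b : Bool) : E v ≤ holWeight E v b := by
  cases b <;> simp [holWeight, h]

/-- With 0 ≤ E ≤ 1, a product carries the weight E as soon as one factor does. This is the
submultiplicativity required by the Leibniz rule and by `gevRing`. -/
theorem holWeight_mul_le {ι : Type} {E : (ι → ℂ) → ℝ} {v : ι → ℂ} (h0 : 0 ≤ E v) (h1 : E v ≤ 1) (b b' : Bool) :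
    holWeight E v b * holWeight E v b' ≤ holWeight E v (b || b') := by
  cases b <;> cases b' <;> simp [holWeight]
  exact mul_le_of_le_one_left h0 h1

theorem isGev_zero {w : (ι → ℂ) → Bool → ℝ} : IsGev O S s w 0 :=
  ⟨contDiffOn_const, 0, 0, le_rfl, le_rfl, fun v _ L => by
    have : dWord L (0 : (ι → ℂ) → ℂ) v = 0 := by
      change dWord L (fun _ => 0) v = 0
      rw [dWord_const]; simp
    simp [this, gev]⟩

theorem isGev_sum {α : Type*} {w : (ι → ℂ) → Bool → ℝ} (hO : IsOpen O) (hS : S ⊆ O)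
    (hw : ∀ v ∈ S, ∀ b, 0 ≤ w v b) (t : Finset α) {F : α → (ι → ℂ) → ℂ}
    (hF : ∀ i, IsGev O S s w (F i)) : IsGev O S s w (∑ i ∈ t, F i) := by
  classical
  induction t using Finset.induction_on with
  | empty => exact isGev_zero
  | insert i t hi ih => rw [Finset.sum_insert hi]; exact (hF i).add hO hS hw ih

/-- Solutions of a linear system `P γ + Q γ' = r`, `Q' γ + P' γ' = r'`, whose coefficients in the
first half are almost holomorphic, and in which `Q` is flat. -/
theorem exists_solution_isGev (hO : IsOpen O) (hS : S ⊆ O) (hs : 1 ≤ s)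
    (hE0 : ∀ v ∈ S, 0 ≤ E v) (hE1 : ∀ v ∈ S, E v ≤ 1) {P Q P' Q' : Matrix m m ((ι → ℂ) → ℂ)}
    (hP : ∀ i j, IsGev O S s (holWeight E) (P i j)) (hQ : ∀ i j, IsGev O S s (fun v _ => E v) (Q i j))
    (hP' : ∀ i j, IsGev O S s (fun _ _ => 1) (P' i j))
    (hQ' : ∀ i j, IsGev O S s (fun _ _ => 1) (Q' i j)) {c₀ : ℝ} (hc₀ : 0 < c₀)
    (hdet' : ∀ v ∈ O, c₀ ≤ ‖(evalMat P' v).det‖)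
    (hdet : ∀ v ∈ O, c₀ ≤
      ‖(evalMat P v - evalMat Q v * (evalMat P' v)⁻¹ * evalMat Q' v).det‖)
    {r r' : m → (ι → ℂ) → ℂ} (hr : ∀ i, IsGev O S s (holWeight E) (r i))
    (hr' : ∀ i, IsGev O S s (fun _ _ => 1) (r' i)) :
    ∃ c c' : m → (ι → ℂ) → ℂ, (∀ i, IsGev O S s (holWeight E) (c i)) ∧
      (∀ i, IsGev O S s (fun _ _ => 1) (c' i)) ∧ ∀ v ∈ O, ∀ γ γ' : m → ℂ,
        ((evalMat P v).mulVec γ + (evalMat Q v).mulVec γ' = fun i => r i v) →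
        ((evalMat Q' v).mulVec γ + (evalMat P' v).mulVec γ' = fun i => r' i v) →
        (∀ i, γ i = c i v) ∧ ∀ i, γ' i = c' i v := by
  have hs0 : 0 ≤ s := zero_le_one.trans hs
  have hwA : ∀ v ∈ S, ∀ b, 0 ≤ holWeight E v b := fun v hv => holWeight_nonneg (hE0 v hv)
  have hwA1 : ∀ v ∈ S, holWeight E v false = 1 := fun v _ => rfl
  have hwAm : ∀ v ∈ S, ∀ b b', holWeight E v b * holWeight E v b' ≤ holWeight E v (b || b') :=
    fun v hv => holWeight_mul_le (hE0 v hv) (hE1 v hv)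
  have hwB : ∀ v ∈ S, ∀ b : Bool, (0 : ℝ) ≤ (fun (_ : ι → ℂ) (_ : Bool) => (1 : ℝ)) v b :=
    fun _ _ _ => zero_le_one
  have hwI : ∀ v ∈ S, ∀ b : Bool, 0 ≤ (fun v (_ : Bool) => E v) v b := fun v hv _ => hE0 v hv
  set A := gevRing hO hS hs0 hwA hwA1 hwAm with hA
  set A' := gevRing hO hS hs0 hwB (fun _ _ => rfl) (fun _ _ _ _ => by simp) with hA'
  have hAA' : ∀ {f}, IsGev O S s (holWeight E) f → IsGev O S s (fun _ _ => 1) f := fun hf =>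
    hf.mono_weight fun v hv => holWeight_le_one (hE1 v hv)
  have hIA : ∀ {f}, IsGev O S s (fun v _ => E v) f → IsGev O S s (holWeight E) f := fun hf =>
    hf.mono_weight fun v hv => le_holWeight (hE1 v hv)
  have hImul : ∀ {f g}, IsGev O S s (fun v _ => E v) f → IsGev O S s (fun _ _ => 1) g →
      IsGev O S s (fun v _ => E v) (f * g) := fun hf hg =>
    IsGev.mul hO hS hs0 hwI (fun v _ _ _ => by simp) hf hg
  obtain ⟨N, hN, hNinv⟩ := exists_inv_isGev hO hS hs hwB (fun _ _ => rfl) (fun _ _ _ _ => by simp)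
    hP' hc₀ hdet'
  -- The inverse N of P' is only Gevrey, not almost holomorphic. Every use of it in the equation for
  -- γ comes with a factor Q whose derivatives of every type carry E, so the product is flat.
  have hQN : ∀ i j, IsGev O S s (fun v _ => E v) ((Q * N) i j) := fun i j => by
    rw [Matrix.mul_apply]
    exact isGev_sum hO hS hwI _ fun k => hImul (hQ i k) (hN k j)
  have hQNQ : ∀ i j, IsGev O S s (fun v _ => E v) ((Q * N * Q') i j) := fun i j => by
    rw [Matrix.mul_apply]
    exact isGev_sum hO hS hwI _ fun k => hImul (hQN i k) (hQ' k j)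
  -- The Schur complement of P' is a flat perturbation of P, hence almost holomorphic, and so is its
  -- inverse.
  have hT : ∀ i j, IsGev O S s (holWeight E) ((P - Q * N * Q') i j) := fun i j =>
    A.sub_mem (hP i j) (hIA (hQNQ i j))
  have hTev : ∀ v ∈ O, evalMat (P - Q * N * Q') v =
      evalMat P v - evalMat Q v * (evalMat P' v)⁻¹ * evalMat Q' v := fun v hv => by
    rw [← hNinv v hv, ← evalMat_mul, ← evalMat_mul]
    rfl
  obtain ⟨T', hT', hT'inv⟩ := exists_inv_isGev hO hS hs hwA hwA1 hwAm hT hc₀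
    (fun v hv => by rw [hTev v hv]; exact hdet v hv)
  have hc : ∀ i, IsGev O S s (holWeight E) (T'.mulVec (r - (Q * N).mulVec r') i) :=
    mulVec_mem_subring A hT' fun i => A.sub_mem (hr i)
      (hIA (isGev_sum hO hS hwI _ fun k => hImul (hQN i k) (hr' k)))
  refine ⟨T'.mulVec (r - (Q * N).mulVec r'),
    N.mulVec (r' - Q'.mulVec (T'.mulVec (r - (Q * N).mulVec r'))), hc,
    mulVec_mem_subring A' hN fun i => A'.sub_mem (hr' i)
      (mulVec_mem_subring A' hQ' (fun i => hAA' (hc i)) i), fun v hv γ γ' h1 h2 => ?_⟩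
  have hunit : ∀ {M : Matrix m m ℂ}, c₀ ≤ ‖M.det‖ → IsUnit M.det := fun {M} hM => by
    rw [isUnit_iff_ne_zero]
    intro h0
    rw [h0, norm_zero] at hM
    linarith
  have hγ' : γ' = (evalMat N v).mulVec ((fun i => r' i v) - (evalMat Q' v).mulVec γ) := by
    rw [← h2, add_sub_cancel_left, Matrix.mulVec_mulVec, hNinv v hv,
      Matrix.nonsing_inv_mul _ (hunit (hdet' v hv)), Matrix.one_mulVec]
  have hγ : γ = (evalMat T' v).mulVec ((fun i => r i v) -
      (evalMat (Q * N) v).mulVec fun i => r' i v) := by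
    have h3 : (evalMat (P - Q * N * Q') v).mulVec γ = (fun i => r i v) -
        (evalMat (Q * N) v).mulVec fun i => r' i v := by
      rw [← h1, hγ', Matrix.mulVec_mulVec, Matrix.mulVec_sub, ← evalMat_mul, Matrix.mulVec_mulVec,
        ← evalMat_mul]
      have : evalMat (P - Q * N * Q') v = evalMat P v - evalMat (Q * N * Q') v := rfl
      rw [this, Matrix.sub_mulVec]
      abel
    rw [← h3, Matrix.mulVec_mulVec, hT'inv v hv, Matrix.nonsing_inv_mul _
      (hunit (by rw [hTev v hv]; exact hdet v hv)), Matrix.one_mulVec]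
  have hcv : γ = fun i => (T'.mulVec (r - (Q * N).mulVec r')) i v := by
    rw [evalMat_mulVec, hγ, ← evalMat_mulVec (Q * N)]
    rfl
  refine ⟨congrFun hcv, congrFun (?_ : γ' = _)⟩
  rw [evalMat_mulVec, hγ', hcv, ← evalMat_mulVec Q']
  rfl

end linear

/-! ### Operators which raise the factorial exponent by a fixed amount -/

/-- `X` preserves smoothness, and raises the shift `N` in the Gevrey bounds `A R^k (k + N)!^s`
by `d`, at the price of a constant. -/
def Tame (O S : Set (ι → ℂ)) (s : ℝ) (w : (ι → ℂ) → Bool → ℝ) (d : ℕ)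
    (X : ((ι → ℂ) → ℂ) → (ι → ℂ) → ℂ) : Prop :=
  (∀ F, ContDiffOn ℝ ∞ F O → ContDiffOn ℝ ∞ (X F) O) ∧
    ∃ R₁ : ℝ, 0 ≤ R₁ ∧ ∀ R, R₁ ≤ R → ∃ K : ℝ, 0 ≤ K ∧ ∀ F, ContDiffOn ℝ ∞ F O →
      ∀ v ∈ S, ∀ A N, 0 ≤ A → Maj (w v) (gev s A R N) F v →
        Maj (w v) (gev s (K * A) R (N + d)) (X F) v

section Tame

variable {O S : Set (ι → ℂ)} {s : ℝ} {w : (ι → ℂ) → Bool → ℝ} {d d' : ℕ}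

theorem Tame.comp {X Y : ((ι → ℂ) → ℂ) → (ι → ℂ) → ℂ} (hX : Tame O S s w d X)
    (hY : Tame O S s w d' Y) : Tame O S s w (d' + d) (fun F => X (Y F)) := by
  obtain ⟨hX1, R₁, hR₁, hX⟩ := hX
  obtain ⟨hY1, R₂, hR₂, hY⟩ := hY
  refine ⟨fun F hF => hX1 _ (hY1 F hF), max R₁ R₂, by positivity, fun R hR => ?_⟩
  obtain ⟨K, hK, hX⟩ := hX R ((le_max_left _ _).trans hR)
  obtain ⟨K', hK', hY⟩ := hY R ((le_max_right _ _).trans hR)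
  refine ⟨K * K', by positivity, fun F hF v hv A N hA h => ?_⟩
  have := hX _ (hY1 F hF) v hv _ _ (mul_nonneg hK' hA) (hY F hF v hv A N hA h)
  rwa [← mul_assoc, add_assoc] at this

theorem Tame.add {X Y : ((ι → ℂ) → ℂ) → (ι → ℂ) → ℂ} (hO : IsOpen O) (hS : S ⊆ O)
    (hX : Tame O S s w d X) (hY : Tame O S s w d Y) :
    Tame O S s w d (fun F v => X F v + Y F v) := by
  obtain ⟨hX1, R₁, hR₁, hX⟩ := hX
  obtain ⟨hY1, R₂, hR₂, hY⟩ := hY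
  refine ⟨fun F hF => (hX1 F hF).add (hY1 F hF), max R₁ R₂, by positivity, fun R hR => ?_⟩
  obtain ⟨K, hK, hX⟩ := hX R ((le_max_left _ _).trans hR)
  obtain ⟨K', hK', hY⟩ := hY R ((le_max_right _ _).trans hR)
  refine ⟨K + K', by positivity, fun F hF v hv A N hA h => ?_⟩
  have := (hX F hF v hv A N hA h).add hO (hS hv) (hX1 F hF) (hY1 F hF) (hY F hF v hv A N hA h)
  convert this using 2
  unfold gev; ring

theorem tame_zero : Tame O S s w d (fun _ _ => 0) :=
  ⟨fun _ _ => contDiffOn_const, 0, le_rfl, fun R _ => ⟨0, le_rfl, fun F _ v _ A N _ _ L => by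
    rw [dWord_const]; simp [gev]⟩⟩

theorem Tame.sum {α : Type*} (hO : IsOpen O) (hS : S ⊆ O) (t : Finset α)
    {X : α → ((ι → ℂ) → ℂ) → (ι → ℂ) → ℂ} (hX : ∀ i, Tame O S s w d (X i)) :
    Tame O S s w d (fun F v => ∑ i ∈ t, X i F v) := by
  classical
  induction t using Finset.induction_on with
  | empty => simpa using tame_zero
  | insert i t hi ih =>
    simp only [Finset.sum_insert hi]
    exact (hX i).add hO hS ih

/-- Multiplication of derivatives by a Gevrey coefficient. -/
theorem tame_mul_dW {w' : (ι → ℂ) → Bool → ℝ} (hO : IsOpen O) (hS : S ⊆ O) (hs : 1 ≤ s)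
    (hw0 : ∀ v ∈ S, ∀ b, 0 ≤ w v b) {c : ι × Bool}
    (hw : ∀ v ∈ S, ∀ b b', w' v b * w v (c.2 || b') ≤ w v (b || b')) {f : (ι → ℂ) → ℂ}
    (hf : IsGev O S s w' f) :
    Tame O S s w 1 (fun F v => f v * dW c F v) := by
  obtain ⟨hf1, C, R₀, hC, hR₀, hf⟩ := hf
  refine ⟨fun F hF => hf1.mul (contDiffOn_dW hO hF c), 2 * R₀, by positivity, fun R hR => ?_⟩
  have hR0 : 0 ≤ R := by linarith
  refine ⟨2 * C * R, by positivity, fun F hF v hv A N hA h => ?_⟩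
  have h1 := h.dW c
  have h2 : (fun k => gev s A R N (k + 1)) = gev s (A * R) R (N + 1) := by
    funext k; rw [gev_succ_shift]
  rw [h2] at h1
  have h3 := (hf v hv).mul hO (hS hv) hf1 (contDiffOn_dW hO hF c) (gev_nonneg hC hR₀ 0)
    (gev_nonneg (mul_nonneg hA hR0) hR0 _) h1 (hw v hv)
  refine h3.mono (fun k => ?_) (hw0 v hv)
  refine (conv_gev_le_of_two_mul_le hs hC hR₀ (mul_nonneg hA hR0) hR _ k).trans (le_of_eq ?_)
  congr 1
  ring

/-- Since R is fixed during the iteration, k applications cost only K^k and a shift by k d. Any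
growth of the radius would ruin the bound in m. -/
theorem maj_iterate {X : ((ι → ℂ) → ℂ) → (ι → ℂ) → ℂ} {R K : ℝ} (hK : 0 ≤ K)
    (hX1 : ∀ F, ContDiffOn ℝ ∞ F O → ContDiffOn ℝ ∞ (X F) O)
    (hX : ∀ F, ContDiffOn ℝ ∞ F O → ∀ v ∈ S, ∀ A N, 0 ≤ A → Maj (w v) (gev s A R N) F v →
        Maj (w v) (gev s (K * A) R (N + d)) (X F) v) {F : (ι → ℂ) → ℂ} (hF : ContDiffOn ℝ ∞ F O)
    {v : ι → ℂ} (hv : v ∈ S) {A : ℝ} {N : ℕ} (hA : 0 ≤ A) (h : Maj (w v) (gev s A R N) F v)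
    (k : ℕ) : ContDiffOn ℝ ∞ (X^[k] F) O ∧ Maj (w v) (gev s (K ^ k * A) R (N + k * d)) (X^[k] F) v := by
  induction k with
  | zero => simpa using ⟨hF, h⟩
  | succ k ih =>
    rw [Function.iterate_succ_apply']
    refine ⟨hX1 _ ih.1, ?_⟩
    have := hX _ ih.1 v hv _ _ (by positivity) ih.2
    convert this using 2
    · ring
    · ring

end Tame

end

end BBS

namespace BBS

noncomputable section

variable {n : ℕ}

/-! ### Differentiation along a slice of the chart -/

/-- The derivative of `F` in the direction in which `w_i` moves with speed `σ` and `z`, `z̄` move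
with speeds `γ`, `γ'`. -/
def slope (σ : ℂ) (i : Fin n) (γ γ' : Fin n → ℂ) (F : (Fin n ⊕ Fin n ⊕ Fin n → ℂ) → ℂ)
    (v : Fin n ⊕ Fin n ⊕ Fin n → ℂ) : ℂ :=
  σ * dW (Sum.inr (Sum.inl i), false) F v + ∑ j, (dW (Sum.inr (Sum.inr j), false) F v * γ j +
    dW (Sum.inr (Sum.inr j), true) F v * γ' j)

/-- The chain rule for a slice with x frozen, on which only w_i and z move. The speeds γ, γ' of z
and z̄ are independent unknowns because the inverse chart need not be holomorphic. -/
theorem dW_comp_eq_slope {F : (Fin n ⊕ Fin n ⊕ Fin n → ℂ) → ℂ}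
    {g : (Fin n → ℂ) → Fin n ⊕ Fin n ⊕ Fin n → ℂ} {u : Fin n → ℂ}
    (hF : DifferentiableAt ℝ F (g u)) (hg : DifferentiableAt ℝ g u) {i : Fin n} {σ : ℂ}
    (hx : ∀ k, dW (i, false) (fun u => g u (Sum.inl k)) u = 0)
    (hx' : ∀ k, dW (i, false) (fun u => star (g u (Sum.inl k))) u = 0)
    (hw : ∀ k, dW (i, false) (fun u => g u (Sum.inr (Sum.inl k))) u = if k = i then σ else 0)
    (hw' : ∀ k, dW (i, false) (fun u => star (g u (Sum.inr (Sum.inl k)))) u = 0) :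
    dW (i, false) (fun u => F (g u)) u =
      slope σ i (fun j => dW (i, false) (fun u => g u (Sum.inr (Sum.inr j))) u)
        (fun j => dW (i, false) (fun u => star (g u (Sum.inr (Sum.inr j)))) u) F (g u) := by
  rw [dW_comp hF hg, Fintype.sum_sum_type, Fintype.sum_sum_type]
  simp only [hx, hx', hw, hw', slope]
  simp [mul_comm]

section transport

variable {B : Set (Fin n → ℂ)} {g : (Fin n ⊕ Fin n → ℂ) → ℂ} {S : Set (Fin n ⊕ Fin n → ℂ)}
  {s c₀ : ℝ} {E : (Fin n ⊕ Fin n → ℂ) → ℝ}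

/-- `B` is convex and open, `g` is smooth on `B × B`, and the real Jacobian of `z ↦ θ` is
invertible with bounds. -/
structure GoodDom (g : (Fin n ⊕ Fin n → ℂ) → ℂ) (B : Set (Fin n → ℂ)) (c₀ : ℝ) : Prop where
  isOpen : IsOpen B
  convex : Convex ℝ B
  smooth : ContDiffOn ℝ ∞ g (dom2 B)
  pos : 0 < c₀
  det : ∀ v ∈ dom3 B, c₀ ≤ ‖(thetaZ g v).det‖
  schur : ∀ v ∈ dom3 B, c₀ ≤ ‖(thetaZ g v -
    thetaZbar g v * ((thetaZ g v).map star)⁻¹ * (thetaZbar g v).map star).det‖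

theorem GoodDom.smooth_thetaFun (h : GoodDom g B c₀) (i : Fin n) :
    ContDiffOn ℝ ∞ (thetaFun g i) (dom3 B) :=
  contDiffOn_segAvg h.isOpen h.convex continuous_const
    (contDiffOn_dW (isOpen_dom2 h.isOpen) h.smooth _)

theorem GoodDom.isGev_thetaFun (h : GoodDom g B c₀) (hs : 0 ≤ s) (hE0 : ∀ v ∈ S, 0 ≤ E v)
    (hg : IsGev (dom2 B) S s (holWeight E) g) (i : Fin n) :
    IsGev (dom3 B) (lift3 B S) s (holWeight fun v => E (baseL v)) (thetaFun g i) :=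
  isGev_segAvg h.isOpen h.convex (hg.dW (isOpen_dom2 h.isOpen) hs
    (fun v hv => holWeight_nonneg (hE0 v hv)) (Sum.inl i, false))

/-- The derivations along slices of the chart are given by operators with Gevrey coefficients. -/
theorem GoodDom.exists_transport (h : GoodDom g B c₀) (hs : 1 ≤ s) (hE0 : ∀ v ∈ S, 0 ≤ E v)
    (hE1 : ∀ v ∈ S, E v ≤ 1) (hg : IsGev (dom2 B) S s (holWeight E) g) (ρ σ : ℂ) (i : Fin n) :
    ∃ X : ((Fin n ⊕ Fin n ⊕ Fin n → ℂ) → ℂ) → (Fin n ⊕ Fin n ⊕ Fin n → ℂ) → ℂ,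
      Tame (dom3 B) (lift3 B S) s (holWeight fun v => E (baseL v)) 1 X ∧
      ∀ v ∈ dom3 B, ∀ γ γ' : Fin n → ℂ,
        (∀ k, slope σ i γ γ' (thetaFun g k) v = if k = i then ρ else 0) →
        (∀ k, slope σ i γ γ' (fun u => star (thetaFun g k u)) v = 0) →
        ∀ F, slope σ i γ γ' F v = X F v := by
  have hs0 : 0 ≤ s := zero_le_one.trans hs
  have hO := isOpen_dom3 h.isOpen
  have hS := lift3_subset B S
  have hE0' : ∀ v ∈ lift3 B S, 0 ≤ E (baseL v) := fun v hv => hE0 _ hv.2.2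
  have hE1' : ∀ v ∈ lift3 B S, E (baseL v) ≤ 1 := fun v hv => hE1 _ hv.2.2
  set E3 : (Fin n ⊕ Fin n ⊕ Fin n → ℂ) → ℝ := fun v => E (baseL v) with hE3
  have hw0 : ∀ v ∈ lift3 B S, ∀ b, 0 ≤ holWeight E3 v b := fun v hv => holWeight_nonneg (hE0' v hv)
  have hΘ : ∀ i, IsGev (dom3 B) (lift3 B S) s (holWeight E3) (thetaFun g i) :=
    h.isGev_thetaFun hs0 hE0 hg
  have hhol : ∀ i k, IsGev (dom3 B) (lift3 B S) s (holWeight E3) (dW (k, false) (thetaFun g i)) :=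
    fun i k => (hΘ i).dW hO hs0 hw0 (k, false)
  -- The letter itself is antiholomorphic, so the function and all its derivatives carry the weight
  -- E. This is the flatness of Q = θ_z̄.
  have hanti : ∀ i k, IsGev (dom3 B) (lift3 B S) s (fun v _ => E3 v) (dW (k, true) (thetaFun g i)) :=
    fun i k => (hΘ i).dW hO hs0 hw0 (k, true)
  have hstar : ∀ i k, IsGev (dom3 B) (lift3 B S) s (fun _ _ => 1)
      (fun v => star (dW (k, false) (thetaFun g i) v)) := fun i k =>
    ((hhol i k).mono_weight fun v hv => holWeight_le_one (hE1' v hv)).star hO hS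
  have hstar' : ∀ i k, IsGev (dom3 B) (lift3 B S) s (fun _ _ => 1)
      (fun v => star (dW (k, true) (thetaFun g i) v)) := fun i k =>
    ((hanti i k).mono_weight fun v hv _ => hE1' v hv).star hO hS
  have hwA1 : ∀ v ∈ lift3 B S, holWeight E3 v false = 1 := fun v _ => rfl
  have hwAm := fun v (hv : v ∈ lift3 B S) => holWeight_mul_le (hE0' v hv) (hE1' v hv)
  set A := gevRing hO hS hs0 hw0 hwA1 hwAm
  set A' := gevRing (s := s) hO hS hs0 (w := fun _ _ => (1 : ℝ)) (fun _ _ _ => zero_le_one)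
    (fun _ _ => rfl) (fun _ _ _ _ => by simp)
  -- The equations say that the derivation takes θ_k to ρ δ_{ik} and each conjugate of θ_k to 0,
  -- with the known ∂_w part moved to the right. Conjugated coefficients have no small
  -- antiholomorphic derivatives and get weight 1.
  obtain ⟨c, c', hc, hc', hsol⟩ := exists_solution_isGev hO hS hs hE0' hE1'
    (P := Matrix.of fun k j => dW (Sum.inr (Sum.inr j), false) (thetaFun g k))
    (Q := Matrix.of fun k j => dW (Sum.inr (Sum.inr j), true) (thetaFun g k))
    (P' := Matrix.of fun k j v => star (dW (Sum.inr (Sum.inr j), false) (thetaFun g k) v))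
    (Q' := Matrix.of fun k j v => star (dW (Sum.inr (Sum.inr j), true) (thetaFun g k) v))
    (fun k j => hhol k _) (fun k j => hanti k _) (fun k j => hstar k _) (fun k j => hstar' k _)
    h.pos
    (fun v hv => by
      have h1 := (starRingEnd ℂ).map_det (thetaZ g v)
      have h2 : ‖((thetaZ g v).map star).det‖ = ‖(thetaZ g v).det‖ := by
        rw [← norm_star (thetaZ g v).det]
        exact congrArg norm h1.symm
      exact (h.det v hv).trans h2.ge)
    h.schur
    (r := fun k => (fun _ => if k = i then ρ else 0) -
      (fun _ => σ) * dW (Sum.inr (Sum.inl i), false) (thetaFun g k))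
    (r' := fun k => -((fun _ => σ) * fun v => star (dW (Sum.inr (Sum.inl i), true) (thetaFun g k) v)))
    (fun k => A.sub_mem (isGev_const hw0 (fun v hv => (hwA1 v hv).ge) _)
      (A.mul_mem (isGev_const hw0 (fun v hv => (hwA1 v hv).ge) _) (hhol k _)))
    (fun k => A'.neg_mem (A'.mul_mem (isGev_const (fun _ _ _ => zero_le_one) (fun _ _ => le_rfl) _)
      (hstar' k _)))
  refine ⟨fun F v => σ * dW (Sum.inr (Sum.inl i), false) F v +
    ∑ j, (c j v * dW (Sum.inr (Sum.inr j), false) F v +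
      c' j v * dW (Sum.inr (Sum.inr j), true) F v), ?_, ?_⟩
  · refine Tame.add hO hS ?_ (Tame.sum hO hS _ fun j => Tame.add hO hS ?_ ?_)
    · exact tame_mul_dW hO hS hs hw0 hwAm
        (isGev_const hw0 (fun v hv => (hwA1 v hv).ge) σ)
    · exact tame_mul_dW hO hS hs hw0 hwAm (hc j)
    · refine tame_mul_dW hO hS hs hw0 (fun v hv b b' => ?_) (hc' j)
      rw [one_mul]
      exact le_holWeight (hE1' v hv) _
  · intro v hv γ γ' h1 h2 F
    have hd : ∀ k, DifferentiableAt ℝ (thetaFun g k) v := fun k =>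
      (h.smooth_thetaFun k).differentiableAt_of_isOpen hO hv
    obtain ⟨e1, e2⟩ := hsol v hv γ γ' (by
      funext k
      have := h1 k
      simp only [slope, Finset.sum_add_distrib] at this
      simp only [Pi.add_apply, Matrix.mulVec, dotProduct, evalMat, Matrix.map_apply,
        Matrix.of_apply, Pi.sub_apply, Pi.mul_apply]
      rw [← this]; ring) (by
      funext k
      have := h2 k
      simp only [slope, Finset.sum_add_distrib, dW_star (hd k), Bool.not_false, Bool.not_true]
        at this
      simp only [Pi.add_apply, Matrix.mulVec, dotProduct, evalMat, Matrix.map_apply,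
        Matrix.of_apply, Pi.neg_apply, Pi.mul_apply]
      linear_combination this)
    simp only [slope, e1, e2]
    congr 1
    exact Finset.sum_congr rfl fun j _ => by ring

theorem GoodDom.isGev_delta0 {ψ : (Fin n → ℂ) → (Fin n → ℂ) → ℂ} (h : GoodDom (joint ψ) B c₀)
    (hs : 1 ≤ s) (hE0 : ∀ v ∈ S, 0 ≤ E v)
    (hE1 : ∀ v ∈ S, E v ≤ 1) (hg : IsGev (dom2 B) S s (holWeight E) (joint ψ)) :
    IsGev (dom3 B) (lift3 B S) s (holWeight fun v => E (baseL v))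
      (fun v => (mixedHess (joint ψ) v).det * ((thetaZ (joint ψ) v).det)⁻¹) := by
  have hs0 : 0 ≤ s := zero_le_one.trans hs
  have hO := isOpen_dom3 h.isOpen
  have hO2 := isOpen_dom2 h.isOpen
  have hS := lift3_subset B S
  set E3 : (Fin n ⊕ Fin n ⊕ Fin n → ℂ) → ℝ := fun v => E (baseL v) with hE3
  have hE0' : ∀ v ∈ lift3 B S, 0 ≤ E3 v := fun v hv => hE0 _ hv.2.2
  have hE1' : ∀ v ∈ lift3 B S, E3 v ≤ 1 := fun v hv => hE1 _ hv.2.2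
  have hw0 : ∀ v ∈ lift3 B S, ∀ b, 0 ≤ holWeight E3 v b := fun v hv => holWeight_nonneg (hE0' v hv)
  have hwA1 : ∀ v ∈ lift3 B S, holWeight E3 v false = 1 := fun v _ => rfl
  have hwAm := fun v (hv : v ∈ lift3 B S) => holWeight_mul_le (hE0' v hv) (hE1' v hv)
  have hw2 : ∀ v ∈ S, ∀ b, 0 ≤ holWeight E v b := fun v hv => holWeight_nonneg (hE0 v hv)
  set A := gevRing hO hS hs0 hw0 hwA1 hwAm
  have hΘ : ∀ k j, IsGev (dom3 B) (lift3 B S) s (holWeight E3)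
      (dW (Sum.inr (Sum.inr j), false) (thetaFun (joint ψ) k)) := fun k j =>
    (h.isGev_thetaFun hs0 hE0 hg k).dW hO hs0 hw0 (_, false)
  have hH : ∀ k j, IsGev (dom3 B) (lift3 B S) s (holWeight E3)
      (fun v => dW (Sum.inl k, false) (dW (Sum.inr j, false) (joint ψ)) (seg 0 v)) := fun k j =>
    isGev_comp_seg h.isOpen h.convex hw2
      ((hg.dW hO2 hs0 hw2 (Sum.inr j, false)).dW hO2 hs0 hw2 (Sum.inl k, false))
      ⟨le_rfl, zero_le_one⟩
  have h1 : IsGev (dom3 B) (lift3 B S) s (holWeight E3) (fun v => (mixedHess (joint ψ) v).det) := by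
    have h3 : IsGev (dom3 B) (lift3 B S) s (holWeight E3) (Matrix.of fun k j v =>
        dW (Sum.inl k, false) (dW (Sum.inr j, false) (joint ψ)) (seg 0 v)).det :=
      det_mem_subring A hH
    convert h3 using 1
    funext v
    rw [← det_evalMat]; rfl
  have h2 : IsGev (dom3 B) (lift3 B S) s (holWeight E3) (fun v => (thetaZ (joint ψ) v).det) := by
    have h3 : IsGev (dom3 B) (lift3 B S) s (holWeight E3) (Matrix.of fun k j =>
        dW (Sum.inr (Sum.inr j), false) (thetaFun (joint ψ) k)).det :=
      det_mem_subring A hΘ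
    convert h3 using 1
    funext v
    rw [← det_evalMat]; rfl
  refine A.mul_mem h1 (h2.inv hO hS hs hwA1 hwAm (fun v hv h0 => ?_) h.pos
    fun v hv => h.det v (hS hv))
  have := h.det v hv
  rw [h0, norm_zero] at this
  linarith [h.pos]

end transport

/-! ### The chart -/

section chart

variable {ψ : (Fin n → ℂ) → (Fin n → ℂ) → ℂ}
  {e : OpenPartialHomeomorph ((Fin n → ℂ) × (Fin n → ℂ) × (Fin n → ℂ))
      ((Fin n → ℂ) × (Fin n → ℂ) × (Fin n → ℂ))} {B : Set (Fin n → ℂ)} {c₀ : ℝ}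

theorem IsThetaChart.symm_apply (he : IsThetaChart ψ e) {x y θ : Fin n → ℂ}
    (h : (x, y, θ) ∈ e.target) : e.symm (x, y, θ) = (x, y, zOf e x y θ) ∧
      theta ψ x y (zOf e x y θ) = θ := by
  have h1 := e.map_target h
  have h2 := e.right_inv h
  have h3 : e (e.symm (x, y, θ)) = ((e.symm (x, y, θ)).1, (e.symm (x, y, θ)).2.1,
      theta ψ (e.symm (x, y, θ)).1 (e.symm (x, y, θ)).2.1 (e.symm (x, y, θ)).2.2) :=
    he.apply_eq _ _ _ h1
  rw [h2, Prod.ext_iff, Prod.ext_iff] at h3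
  obtain ⟨h4, h5, h6⟩ := h3
  simp only at h4 h5 h6
  refine ⟨Prod.ext h4.symm (Prod.ext h5.symm rfl), ?_⟩
  rw [← h4, ← h5] at h6
  exact h6.symm

theorem IsThetaChart.zOf_theta (he : IsThetaChart ψ e) {x y z : Fin n → ℂ}
    (h : (x, y, z) ∈ e.source) : (x, y, theta ψ x y z) ∈ e.target ∧
      zOf e x y (theta ψ x y z) = z := by
  rw [← he.apply_eq x y z h]
  refine ⟨e.map_source h, ?_⟩
  rw [zOf, ← he.apply_eq x y z h, e.left_inv h]

/-- The pairs `(y, θ)` with `y, z(x,y,θ) ∈ B`. -/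
def chartDom (e : OpenPartialHomeomorph ((Fin n → ℂ) × (Fin n → ℂ) × (Fin n → ℂ))
      ((Fin n → ℂ) × (Fin n → ℂ) × (Fin n → ℂ))) (B : Set (Fin n → ℂ)) (x : Fin n → ℂ) :
    Set ((Fin n → ℂ) × (Fin n → ℂ)) :=
  {p | (x, p) ∈ e.target ∧ p.1 ∈ B ∧ zOf e x p.1 p.2 ∈ B}

theorem isOpen_chartDom (hB : IsOpen B) (x : Fin n → ℂ) : IsOpen (chartDom e B x) := by
  have h1 : IsOpen (e.target ∩ e.symm ⁻¹' {q | q.2.2 ∈ B}) :=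
    e.continuousOn_symm.isOpen_inter_preimage e.open_target
      (hB.preimage (continuous_snd.comp continuous_snd))
  have h2 : IsOpen (((fun p => (x, p)) ⁻¹' (e.target ∩ e.symm ⁻¹' {q | q.2.2 ∈ B})) ∩
      Prod.fst ⁻¹' B) :=
    (h1.preimage (Continuous.prodMk_right x)).inter (hB.preimage continuous_fst)
  convert h2 using 1
  ext p
  simp only [chartDom, zOf, Set.mem_ofPred_eq, Set.mem_inter_iff, Set.mem_preimage]
  tauto

/-- A function of `(x, w, z)` in the coordinates `(x, y, θ)`. -/
def pull (e : OpenPartialHomeomorph ((Fin n → ℂ) × (Fin n → ℂ) × (Fin n → ℂ))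
      ((Fin n → ℂ) × (Fin n → ℂ) × (Fin n → ℂ))) (x : Fin n → ℂ)
    (F : (Fin n ⊕ Fin n ⊕ Fin n → ℂ) → ℂ) (y θ : Fin n → ℂ) : ℂ :=
  F (pt x (y - x) (zOf e x y θ))

theorem pt_mem_of_chartDom {x y θ : Fin n → ℂ} (hx : x ∈ B) (h : (y, θ) ∈ chartDom e B x) :
    pt x (y - x) (zOf e x y θ) ∈ dom3 B :=
  ⟨hx, by rw [py_pt, add_sub_cancel]; exact h.2.1, h.2.2⟩

/-- In the coordinates (x, y, θ) the function θ_k is a coordinate. Differentiating this identity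
produces the linear system that determines the derivatives of the inverse chart. -/
theorem thetaFun_pt (hB : GoodDom (joint ψ) B c₀) (he : IsThetaChart ψ e) {x y θ : Fin n → ℂ}
    (hx : x ∈ B) (h : (y, θ) ∈ chartDom e B x) (k : Fin n) :
    thetaFun (joint ψ) k (pt x (y - x) (zOf e x y θ)) = θ k := by
  have := theta_eq_thetaFun hB.isOpen hB.convex hB.smooth (pt_mem_of_chartDom hx h) k
  rw [← this, px_pt, py_pt, pz_pt, add_sub_cancel, (he.symm_apply h.1).2]

theorem differentiableAt_zOf (he : IsThetaChart ψ e) {x y θ : Fin n → ℂ}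
    (h : (x, y, θ) ∈ e.target) :
    DifferentiableAt ℝ (fun p : (Fin n → ℂ) × (Fin n → ℂ) => zOf e x p.1 p.2) (y, θ) := by
  have h1 : DifferentiableAt ℝ e.symm (x, y, θ) :=
    he.smooth_symm.differentiableAt_of_isOpen e.open_target h
  have h2 : DifferentiableAt ℝ (fun p : (Fin n → ℂ) × (Fin n → ℂ) => e.symm (x, p)) (y, θ) :=
    DifferentiableAt.comp (y, θ) h1 ((differentiableAt_const x).prodMk differentiableAt_id)
  exact h2.snd.snd

theorem differentiableAt_pt {x : Fin n → ℂ} {f h : (Fin n → ℂ) → Fin n → ℂ} {u : Fin n → ℂ}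
    (hf : DifferentiableAt ℝ f u) (hh : DifferentiableAt ℝ h u) :
    DifferentiableAt ℝ (fun u => pt x (f u) (h u)) u := by
  rw [differentiableAt_pi]
  rintro (k | k | k)
  · exact differentiableAt_const _
  · exact differentiableAt_pi.1 hf k
  · exact differentiableAt_pi.1 hh k

/-- Here y is fixed, so w does not move (σ = 0). The derivation takes θ_k to δ_{ik} and kills the
conjugates, so by the hypothesis on X it is given by X at the image point. -/
theorem dHol_pull_theta (hB : GoodDom (joint ψ) B c₀) (he : IsThetaChart ψ e) {x y θ : Fin n → ℂ}
    (hx : x ∈ B) (h : (y, θ) ∈ chartDom e B x) {i : Fin n}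
    {X : ((Fin n ⊕ Fin n ⊕ Fin n → ℂ) → ℂ) → (Fin n ⊕ Fin n ⊕ Fin n → ℂ) → ℂ}
    (hX : ∀ v ∈ dom3 B, ∀ γ γ' : Fin n → ℂ,
        (∀ k, slope 0 i γ γ' (thetaFun (joint ψ) k) v = if k = i then 1 else 0) →
        (∀ k, slope 0 i γ γ' (fun u => star (thetaFun (joint ψ) k u)) v = 0) →
        ∀ F, slope 0 i γ γ' F v = X F v)
    {F : (Fin n ⊕ Fin n ⊕ Fin n → ℂ) → ℂ} (hF : ContDiffOn ℝ ∞ F (dom3 B)) :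
    dHol i (fun θ' => pull e x F y θ') θ = pull e x (X F) y θ := by
  have hO := isOpen_dom3 hB.isOpen
  have hv := pt_mem_of_chartDom hx h
  have hD : IsOpen {θ' | (y, θ') ∈ chartDom e B x} :=
    (isOpen_chartDom hB.isOpen x).preimage (Continuous.prodMk_right y)
  have hz : DifferentiableAt ℝ (fun θ' => zOf e x y θ') θ :=
    DifferentiableAt.comp (f := fun θ' => (y, θ')) θ (differentiableAt_zOf he h.1)
      ((differentiableAt_const y).prodMk differentiableAt_id)
  have hg : DifferentiableAt ℝ (fun θ' => pt x (y - x) (zOf e x y θ')) θ :=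
    differentiableAt_pt (differentiableAt_const _) hz
  have key : ∀ {F : (Fin n ⊕ Fin n ⊕ Fin n → ℂ) → ℂ},
      DifferentiableAt ℝ F (pt x (y - x) (zOf e x y θ)) → _ := fun {F} hF =>
    dW_comp_eq_slope (F := F) (g := fun θ' => pt x (y - x) (zOf e x y θ')) hF hg (i := i) (σ := 0)
      (fun k => congrFun (dW_const _ (x k)) θ) (fun k => congrFun (dW_const _ (star (x k))) θ)
      (fun k => by rw [ite_self]; exact congrFun (dW_const _ ((y - x) k)) θ)
      (fun k => congrFun (dW_const _ (star ((y - x) k))) θ)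
  have hΘ : ∀ k, DifferentiableAt ℝ (thetaFun (joint ψ) k) (pt x (y - x) (zOf e x y θ)) := fun k =>
    (hB.smooth_thetaFun k).differentiableAt_of_isOpen hO hv
  rw [← dW_false]
  unfold pull
  rw [key (hF.differentiableAt_of_isOpen hO hv)]
  refine hX _ hv _ _ (fun k => ?_) (fun k => ?_) F
  · rw [← key (hΘ k), dW_congr hD (g := fun θ' => θ' k)
      (fun θ' hθ' => thetaFun_pt hB he hx hθ' k) _ h, dW_coord]
    simp [eq_comm]
  · rw [← key (hΘ k).star, dW_congr hD (g := fun θ' => star (θ' k))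
      (fun θ' hθ' => congrArg star (thetaFun_pt hB he hx hθ' k)) _ h, dW_star_coord]
    simp

/-- Here w = y - x moves with speed one (σ = 1) while θ stays fixed, so the right-hand sides vanish.
The form `if k = i then 0 else 0` is the case ρ = 0 of `exists_transport`. -/
theorem dHol_pull_y (hB : GoodDom (joint ψ) B c₀) (he : IsThetaChart ψ e) {x y θ : Fin n → ℂ}
    (hx : x ∈ B) (h : (y, θ) ∈ chartDom e B x) {i : Fin n}
    {X : ((Fin n ⊕ Fin n ⊕ Fin n → ℂ) → ℂ) → (Fin n ⊕ Fin n ⊕ Fin n → ℂ) → ℂ}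
    (hX : ∀ v ∈ dom3 B, ∀ γ γ' : Fin n → ℂ,
        (∀ k, slope 1 i γ γ' (thetaFun (joint ψ) k) v = if k = i then 0 else 0) →
        (∀ k, slope 1 i γ γ' (fun u => star (thetaFun (joint ψ) k u)) v = 0) →
        ∀ F, slope 1 i γ γ' F v = X F v)
    {F : (Fin n ⊕ Fin n ⊕ Fin n → ℂ) → ℂ} (hF : ContDiffOn ℝ ∞ F (dom3 B)) :
    dHol i (fun y' => pull e x F y' θ) y = pull e x (X F) y θ := by
  have hO := isOpen_dom3 hB.isOpen
  have hv := pt_mem_of_chartDom hx h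
  have hD : IsOpen {y' | (y', θ) ∈ chartDom e B x} :=
    (isOpen_chartDom hB.isOpen x).preimage (Continuous.prodMk_left θ)
  have hz : DifferentiableAt ℝ (fun y' => zOf e x y' θ) y :=
    DifferentiableAt.comp (f := fun y' => (y', θ)) y (differentiableAt_zOf he h.1)
      (differentiableAt_id.prodMk (differentiableAt_const θ))
  have hg : DifferentiableAt ℝ (fun y' => pt x (y' - x) (zOf e x y' θ)) y :=
    differentiableAt_pt (differentiableAt_id.sub_const _) hz
  have hcoord : ∀ k, DifferentiableAt ℝ (fun y' : Fin n → ℂ => y' k) y := fun k => by fun_prop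
  have hw : ∀ k, dW (i, false) (fun y' : Fin n → ℂ => y' k - x k) y = if k = i then 1 else 0 :=
    fun k => by
      have := dW_add (hcoord k) (differentiableAt_const (-x k)) (i, false)
      simp only [← sub_eq_add_neg] at this
      rw [this, dW_const, dW_coord]
      simp [eq_comm]
  have hw' : ∀ k, dW (i, false) (fun y' : Fin n → ℂ => star (y' k - x k)) y = 0 := fun k => by
    have := dW_add (hcoord k).star (differentiableAt_const (-star (x k))) (i, false)
    simp only [star_sub]
    simp only [← sub_eq_add_neg] at this
    rw [this, dW_const, dW_star_coord]
    simp
  have key : ∀ {F : (Fin n ⊕ Fin n ⊕ Fin n → ℂ) → ℂ},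
      DifferentiableAt ℝ F (pt x (y - x) (zOf e x y θ)) → _ := fun {F} hF =>
    dW_comp_eq_slope (F := F) (g := fun y' => pt x (y' - x) (zOf e x y' θ)) hF hg (i := i) (σ := 1)
      (fun k => congrFun (dW_const _ (x k)) y) (fun k => congrFun (dW_const _ (star (x k))) y)
      hw hw'
  have hΘ : ∀ k, DifferentiableAt ℝ (thetaFun (joint ψ) k) (pt x (y - x) (zOf e x y θ)) := fun k =>
    (hB.smooth_thetaFun k).differentiableAt_of_isOpen hO hv
  rw [← dW_false]
  unfold pull
  rw [key (hF.differentiableAt_of_isOpen hO hv)]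
  refine hX _ hv _ _ (fun k => ?_) (fun k => ?_) F
  · rw [← key (hΘ k), dW_congr hD (g := fun _ => θ k)
      (fun y' hy' => thetaFun_pt hB he hx hy' k) _ h, dW_const, ite_self]
  · rw [← key (hΘ k).star, dW_congr hD (g := fun _ => star (θ k))
      (fun y' hy' => congrArg star (thetaFun_pt hB he hx hy' k)) _ h, dW_const]

/-- In the coordinates `(x, w, z)`, the operator `D_y · D_θ` raises the Gevrey shift by two. -/
theorem GoodDom.exists_dyDtheta (hB : GoodDom (joint ψ) B c₀) (he : IsThetaChart ψ e)
    {S : Set (Fin n ⊕ Fin n → ℂ)} {s : ℝ} {E : (Fin n ⊕ Fin n → ℂ) → ℝ} (hs : 1 ≤ s)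
    (hE0 : ∀ v ∈ S, 0 ≤ E v) (hE1 : ∀ v ∈ S, E v ≤ 1)
    (hg : IsGev (dom2 B) S s (holWeight E) (joint ψ)) :
    ∃ X : ((Fin n ⊕ Fin n ⊕ Fin n → ℂ) → ℂ) → (Fin n ⊕ Fin n ⊕ Fin n → ℂ) → ℂ,
      Tame (dom3 B) (lift3 B S) s (holWeight fun v => E (baseL v)) 2 X ∧
      ∀ F, ContDiffOn ℝ ∞ F (dom3 B) → ∀ x ∈ B, ∀ f : (Fin n → ℂ) → (Fin n → ℂ) → ℂ,
        (∀ y θ, (y, θ) ∈ chartDom e B x → f y θ = pull e x F y θ) → ∀ k : ℕ,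
          ∀ y θ, (y, θ) ∈ chartDom e B x → (dyDtheta^[k] f) y θ = pull e x (X^[k] F) y θ := by
  -- The operators T i represent ∂/∂θ_i (ρ = 1, σ = 0), and the operators Y i represent ∂/∂y_i (ρ =
  -- 0, σ = 1). Each raises the shift by one.
  choose T hT hT' using fun i => hB.exists_transport hs hE0 hE1 hg 1 0 i
  choose Y hY hY' using fun i => hB.exists_transport hs hE0 hE1 hg 0 1 i
  have hX : Tame (dom3 B) (lift3 B S) s (holWeight fun v => E (baseL v)) 2
      (fun F v => ∑ i, Y i (T i F) v) :=
    Tame.sum (isOpen_dom3 hB.isOpen) (lift3_subset B S) _ fun i => (hY i).comp (hT i)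
  refine ⟨_, hX, fun F hF x hx f hf k => ?_⟩
  induction k generalizing F f with
  | zero => exact hf
  | succ k ih =>
    rw [Function.iterate_succ_apply, Function.iterate_succ_apply]
    refine ih _ (hX.1 F hF) _ fun y θ h => ?_
    have hD : IsOpen {y' | (y', θ) ∈ chartDom e B x} :=
      (isOpen_chartDom hB.isOpen x).preimage (Continuous.prodMk_left θ)
    simp only [dyDtheta, pull]
    refine Finset.sum_congr rfl fun i _ => ?_
    rw [← dW_false i, dW_congr hD (g := fun y' => pull e x (T i F) y' θ) (fun y' hy' => ?_) _ h,
      dW_false, dHol_pull_y hB he hx h (hY' i) ((hT i).1 F hF)]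
    · rfl
    · have hD' : IsOpen {θ' | (y', θ') ∈ chartDom e B x} :=
        (isOpen_chartDom hB.isOpen x).preimage (Continuous.prodMk_right y')
      change dHol i (fun θ' => f y' θ') θ = pull e x (T i F) y' θ
      rw [← dHol_pull_theta hB he hx hy' (hT' i) hF, ← dW_false, ← dW_false]
      exact dW_congr hD' (fun θ' hθ' => hf y' θ' hθ') _ hy'

end chart

end

end BBS

/-! ### The recursion for the coefficients -/

namespace BBS

noncomputable section

variable {n : ℕ}

/-- The linear map `(x, z) ↦ (x, 0, z)`. -/
def diagL : (Fin n ⊕ Fin n → ℂ) →L[ℝ] (Fin n ⊕ Fin n ⊕ Fin n → ℂ) :=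
  insertL (Sum.elim (fun i => some (Sum.inl i))
    (Sum.elim (fun _ => none) fun i => some (Sum.inr i)))

theorem diagL_eq (v : Fin n ⊕ Fin n → ℂ) :
    diagL v = pt (fun i => v (Sum.inl i)) 0 fun i => v (Sum.inr i) := by
  funext k
  rcases k with k | k | k <;> simp [diagL, insertL_apply, pt]

theorem baseL_diagL (v : Fin n ⊕ Fin n → ℂ) : baseL (diagL v) = v := by
  funext k
  rcases k with k | k <;> simp [diagL_eq, baseL, pt]

theorem mapsTo_diagL (B : Set (Fin n → ℂ)) :
    Set.MapsTo (diagL : (Fin n ⊕ Fin n → ℂ) →L[ℝ] _) (dom2 B) (dom3 B) := fun v hv => by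
  rw [diagL_eq]
  exact pt_mem_dom3 hv.1 (by rw [add_zero]; exact hv.1) hv.2

theorem diagL_mem_lift3 {B : Set (Fin n → ℂ)} {S : Set (Fin n ⊕ Fin n → ℂ)}
    {v : Fin n ⊕ Fin n → ℂ} (hv : v ∈ dom2 B) (hS : v ∈ S) : diagL v ∈ lift3 B S :=
  ⟨mapsTo_diagL B hv, by rw [diagL_eq, pw_pt], by rwa [baseL_diagL]⟩

theorem dW_comp_diagL_coord (c : (Fin n ⊕ Fin n) × Bool) (k : Fin n ⊕ Fin n ⊕ Fin n)
    (v : Fin n ⊕ Fin n → ℂ) :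
    dW c (fun w => diagL w k) v =
        (if ((Sum.map id Sum.inr c.1, c.2) : (Fin n ⊕ Fin n ⊕ Fin n) × Bool) = (k, false)
          then 1 else 0) ∧
      dW c (fun w => star (diagL w k)) v =
        (if ((Sum.map id Sum.inr c.1, c.2) : (Fin n ⊕ Fin n ⊕ Fin n) × Bool) = (k, true)
          then 1 else 0) := by
  rcases k with i | i | i
  · simp only [diagL_eq, pt, Sum.elim_inl]
    rw [dW_coord, dW_star_coord]
    rcases c with ⟨j | j, b⟩ <;> simp
  · simp only [diagL_eq, pt, Sum.elim_inl, Sum.elim_inr, Pi.zero_apply, star_zero, dW_const]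
    rcases c with ⟨j | j, b⟩ <;> simp
  · simp only [diagL_eq, pt, Sum.elim_inr]
    rw [dW_coord, dW_star_coord]
    rcases c with ⟨j | j, b⟩ <;> simp

theorem maj_comp_diagL {B : Set (Fin n → ℂ)} (hB : IsOpen B) {v : Fin n ⊕ Fin n → ℂ}
    (hv : v ∈ dom2 B) {F : (Fin n ⊕ Fin n ⊕ Fin n → ℂ) → ℂ} (hF : ContDiffOn ℝ ∞ F (dom3 B))
    {M : ℕ → ℝ} (hM : ∀ k, 0 ≤ M k) {e : Bool → ℝ} (he : ∀ b, 0 ≤ e b)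
    (h : Maj e M F (diagL v)) : Maj e M (fun w => F (diagL w)) v := by
  refine Maj.comp_linear (isOpen_dom2 hB) (isOpen_dom3 hB) (fun w _ => diagL.differentiableAt)
    diagL.contDiff.contDiffOn (mapsTo_diagL B)
    (fun c d => if (Sum.map id Sum.inr c.1, c.2) = d then 1 else 0)
    (fun w _ c k => dW_comp_diagL_coord c k w) (fun c => ?_) hv hF hM he (Or.inl fun c d hcd => ?_) h
  · rw [Finset.sum_eq_single (Sum.map id Sum.inr c.1, c.2)]
    · simp
    · intro d _ hd
      simp [hd.symm]
    · simp
  · by_contra hne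
    exact hcd (if_neg fun h => hne (by rw [← h]))

theorem contDiffOn_iterate {ι : Type} [Fintype ι] {O : Set (ι → ℂ)}
    {X : ((ι → ℂ) → ℂ) → (ι → ℂ) → ℂ}
    (hX : ∀ F, ContDiffOn ℝ ∞ F O → ContDiffOn ℝ ∞ (X F) O) {F : (ι → ℂ) → ℂ}
    (hF : ContDiffOn ℝ ∞ F O) (k : ℕ) : ContDiffOn ℝ ∞ (X^[k] F) O := by
  induction k with
  | zero => exact hF
  | succ k ih => rw [Function.iterate_succ_apply']; exact hX _ ih

/-- The two ratios K and K(1+D) differ by K D, so the sum is the difference of their (m+1)-st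
powers. This is why M = K(1+D) closes the induction. -/
theorem sum_geom_le {K D : ℝ} (hK : 0 ≤ K) (m : ℕ) :
    ∑ k ∈ Finset.range (m + 1), K ^ (k + 1) * (D * (K * (1 + D)) ^ (m - k)) ≤
      (K * (1 + D)) ^ (m + 1) := by
  have h := geom_sum₂_mul K (K * (1 + D)) (m + 1)
  simp only [Nat.add_sub_cancel] at h
  have h2 : ∑ k ∈ Finset.range (m + 1), K ^ (k + 1) * (D * (K * (1 + D)) ^ (m - k)) =
      K * D * ∑ k ∈ Finset.range (m + 1), K ^ k * (K * (1 + D)) ^ (m - k) := by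
    rw [Finset.mul_sum]
    exact Finset.sum_congr rfl fun k _ => by ring
  have h3 : 0 ≤ K ^ (m + 1) := by positivity
  have h4 : K * D * ∑ k ∈ Finset.range (m + 1), K ^ k * (K * (1 + D)) ^ (m - k) =
      (K * (1 + D)) ^ (m + 1) - K ^ (m + 1) := by linear_combination -h
  rw [h2, h4]
  linarith

section

variable {ψ : (Fin n → ℂ) → (Fin n → ℂ) → ℂ}
  {e : OpenPartialHomeomorph ((Fin n → ℂ) × (Fin n → ℂ) × (Fin n → ℂ))
      ((Fin n → ℂ) × (Fin n → ℂ) × (Fin n → ℂ))} {B : Set (Fin n → ℂ)} {c₀ : ℝ}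

/-- The recursion for the coefficients in the coordinates `(x, w, z)`. -/
theorem GoodDom.coeff_succ (hB : GoodDom (joint ψ) B c₀) (he : IsThetaChart ψ e)
    (hsrc : ∀ x ∈ B, ∀ z ∈ B, (x, x, z) ∈ e.source)
    {X : ((Fin n ⊕ Fin n ⊕ Fin n → ℂ) → ℂ) → (Fin n ⊕ Fin n ⊕ Fin n → ℂ) → ℂ}
    (hX : ∀ F, ContDiffOn ℝ ∞ F (dom3 B) → ∀ x ∈ B, ∀ f : (Fin n → ℂ) → (Fin n → ℂ) → ℂ,
        (∀ y θ, (y, θ) ∈ chartDom e B x → f y θ = pull e x F y θ) → ∀ k : ℕ,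
          ∀ y θ, (y, θ) ∈ chartDom e B x → (dyDtheta^[k] f) y θ = pull e x (X^[k] F) y θ)
    {F : ℕ → (Fin n ⊕ Fin n ⊕ Fin n → ℂ) → ℂ} {m : ℕ}
    (hF : ∀ j ≤ m, ContDiffOn ℝ ∞ (F j) (dom3 B))
    (hFb : ∀ j ≤ m, F j = fun u => joint (bbsCoeff ψ e j) (seg 1 u) *
      ((mixedHess (joint ψ) u).det * ((thetaZ (joint ψ) u).det)⁻¹)) :
    Set.EqOn (joint (bbsCoeff ψ e (m + 1))) (fun v => ∑ k ∈ Finset.range (m + 1),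
      -(1 / ((k + 1).factorial : ℂ)) * (X^[k + 1] (F (m - k))) (diagL v)) (dom2 B) := by
  intro v hv
  simp only [joint, bbsCoeff]
  set x : Fin n → ℂ := fun i => v (Sum.inl i) with hx
  set z : Fin n → ℂ := fun i => v (Sum.inr i) with hz
  rw [Finset.sum_range fun k => -(1 / ((k + 1).factorial : ℂ)) * (X^[k + 1] (F (m - k))) (diagL v),
    ← Finset.sum_neg_distrib]
  refine Finset.sum_congr rfl fun k _ => ?_
  rw [neg_mul]
  congr 2
  obtain ⟨h1, h2⟩ := he.zOf_theta (hsrc x hv.1 z hv.2)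
  have hmem : (x, theta ψ x x z) ∈ chartDom e B x := ⟨h1, hv.1, by rw [h2]; exact hv.2⟩
  rw [hX (F (m - k)) (hF _ (Nat.sub_le _ _)) x hv.1 _ (fun y θ h => ?_) (k + 1) _ _ hmem]
  · rw [pull, h2, sub_self, diagL_eq]
  · have hxB : x ∈ B := hv.1
    have hd := delta0_eq hB.isOpen hB.convex hB.smooth (pt_mem_of_chartDom hxB h)
    rw [px_pt, py_pt, pz_pt, add_sub_cancel] at hd
    rw [hFb _ (Nat.sub_le _ _), pull, ← hd, seg_eq]
    simp [joint]

/-- The coefficients are smooth and satisfy Gevrey bounds. -/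
theorem GoodDom.coeff_bound (hB : GoodDom (joint ψ) B c₀) (he : IsThetaChart ψ e)
    (hsrc : ∀ x ∈ B, ∀ z ∈ B, (x, x, z) ∈ e.source)
    {S : Set (Fin n ⊕ Fin n → ℂ)} {s : ℝ} {E : (Fin n ⊕ Fin n → ℂ) → ℝ} (hs : 1 ≤ s)
    (hE0 : ∀ v ∈ S, 0 ≤ E v) (hE1 : ∀ v ∈ S, E v ≤ 1)
    (hg : IsGev (dom2 B) S s (holWeight E) (joint ψ)) :
    ∃ M R : ℝ, 0 ≤ M ∧ 0 ≤ R ∧ ∀ m, ContDiffOn ℝ ∞ (joint (bbsCoeff ψ e m)) (dom2 B) ∧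
      ∀ v ∈ S, v ∈ dom2 B →
        Maj (holWeight E v) (gev s (M ^ m) R (2 * m)) (joint (bbsCoeff ψ e m)) v := by
  have hO2 := isOpen_dom2 hB.isOpen
  have hO3 := isOpen_dom3 hB.isOpen
  obtain ⟨X, ⟨hX1, R₁, hR₁, hX2⟩, hX3⟩ := hB.exists_dyDtheta he hs hE0 hE1 hg
  obtain ⟨hΔ1, C, R₀, hC, hR₀, hΔ⟩ := hB.isGev_delta0 hs hE0 hE1 hg
  set Δ := fun v => (mixedHess (joint ψ) v).det * ((thetaZ (joint ψ) v).det)⁻¹ with hΔdef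
  -- One radius for the whole induction: R₁ lets the operator act, and 2 R₀ lets multiplication by
  -- Δ₀ cost only the factor D = 2C.
  set R := max R₁ (2 * R₀) with hR
  have hR0 : 0 ≤ R := hR₁.trans (le_max_left _ _)
  obtain ⟨K, hK, hX4⟩ := hX2 R (le_max_left _ _)
  set D := 2 * C with hD
  have hD0 : 0 ≤ D := by positivity
  refine ⟨K * (1 + D), R, by positivity, hR0, fun m => ?_⟩
  induction m using Nat.strong_induction_on with
  | _ m ih =>
  rcases m with _ | m
  · have h0 : joint (bbsCoeff ψ e 0) = fun _ => 1 := by funext v; simp [joint, bbsCoeff]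
    rw [h0]
    refine ⟨contDiffOn_const, fun v hv _ => maj_const _ (holWeight_nonneg (hE0 v hv)) le_rfl
      (gev_nonneg (by simp) hR0 _) (by simp [gev])⟩
  -- At t = 1 the segment map is (x, w, z) ↦ (x, z), so b_j becomes a function independent of w.
  set F : ℕ → (Fin n ⊕ Fin n ⊕ Fin n → ℂ) → ℂ := fun j u =>
    joint (bbsCoeff ψ e j) (seg 1 u) * Δ u with hF
  have h1mem : (1 : ℝ) ∈ Set.Icc (0 : ℝ) 1 := ⟨zero_le_one, le_rfl⟩
  have hb3 : ∀ j ≤ m, ContDiffOn ℝ ∞ (fun u => joint (bbsCoeff ψ e j) (seg 1 u)) (dom3 B) :=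
    fun j hj => (ih j (by lia)).1.comp (seg 1).contDiff.contDiffOn (mapsTo_seg hB.convex h1mem)
  have hFs : ∀ j ≤ m, ContDiffOn ℝ ∞ (F j) (dom3 B) := fun j hj => (hb3 j hj).mul hΔ1
  have hrec := hB.coeff_succ he hsrc hX3 hFs fun j _ => rfl
  have hXs : ∀ k, ContDiffOn ℝ ∞ (fun v => (X^[k + 1] (F (m - k))) (diagL v)) (dom2 B) := fun k =>
    (contDiffOn_iterate hX1 (hFs _ (Nat.sub_le _ _)) (k + 1)).comp diagL.contDiff.contDiffOn
      (mapsTo_diagL B)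
  have hsum : ContDiffOn ℝ ∞ (fun v => ∑ k ∈ Finset.range (m + 1),
      -(1 / ((k + 1).factorial : ℂ)) * (X^[k + 1] (F (m - k))) (diagL v)) (dom2 B) :=
    ContDiffOn.sum fun k _ => contDiffOn_const.mul (hXs k)
  refine ⟨hsum.congr hrec, fun v hvS hv => ?_⟩
  refine Maj.congr hO2 hv ?_ hrec.symm
  have hv3 := diagL_mem_lift3 hv hvS
  have hw0 : ∀ b, 0 ≤ holWeight E v b := holWeight_nonneg (hE0 v hvS)
  have hweight : (holWeight (fun v => E (baseL v)) (diagL v) : Bool → ℝ) = holWeight E v := by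
    funext b; simp only [holWeight, baseL_diagL]
  have hterm : ∀ k ∈ Finset.range (m + 1), Maj (holWeight E v)
      (fun i => ‖-(1 / ((k + 1).factorial : ℂ))‖ *
        gev s (K ^ (k + 1) * (D * (K * (1 + D)) ^ (m - k))) R (2 * (m + 1)) i)
      (fun v => -(1 / ((k + 1).factorial : ℂ)) * (X^[k + 1] (F (m - k))) (diagL v)) v := by
    intro k hk
    have hkm : k ≤ m := by rw [Finset.mem_range] at hk; lia
    have hA : 0 ≤ D * (K * (1 + D)) ^ (m - k) := by positivity
    refine Maj.const_mul hO2 hv (hXs k) ?_ _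
    refine maj_comp_diagL hB.isOpen hv
      (contDiffOn_iterate hX1 (hFs _ (Nat.sub_le _ _)) (k + 1))
      (gev_nonneg (by positivity) hR0 _) hw0 ?_
    have hb : Maj (holWeight E v) (gev s ((K * (1 + D)) ^ (m - k)) R (2 * (m - k)))
        (fun u => joint (bbsCoeff ψ e (m - k)) (seg 1 u)) (diagL v) := by
      refine maj_comp_seg hB.isOpen hB.convex h1mem (mapsTo_diagL B hv) (ih (m - k) (by lia)).1
        (gev_nonneg (by positivity) hR0 _) hw0 ?_
      rw [seg_eq_base hv3.2.1, baseL_diagL]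
      exact (ih (m - k) (by lia)).2 v hvS hv
    have hΔv := hΔ _ hv3
    rw [hweight] at hΔv
    have hFm : Maj (holWeight E v) (gev s (D * (K * (1 + D)) ^ (m - k)) R (2 * (m - k)))
        (F (m - k)) (diagL v) := by
      have h3 := hΔv.mul hO3 (mapsTo_diagL B hv) hΔ1 (hb3 _ (Nat.sub_le _ _))
        (gev_nonneg hC hR₀ 0) (gev_nonneg (by positivity) hR0 _) hb
        (holWeight_mul_le (hE0 v hvS) (hE1 v hvS))
      have h4 : F (m - k) = fun u => Δ u * joint (bbsCoeff ψ e (m - k)) (seg 1 u) := by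
        funext u; rw [mul_comm]
      rw [h4]
      exact h3.mono (fun i => conv_gev_le_of_two_mul_le hs hC hR₀ (by positivity)
        (le_max_right _ _) _ i) hw0
    have h5 := (maj_iterate (S := lift3 B S) (w := holWeight fun v => E (baseL v)) hK hX1 hX4
      (hFs _ (Nat.sub_le m k)) hv3 hA (by rw [hweight]; exact hFm) (k + 1)).2
    -- With l = k + 1, the shift 2(m+1-l) of b_{m+1-l} plus 2l from the operator is 2(m+1), the same
    -- for every summand.
    rw [hweight, show 2 * (m - k) + (k + 1) * 2 = 2 * (m + 1) by lia] at h5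
    exact h5
  refine Maj.mono (Maj.sum hO2 hv _ (fun k _ => contDiffOn_const.mul (hXs k)) hterm)
    (fun i => ?_) hw0
  have hle : ∀ k ∈ Finset.range (m + 1), ‖-(1 / ((k + 1).factorial : ℂ))‖ *
        gev s (K ^ (k + 1) * (D * (K * (1 + D)) ^ (m - k))) R (2 * (m + 1)) i ≤
      K ^ (k + 1) * (D * (K * (1 + D)) ^ (m - k)) *
        (R ^ i * ((i + 2 * (m + 1)).factorial : ℝ) ^ s) := fun k _ => by
    refine (mul_le_of_le_one_left (gev_nonneg (by positivity) hR0 _ _) ?_).trans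
      (le_of_eq (by unfold gev; ring))
    -- The factor 1/l! is merely bounded by 1; the geometric sum already converges to what is
    -- needed.
    rw [norm_neg, norm_div, norm_one, Complex.norm_natCast]
    refine div_le_one_of_le₀ ?_ (by positivity)
    exact_mod_cast Nat.succ_le_of_lt (Nat.factorial_pos _)
  refine (Finset.sum_le_sum hle).trans ?_
  rw [← Finset.sum_mul]
  refine (mul_le_mul_of_nonneg_right (sum_geom_le hK m) (by positivity)).trans (le_of_eq ?_)
  unfold gev; ring

end

end

end BBS

/-! ### Invertibility near the origin and existence of the chart -/

namespace BBS

noncomputable section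

variable {n : ℕ}

/-- A derivative in z does not see the parameter t, and at w = 0 the integrand is constant, so the
average is its value. -/
theorem dW_thetaFun {B : Set (Fin n → ℂ)} (hB : IsOpen B) (hBc : Convex ℝ B)
    {g : (Fin n ⊕ Fin n → ℂ) → ℂ} (hg : ContDiffOn ℝ ∞ g (dom2 B))
    {v : Fin n ⊕ Fin n ⊕ Fin n → ℂ} (hv : v ∈ dom3 B) (hw : pw v = 0) (i j : Fin n) (b : Bool) :
    dW (Sum.inr (Sum.inr j), b) (thetaFun g i) v =
      dWord [(Sum.inl i, false), (Sum.inr j, b)] g (baseL v) := by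
  rw [thetaFun, dW_segAvg hB hBc continuous_const (contDiffOn_dW (isOpen_dom2 hB) hg _) _ hv]
  simp only [segAvg, seg_eq_base hw]
  simp [segFactor, segTarget]

theorem dom2_ball_subset {r : ℝ} (hr : 0 < r) :
    dom2 (Metric.ball (0 : Fin n → ℂ) r) ⊆ Metric.ball 0 r := by
  rintro v ⟨h1, h2⟩
  rw [mem_ball_zero_iff, pi_norm_lt_iff hr] at *
  rintro (i | i)
  · exact h1 i
  · exact h2 i

theorem dom3_ball_subset {r : ℝ} (hr : 0 < r) :
    dom3 (Metric.ball (0 : Fin n → ℂ) r) ⊆ Metric.ball 0 (2 * r) := by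
  rintro v ⟨h1, h2, h3⟩
  rw [mem_ball_zero_iff] at *
  have h4 : ‖pw v‖ < 2 * r := by
    have : pw v = py v - px v := by simp [py]
    rw [this]
    exact (norm_sub_le _ _).trans_lt (by linarith)
  rw [pi_norm_lt_iff (by linarith)]
  rintro (i | i | i)
  · exact (norm_le_pi_norm (px v) i).trans_lt (by linarith)
  · exact (norm_le_pi_norm (pw v) i).trans_lt h4
  · exact (norm_le_pi_norm (pz v) i).trans_lt (by linarith)

/-- The inverse is the adjugate divided by the determinant, hence continuous where the determinant
of the conjugate of P₀ is nonzero. -/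
theorem continuousAt_schur {m : Type} [Fintype m] [DecidableEq m] {P₀ Q₀ : Matrix m m ℂ}
    (h : P₀.det ≠ 0) :
    ContinuousAt (fun p : Matrix m m ℂ × Matrix m m ℂ =>
      (p.1 - p.2 * (p.1.map star)⁻¹ * p.2.map star).det) (P₀, Q₀) := by
  have hst : Continuous fun M : Matrix m m ℂ => M.map star :=
    continuous_id.matrix_map continuous_star
  have hdet : Continuous fun M : Matrix m m ℂ => M.det := continuous_id.matrix_det
  have hadj : Continuous fun M : Matrix m m ℂ => M.adjugate := continuous_id.matrix_adjugate
  have h0 : (P₀.map star).det ≠ 0 := by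
    have h1 : star P₀.det = (P₀.map star).det := (starRingEnd ℂ).map_det P₀
    rw [← h1]
    simpa using h
  have hinv : ContinuousAt (fun M : Matrix m m ℂ => (M.map star)⁻¹) P₀ := by
    simp only [Matrix.inv_def, Ring.inverse_eq_inv']
    exact ((hdet.comp hst).continuousAt.inv₀ h0).smul (hadj.comp hst).continuousAt
  have hinv' : ContinuousAt (fun p : Matrix m m ℂ × Matrix m m ℂ => (p.1.map star)⁻¹) (P₀, Q₀) :=
    ContinuousAt.comp (f := Prod.fst) (g := fun M : Matrix m m ℂ => (M.map star)⁻¹)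
      hinv continuousAt_fst
  exact hdet.continuousAt.comp (continuousAt_fst.sub ((continuousAt_snd.mul hinv').mul
    (hst.comp continuous_snd).continuousAt))

/-- At the origin θ_z̄ = 0, so the Schur complement equals θ_z. Both determinants are continuous
there, and half of |det θ_z(0)| is a lower bound for both on a small ball. All smaller radii are
allowed, to leave room for later restrictions. -/
theorem exists_goodDom {g : (Fin n ⊕ Fin n → ℂ) → ℂ} {O : Set (Fin n ⊕ Fin n → ℂ)}
    (hO : IsOpen O) (h0 : 0 ∈ O) (hg : ContDiffOn ℝ ∞ g O) (hdet : (thetaZ g 0).det ≠ 0)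
    (hbar : thetaZbar g 0 = 0) : ∃ c₀ δ : ℝ, 0 < δ ∧ ∀ r, 0 < r → r ≤ δ →
      dom2 (Metric.ball 0 r) ⊆ O ∧ GoodDom g (Metric.ball 0 r) c₀ := by
  obtain ⟨r₀, hr₀, hsub⟩ := Metric.isOpen_iff.1 hO 0 h0
  set B₀ := Metric.ball (0 : Fin n → ℂ) r₀ with hB₀
  have hB : IsOpen B₀ := Metric.isOpen_ball
  have hBc : Convex ℝ B₀ := convex_ball 0 r₀
  have hg' : ContDiffOn ℝ ∞ g (dom2 B₀) := hg.mono ((dom2_ball_subset hr₀).trans hsub)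
  have hB0 : (0 : Fin n → ℂ) ∈ B₀ := Metric.mem_ball_self hr₀
  have h3 : (0 : Fin n ⊕ Fin n ⊕ Fin n → ℂ) ∈ dom3 B₀ :=
    ⟨hB0, by
      have : (0 : Fin n → ℂ) + 0 ∈ B₀ := by rwa [add_zero]
      exact this, hB0⟩
  have hcont : ∀ b i j, ContinuousAt (dW (Sum.inr (Sum.inr j), b) (thetaFun g i)) 0 := fun b i j =>
    ((contDiffOn_dW (isOpen_dom3 hB) (contDiffOn_segAvg hB hBc continuous_const
      (contDiffOn_dW (isOpen_dom2 hB) hg' (Sum.inl i, false))) _).continuousOn).continuousAt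
      ((isOpen_dom3 hB).mem_nhds h3)
  have hP : ContinuousAt (thetaZ g) 0 :=
    continuousAt_pi.2 fun i => continuousAt_pi.2 fun j => hcont false i j
  have hQ : ContinuousAt (thetaZbar g) 0 :=
    continuousAt_pi.2 fun i => continuousAt_pi.2 fun j => hcont true i j
  have hc1 : ContinuousAt (fun v => ‖(thetaZ g v).det‖) 0 :=
    ((continuous_id.matrix_det.continuousAt (x := thetaZ g 0)).comp hP).norm
  have hc2 : ContinuousAt (fun v => ‖(thetaZ g v -
      thetaZbar g v * ((thetaZ g v).map star)⁻¹ * (thetaZbar g v).map star).det‖) 0 :=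
    (ContinuousAt.comp (f := fun v => (thetaZ g v, thetaZbar g v))
      (continuousAt_schur (Q₀ := thetaZbar g 0) hdet) (hP.prodMk hQ)).norm
  have hpos : 0 < ‖(thetaZ g 0).det‖ := norm_pos_iff.2 hdet
  have hev := (hc1.eventually_const_lt (half_lt_self hpos)).and
    (hc2.eventually_const_lt (u := ‖(thetaZ g 0).det‖ / 2) (by simpa [hbar] using half_lt_self hpos))
  obtain ⟨δ, hδ, hball⟩ := Metric.eventually_nhds_iff_ball.1 hev
  refine ⟨‖(thetaZ g 0).det‖ / 2, min r₀ (δ / 2), by positivity, fun r hr hrδ => ?_⟩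
  have h4 : Metric.ball (0 : Fin n ⊕ Fin n → ℂ) r ⊆ Metric.ball 0 r₀ :=
    Metric.ball_subset_ball (hrδ.trans (min_le_left _ _))
  have h5 : dom2 (Metric.ball (0 : Fin n → ℂ) r) ⊆ O := (dom2_ball_subset hr).trans (h4.trans hsub)
  have h6 : dom3 (Metric.ball (0 : Fin n → ℂ) r) ⊆ Metric.ball 0 δ :=
    (dom3_ball_subset hr).trans (Metric.ball_subset_ball (by
      linarith [hrδ.trans (min_le_right _ _)]))
  exact ⟨h5, Metric.isOpen_ball, convex_ball 0 r, hg.mono h5, by positivity,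
    fun v hv => (hball v (h6 hv)).1.le, fun v hv => (hball v (h6 hv)).2.le⟩

/-! ### Existence of the chart -/

/-- Injectivity of the real-linear map ζ ↦ P ζ + Q ζ̄: conjugate the equation, solve for ζ̄, and
substitute to obtain the Schur complement applied to ζ. -/
theorem eq_zero_of_schur {m : Type} [Fintype m] [DecidableEq m] {P Q : Matrix m m ℂ}
    (hP : P.det ≠ 0) (hS : (P - Q * (P.map star)⁻¹ * Q.map star).det ≠ 0) {ζ : m → ℂ}
    (h : P.mulVec ζ + Q.mulVec (star ζ) = 0) : ζ = 0 := by
  have h0 : IsUnit (P.map star).det := by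
    have h1 : star P.det = (P.map star).det := (starRingEnd ℂ).map_det P
    rw [← h1, isUnit_iff_ne_zero]
    simpa using hP
  have hmv : ∀ (M : Matrix m m ℂ) (u : m → ℂ), star (M.mulVec u) = (M.map star).mulVec (star u) :=
    fun M u => by
      funext i
      simp [Matrix.mulVec, dotProduct]
  have h' : (P.map star).mulVec (star ζ) = -(Q.map star).mulVec ζ := by
    have := congrArg star h
    rw [star_add, hmv, hmv, star_star, star_zero] at this
    exact eq_neg_of_add_eq_zero_left this
  have h2 : star ζ = -((P.map star)⁻¹ * Q.map star).mulVec ζ := by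
    have := congrArg (P.map star)⁻¹.mulVec h'
    rwa [Matrix.mulVec_mulVec, Matrix.nonsing_inv_mul _ h0, Matrix.one_mulVec, Matrix.mulVec_neg,
      Matrix.mulVec_mulVec] at this
  have h3 : (P - Q * (P.map star)⁻¹ * Q.map star).mulVec ζ = 0 := by
    rw [h2, Matrix.mulVec_neg, Matrix.mulVec_mulVec, ← Matrix.mul_assoc] at h
    rw [Matrix.sub_mulVec, sub_eq_add_neg]
    exact h
  exact Matrix.eq_zero_of_mulVec_eq_zero hS h3

section chart

variable {ψ : (Fin n → ℂ) → (Fin n → ℂ) → ℂ} {B : Set (Fin n → ℂ)} {c₀ : ℝ}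

/-- The map `(x, y, z) ↦ (x, y, θ(x,y,z))`, expressed through `thetaFun`. -/
def thetaMap (g : (Fin n ⊕ Fin n → ℂ) → ℂ) (p : (Fin n → ℂ) × (Fin n → ℂ) × (Fin n → ℂ)) :
    (Fin n → ℂ) × (Fin n → ℂ) × (Fin n → ℂ) :=
  (p.1, p.2.1, fun i => thetaFun g i (pt p.1 (p.2.1 - p.1) p.2.2))

theorem contDiff_pt_sub : ContDiff ℝ ∞ fun p : (Fin n → ℂ) × (Fin n → ℂ) × (Fin n → ℂ) =>
    pt p.1 (p.2.1 - p.1) p.2.2 := by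
  rw [contDiff_pi]
  rintro (i | i | i)
  · exact (contDiff_apply ℝ ℂ i).comp contDiff_fst
  · exact (contDiff_apply ℝ ℂ i).comp ((contDiff_fst.comp contDiff_snd).sub contDiff_fst)
  · exact (contDiff_apply ℝ ℂ i).comp (contDiff_snd.comp contDiff_snd)

theorem pt_sub_mem_dom3 {p : (Fin n → ℂ) × (Fin n → ℂ) × (Fin n → ℂ)}
    (hp : p ∈ B ×ˢ B ×ˢ B) : pt p.1 (p.2.1 - p.1) p.2.2 ∈ dom3 B :=
  ⟨hp.1, by rw [py_pt, add_sub_cancel]; exact hp.2.1, hp.2.2⟩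

variable {g : (Fin n ⊕ Fin n → ℂ) → ℂ}

theorem GoodDom.contDiffOn_thetaMap (hB : GoodDom g B c₀) :
    ContDiffOn ℝ ∞ (thetaMap g) (B ×ˢ B ×ˢ B) := by
  refine contDiff_fst.contDiffOn.prodMk ((contDiff_fst.comp contDiff_snd).contDiffOn.prodMk ?_)
  rw [contDiffOn_pi]
  exact fun i => (hB.smooth_thetaFun i).comp contDiff_pt_sub.contDiffOn fun p => pt_sub_mem_dom3

/-- The derivative is the identity in x and y, so a kernel vector has only a z-part, which
`eq_zero_of_schur` kills; in finite dimension injectivity is enough. -/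
theorem GoodDom.exists_hasFDerivAt (hB : GoodDom g B c₀)
    {p : (Fin n → ℂ) × (Fin n → ℂ) × (Fin n → ℂ)} (hp : p ∈ B ×ˢ B ×ˢ B) :
    ∃ D : ((Fin n → ℂ) × (Fin n → ℂ) × (Fin n → ℂ)) ≃L[ℝ]
        ((Fin n → ℂ) × (Fin n → ℂ) × (Fin n → ℂ)),
      HasFDerivAt (thetaMap g) (D : _ →L[ℝ] _) p := by
  have hW : IsOpen (B ×ˢ B ×ˢ B) := hB.isOpen.prod (hB.isOpen.prod hB.isOpen)
  have hd := (hB.contDiffOn_thetaMap.differentiableAt_of_isOpen hW hp).hasFDerivAt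
  have hv := pt_sub_mem_dom3 hp
  have hne : ∀ {x : ℂ}, c₀ ≤ ‖x‖ → x ≠ 0 := fun hx h0 => by
    rw [h0, norm_zero] at hx
    linarith [hB.pos]
  set A := fderiv ℝ (thetaMap g) p with hA
  have hinj : Function.Injective A := by
    rw [injective_iff_map_eq_zero]
    intro u hu
    have h1 : u.1 = 0 := by
      have h2 : HasFDerivAt (fun q => (thetaMap g q).1)
          ((ContinuousLinearMap.fst ℝ _ _).comp A) p := hasFDerivAt_fst.comp p hd
      have h3 : HasFDerivAt (fun q => (thetaMap g q).1)
          (ContinuousLinearMap.fst ℝ (Fin n → ℂ) ((Fin n → ℂ) × (Fin n → ℂ))) p := hasFDerivAt_fst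
      have := DFunLike.congr_fun (h2.unique h3) u
      simpa [hu] using this.symm
    have h2 : u.2.1 = 0 := by
      have h3 : HasFDerivAt (fun q : (Fin n → ℂ) × (Fin n → ℂ) × (Fin n → ℂ) => q.2.1)
          ((ContinuousLinearMap.fst ℝ (Fin n → ℂ) (Fin n → ℂ)).comp
            (ContinuousLinearMap.snd ℝ (Fin n → ℂ) ((Fin n → ℂ) × (Fin n → ℂ)))) p :=
        hasFDerivAt_snd.fst
      have := DFunLike.congr_fun (hd.snd.fst.unique h3) u
      simpa [hu] using this.symm
    have h3 : u.2.2 = 0 := by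
      refine eq_zero_of_schur (hne (hB.det _ hv)) (hne (hB.schur _ hv)) ?_
      funext i
      have hu' : u = (0, 0, u.2.2) := Prod.ext h1 (Prod.ext h2 rfl)
      have e1 : HasFDerivAt (fun z : Fin n → ℂ => (p.1, p.2.1, z))
          ((ContinuousLinearMap.inr ℝ (Fin n → ℂ) ((Fin n → ℂ) × (Fin n → ℂ))).comp
            (ContinuousLinearMap.inr ℝ (Fin n → ℂ) (Fin n → ℂ))) p.2.2 :=
        (hasFDerivAt_prodMk_right p.1 (p.2.1, p.2.2)).comp p.2.2
          (hasFDerivAt_prodMk_right p.2.1 p.2.2)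
      have e2 : HasFDerivAt (fun q => (thetaMap g q).2.2 i)
          (((ContinuousLinearMap.proj (R := ℝ) (φ := fun _ : Fin n => ℂ) i).comp
            ((ContinuousLinearMap.snd ℝ (Fin n → ℂ) (Fin n → ℂ)).comp
              (ContinuousLinearMap.snd ℝ (Fin n → ℂ) _))).comp A) p :=
        ((ContinuousLinearMap.proj (R := ℝ) (φ := fun _ : Fin n => ℂ) i).comp
            ((ContinuousLinearMap.snd ℝ (Fin n → ℂ) (Fin n → ℂ)).comp
              (ContinuousLinearMap.snd ℝ (Fin n → ℂ) _))).hasFDerivAt.comp p hd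
      have e3 := (HasFDerivAt.comp (g := fun q => (thetaMap g q).2.2 i) p.2.2 e2 e1).fderiv
      have e4 := form_eq_sum_wirForm (fderiv ℝ ((fun q => (thetaMap g q).2.2 i) ∘
        fun z : Fin n → ℂ => (p.1, p.2.1, z)) p.2.2) u.2.2
      rw [e3] at e4
      have e5 : A (0, 0, u.2.2) = 0 := by rw [← hu']; exact hu
      simp only [ContinuousLinearMap.comp_apply, ContinuousLinearMap.inr_apply, e5, map_zero] at e4
      rw [← e3] at e4
      have e6 : ∀ j b, wirForm (j, b) (fderiv ℝ ((fun q => (thetaMap g q).2.2 i) ∘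
          fun z : Fin n → ℂ => (p.1, p.2.1, z)) p.2.2) =
          dW (Sum.inr (Sum.inr j), b) (thetaFun g i) (pt p.1 (p.2.1 - p.1) p.2.2) := fun j b =>
        dW_slice_pt ((hB.smooth_thetaFun i).differentiableAt_of_isOpen
          (isOpen_dom3 hB.isOpen) hv) j b
      simp only [e6, Finset.sum_add_distrib] at e4
      simpa [Matrix.mulVec, dotProduct, thetaZ, thetaZbar] using e4.symm
    exact Prod.ext h1 (Prod.ext h2 h3)
  let D : ((Fin n → ℂ) × (Fin n → ℂ) × (Fin n → ℂ)) ≃L[ℝ]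
      ((Fin n → ℂ) × (Fin n → ℂ) × (Fin n → ℂ)) :=
    (LinearEquiv.ofInjectiveEndo A.toLinearMap hinj).toContinuousLinearEquiv
  have hcoe : (D : ((Fin n → ℂ) × (Fin n → ℂ) × (Fin n → ℂ)) →L[ℝ]
      ((Fin n → ℂ) × (Fin n → ℂ) × (Fin n → ℂ))) = A := ContinuousLinearMap.ext fun _ => rfl
  exact ⟨D, by rw [hcoe]; exact hd⟩

/-- The inverse function theorem at the origin. The source is cut down to B × B × B, where the
derivative is invertible at every point, so the inverse is smooth on the whole target. -/
theorem GoodDom.exists_chart (hB : GoodDom (joint ψ) B c₀) (h0 : (0 : Fin n → ℂ) ∈ B) :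
    ∃ e, IsThetaChart ψ e := by
  have hW : IsOpen (B ×ˢ B ×ˢ B) := hB.isOpen.prod (hB.isOpen.prod hB.isOpen)
  have h0' : ((0, 0, 0) : (Fin n → ℂ) × (Fin n → ℂ) × (Fin n → ℂ)) ∈ B ×ˢ B ×ˢ B := ⟨h0, h0, h0⟩
  have hsm := hB.contDiffOn_thetaMap
  obtain ⟨D, hD⟩ := hB.exists_hasFDerivAt h0'
  have hat := hsm.contDiffAt (hW.mem_nhds h0')
  set e := (hat.toOpenPartialHomeomorph (thetaMap (joint ψ)) hD (by simp)).restrOpen _ hW with he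
  have hcoe : ∀ p, e p = thetaMap (joint ψ) p := fun p => rfl
  have hsrc : e.source ⊆ B ×ˢ B ×ˢ B := fun p hp => hp.2
  refine ⟨e, ⟨hat.mem_toOpenPartialHomeomorph_source hD (by simp), h0'⟩, fun x y z h => ?_,
    (hsm.mono hsrc).congr fun p _ => hcoe p, fun q hq => ?_⟩
  · rw [hcoe]
    refine Prod.ext rfl (Prod.ext rfl (funext fun i => ?_))
    have := theta_eq_thetaFun hB.isOpen hB.convex hB.smooth (pt_sub_mem_dom3 (hsrc h)) i
    simp only [px_pt, py_pt, pz_pt, add_sub_cancel] at this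
    exact this.symm
  · have hp := hsrc (e.map_target hq)
    obtain ⟨D', hD'⟩ := hB.exists_hasFDerivAt hp
    exact (e.contDiffAt_symm hq hD' (hsm.contDiffAt (hW.mem_nhds hp))).contDiffWithinAt

end chart

end

end BBS

/-! ### The Kähler potential at the origin, and conversion to multi-index bounds -/

namespace BBS

noncomputable section

variable {n : ℕ}

theorem IsGev.mono_set {ι : Type} [Fintype ι] [DecidableEq ι] {O O' S S' : Set (ι → ℂ)} {s : ℝ}
    {w : (ι → ℂ) → Bool → ℝ} {f : (ι → ℂ) → ℂ} (h : IsGev O S s w f) (hO : O' ⊆ O) (hS : S' ⊆ S) :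
    IsGev O' S' s w f := by
  obtain ⟨h1, C, R, hC, hR, h⟩ := h
  exact ⟨h1.mono hO, C, R, hC, hR, fun v hv => h v (hS hv)⟩

theorem cdist_zero : cdist (0 : Fin n ⊕ Fin n → ℂ) = 0 := by simp [cdist, conjDist]

theorem mid_zero : mid (0 : Fin n ⊕ Fin n → ℂ) = 0 := by
  funext i; simp [mid]

/-- The points near the diagonal for which the extension is defined. -/
def aheDom (a C₁ : ℝ) (V : Set (Fin n → ℂ)) : Set (Fin n ⊕ Fin n → ℂ) :=
  mid ⁻¹' V ∩ {v | C₁ * 2 ^ (a - 1) * cdist v < 1}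

section

variable {a C₀ C₁ : ℝ} {V : Set (Fin n → ℂ)} {φ : (Fin n → ℂ) → ℝ}

theorem extData_aheDom (ha : 1 < a) (hV : IsOpen V) (hC₀ : 0 < C₀) (hC₁ : 0 < C₁)
    (hφ : GevreyWith a C₀ C₁ V (fun w => (φ w : ℂ))) :
    ExtData a C₀ C₁ V (aheDom a C₁ V) (fun w => (φ w : ℂ)) where
  one_lt := ha
  C₀_pos := hC₀
  C₁_pos := hC₁
  isOpen_V := hV
  isOpen_O := (hV.preimage contDiff_mid.continuous).inter
    (isOpen_lt (continuous_const.mul continuous_cdist) continuous_const)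
  mapsTo := fun _ hv => hv.1
  small := fun _ hv => (hv.2 : _ < _).le
  gevrey := hφ

theorem zero_mem_aheDom (h0 : (0 : Fin n → ℂ) ∈ V) : 0 ∈ aheDom a C₁ V := by
  refine ⟨?_, ?_⟩
  · rw [Set.mem_preimage, mid_zero]; exact h0
  · change C₁ * 2 ^ (a - 1) * cdist 0 < 1
    rw [cdist_zero]; simp

-- The origin lies on the diagonal, where a z-derivative of ψ is an x̄-derivative of φ and a
-- z̄-derivative gives 0 by `dWord_diag`. So θ_z is the complex Hessian, invertible by positivity,
-- and θ_z̄ vanishes.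
open scoped ComplexOrder in
theorem exists_goodDom_ahe (ha : 1 < a) (hV : IsOpen V) (h0 : (0 : Fin n → ℂ) ∈ V)
    (hpsh : IsKahlerPotential V φ) (hC₀ : 0 < C₀) (hC₁ : 0 < C₁)
    (hφ : GevreyWith a C₀ C₁ V (fun w => (φ w : ℂ))) {ε : ℝ} (hε : 0 < ε) {χ : ℝ → ℝ}
    (hχ : IsGevreyCutoff ε χ) : ∃ c₀ δ : ℝ, 0 < δ ∧ ∀ r, 0 < r → r ≤ δ →
      dom2 (Metric.ball 0 r) ⊆ aheDom a C₁ V ∧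
        GoodDom (joint (ahe a C₁ χ (fun w => (φ w : ℂ)))) (Metric.ball 0 r) c₀ := by
  have D := extData_aheDom ha hV hC₀ hC₁ hφ
  have h0' : 0 ∈ aheDom a C₁ V := zero_mem_aheDom h0
  have hsm := D.contDiffOn hε hχ
  obtain ⟨r, hr, hsub⟩ := Metric.isOpen_iff.1 D.isOpen_O 0 h0'
  have hB0 : (0 : Fin n → ℂ) ∈ Metric.ball (0 : Fin n → ℂ) r := Metric.mem_ball_self hr
  have h3 : (0 : Fin n ⊕ Fin n ⊕ Fin n → ℂ) ∈ dom3 (Metric.ball (0 : Fin n → ℂ) r) :=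
    ⟨hB0, by
      have : (0 : Fin n → ℂ) + 0 ∈ Metric.ball (0 : Fin n → ℂ) r := by rwa [add_zero]
      exact this, hB0⟩
  have key : ∀ i j b, dW (Sum.inr (Sum.inr j), b)
      (thetaFun (joint (ahe a C₁ χ (fun w => (φ w : ℂ)))) i) 0 =
      if b then 0 else dWord [(i, false), (j, true)] (fun w => (φ w : ℂ)) 0 := fun i j b => by
    rw [dW_thetaFun Metric.isOpen_ball (convex_ball 0 r)
      (hsm.mono ((dom2_ball_subset hr).trans hsub)) h3 rfl, map_zero,
      D.dWord_diag hε hχ _ h0' cdist_zero, mid_zero]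
    cases b <;> simp [target]
  refine exists_goodDom D.isOpen_O h0' hsm ?_ ?_
  · have : thetaZ (joint (ahe a C₁ χ (fun w => (φ w : ℂ)))) 0 =
        complexHessian (fun w => (φ w : ℂ)) 0 := by
      ext i j
      rw [thetaZ, Matrix.of_apply, key i j false, complexHessian, Matrix.of_apply, ← dW_false,
        ← dW_true]
      exact dW_comm hV hφ.smooth (j, true) (i, false) h0
    rw [this]
    exact (hpsh 0 h0).det_pos.ne'
  · ext i j
    exact key i j true

end

/-! ### The final form of the bounds -/

theorem factorial_size_le {ι : Type} [Fintype ι] (α β : ι → ℕ) :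
    (size α + size β).factorial ≤
      (2 ^ (2 * Fintype.card ι)) ^ (size α + size β) * (mfact α * mfact β) := by
  have := factorial_sum_le (Finset.univ : Finset (ι ⊕ ι)) (Sum.elim α β)
  simpa [Fintype.sum_sum_type, Fintype.prod_sum_type, size, mfact, two_mul] using this

/-- Two applications of (i+j)! ≤ 2^{i+j} i! j!, the second to (2m)!. This produces m!², and so the
exponent 2s of m!. -/
theorem factorial_add_two_mul_le {ι : Type} [Fintype ι] (α β : ι → ℕ) (m : ℕ) :
    (size α + size β + 2 * m).factorial ≤
      (2 * 2 ^ (2 * Fintype.card ι)) ^ (size α + size β) * 16 ^ m *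
        (m.factorial ^ 2 * (mfact α * mfact β)) := by
  set k := size α + size β
  have h1 : ∀ i j : ℕ, (i + j).factorial ≤ 2 ^ (i + j) * (i.factorial * j.factorial) :=
    fun i j => by
      rw [← Nat.add_choose_mul_factorial_mul_factorial i j, mul_assoc]
      exact Nat.mul_le_mul_right _ (Nat.choose_le_two_pow _ _)
  have h2 : (2 * m).factorial ≤ 4 ^ m * m.factorial ^ 2 := by
    have := h1 m m
    rwa [← two_mul, pow_mul, ← sq] at this
  calc (k + 2 * m).factorial ≤ 2 ^ (k + 2 * m) * (k.factorial * (2 * m).factorial) := h1 _ _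
    _ ≤ 2 ^ (k + 2 * m) * ((2 ^ (2 * Fintype.card ι)) ^ k * (mfact α * mfact β) *
        (4 ^ m * m.factorial ^ 2)) :=
      Nat.mul_le_mul_left _ (Nat.mul_le_mul (factorial_size_le α β) h2)
    _ = _ := by
      rw [pow_add, pow_mul, mul_pow, show (16 : ℕ) = 2 ^ 2 * 4 by norm_num, mul_pow]
      ring

/-- The Gevrey majorant in terms of multi-indices. -/
theorem gev_le_multi {ι : Type} [Fintype ι] {s M R C : ℝ} (hs : 0 ≤ s) (hM : 0 ≤ M) (hR : 0 ≤ R)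
    (hC1 : M * 16 ^ s ≤ C) (hC2 : R * (2 * 2 ^ (2 * Fintype.card ι) : ℝ) ^ s ≤ C)
    (α β : ι → ℕ) (m : ℕ) :
    gev s (M ^ m) R (2 * m) (size α + size β) ≤
      C ^ (m + size α + size β) * (m.factorial : ℝ) ^ (2 * s) * (mfact α : ℝ) ^ s *
        (mfact β : ℝ) ^ s := by
  set c : ℝ := 2 * 2 ^ (2 * Fintype.card ι) with hc
  have h := factorial_add_two_mul_le α β m
  have h' : ((size α + size β + 2 * m).factorial : ℝ) ≤ c ^ (size α + size β) * 16 ^ m *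
      ((m.factorial : ℝ) ^ 2 * ((mfact α : ℝ) * mfact β)) := by rw [hc]; exact_mod_cast h
  have h2 := Real.rpow_le_rpow (by positivity) h' hs
  have e : (c ^ (size α + size β) * 16 ^ m *
      ((m.factorial : ℝ) ^ 2 * ((mfact α : ℝ) * mfact β))) ^ s =
      (c ^ s) ^ (size α + size β) * (16 ^ s) ^ m *
        ((m.factorial : ℝ) ^ (2 * s) * ((mfact α : ℝ) ^ s * (mfact β : ℝ) ^ s)) := by
    rw [Real.mul_rpow (by positivity) (by positivity), Real.mul_rpow (by positivity) (by positivity),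
      Real.mul_rpow (by positivity) (by positivity), Real.mul_rpow (by positivity) (by positivity),
      Real.rpow_pow_comm (by positivity), Real.rpow_pow_comm (by positivity),
      Real.rpow_mul (by positivity), Real.rpow_two]
  rw [e] at h2
  have hC : 0 ≤ C := le_trans (by positivity) hC1
  unfold gev
  calc M ^ m * R ^ (size α + size β) * ((size α + size β + 2 * m).factorial : ℝ) ^ s
      ≤ M ^ m * R ^ (size α + size β) * ((c ^ s) ^ (size α + size β) * (16 ^ s) ^ m *
        ((m.factorial : ℝ) ^ (2 * s) * ((mfact α : ℝ) ^ s * (mfact β : ℝ) ^ s))) := by gcongr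
    _ = (M * 16 ^ s) ^ m * (R * c ^ s) ^ (size α + size β) *
        ((m.factorial : ℝ) ^ (2 * s) * ((mfact α : ℝ) ^ s * (mfact β : ℝ) ^ s)) := by
      rw [mul_pow, mul_pow]; ring
    _ ≤ C ^ m * C ^ (size α + size β) *
        ((m.factorial : ℝ) ^ (2 * s) * ((mfact α : ℝ) ^ s * (mfact β : ℝ) ^ s)) := by gcongr
    _ = _ := by rw [add_assoc, pow_add]; ring

theorem holWeight_flat_indexWord (a b : ℝ) (α β : Fin n ⊕ Fin n → ℕ) (x z : Fin n → ℂ) :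
    holWeight (flat a b) (Sum.elim x z) (hasAnti (indexWord α β)) =
      flatFactor a b β (conjDist x z) := by
  have h : cdist (Sum.elim x z) = conjDist x z := rfl
  rw [hasAnti_indexWord, flatFactor, holWeight, flat, h]
  by_cases hβ : size β = 0 <;> simp [hβ]

theorem Maj.wirtinger_le {a b s M R C : ℝ} (hs : 0 ≤ s) (hM : 0 ≤ M) (hR : 0 ≤ R)
    (hC1 : M * 16 ^ s ≤ C) (hC2 : R * (2 * 2 ^ (2 * Fintype.card (Fin n ⊕ Fin n)) : ℝ) ^ s ≤ C)
    {f : (Fin n ⊕ Fin n → ℂ) → ℂ} {m : ℕ} {x z : Fin n → ℂ}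
    (h : Maj (holWeight (flat a b) (Sum.elim x z)) (gev s (M ^ m) R (2 * m)) f (Sum.elim x z))
    (α β : Fin n ⊕ Fin n → ℕ) :
    ‖wirtinger α β f (Sum.elim x z)‖ ≤
      C ^ (m + size α + size β) * (m.factorial : ℝ) ^ (2 * s) * (mfact α : ℝ) ^ s *
        (mfact β : ℝ) ^ s * flatFactor a b β (conjDist x z) := by
  have h1 := h (indexWord α β)
  rw [← wirtinger_eq_dWord, length_indexWord] at h1
  refine h1.trans ?_
  rw [← holWeight_flat_indexWord]
  exact mul_le_mul_of_nonneg_right (gev_le_multi hs hM hR hC1 hC2 α β m)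
    (holWeight_nonneg (flat_nonneg _ _ _) _)

end

end BBS

/-! ### Assembly of the estimates -/

theorem theorem1p5 (n : ℕ) (a : ℝ) (ha : 1 < a)
    (V : Set (Fin n → ℂ)) (hV : IsOpen V) (h0 : (0 : Fin n → ℂ) ∈ V)
    (φ : (Fin n → ℂ) → ℝ)
    (hpsh : BBS.IsKahlerPotential V φ)
    (C₀ C₁ : ℝ) (hC₀ : 0 < C₀) (hC₁ : 0 < C₁)
    (hφ : BBS.GevreyWith a C₀ C₁ V (fun w => (φ w : ℂ))) :
    ∃ b : ℝ, 0 < b ∧ ∀ ε : ℝ, 0 < ε → ∀ χ : ℝ → ℝ, BBS.IsGevreyCutoff ε χ →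
      (∃ e, BBS.IsThetaChart (BBS.ahe a C₁ χ (fun w => (φ w : ℂ))) e) ∧
      ∀ e, BBS.IsThetaChart (BBS.ahe a C₁ χ (fun w => (φ w : ℂ))) e →
        ∃ U : Set (Fin n → ℂ), IsOpen U ∧ (0 : Fin n → ℂ) ∈ U ∧ U ⊆ V ∧
          (∀ x ∈ U, ∀ z ∈ U, (x, x, z) ∈ e.source) ∧
          ∃ C : ℝ, 0 < C ∧ ∀ m : ℕ,
            ContDiffOn ℝ ∞
              (BBS.joint (BBS.bbsCoeff (BBS.ahe a C₁ χ (fun w => (φ w : ℂ))) e m))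
              {v | (fun i => v (Sum.inl i)) ∈ U ∧ (fun i => v (Sum.inr i)) ∈ U} ∧
            (∀ x ∈ U, ∀ z ∈ U,
              ‖BBS.bbsCoeff (BBS.ahe a C₁ χ (fun w => (φ w : ℂ))) e m x z‖ ≤
                C ^ m * (m.factorial : ℝ) ^ (2 * a + 2 * ε)) ∧
            (∀ α β : Fin n ⊕ Fin n → ℕ, ∀ x ∈ U, ∀ z ∈ U,
              ‖BBS.wirtinger α β
                  (BBS.joint (BBS.bbsCoeff (BBS.ahe a C₁ χ (fun w => (φ w : ℂ))) e m))
                  (Sum.elim x z)‖ ≤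
                C ^ (m + BBS.size α + BBS.size β) * (m.factorial : ℝ) ^ (2 * a + 2 * ε) *
                  (BBS.mfact α : ℝ) ^ (a + ε) * (BBS.mfact β : ℝ) ^ (a + ε) *
                  BBS.flatFactor a b β (BBS.conjDist x z)) ∧
            (∀ α β : Fin n ⊕ Fin n → ℕ, ∀ x ∈ U, ∀ z ∈ U, z = star x →
              ‖BBS.wirtinger α β
                  (BBS.joint (BBS.bbsCoeff (BBS.ahe a C₁ χ (fun w => (φ w : ℂ))) e m))
                  (Sum.elim x z)‖ ≤
                C ^ (m + BBS.size α + BBS.size β) * (m.factorial : ℝ) ^ (2 * a) *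
                  (BBS.mfact α : ℝ) ^ a * (BBS.mfact β : ℝ) ^ a *
                  BBS.flatFactor a b β (BBS.conjDist x z)) := by
  set b := BBS.flatRate a C₁ with hb
  have hbpos : 0 < b := BBS.flatRate_pos ha hC₁
  refine ⟨b, hbpos, fun ε hε χ hχ => ?_⟩
  have D := BBS.extData_aheDom ha hV hC₀ hC₁ hφ
  obtain ⟨c₀, δ, hδ, hgood⟩ := BBS.exists_goodDom_ahe ha hV h0 hpsh hC₀ hC₁ hφ hε hχ
  refine ⟨(hgood δ hδ le_rfl).2.exists_chart (Metric.mem_ball_self hδ), fun e he => ?_⟩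
  obtain ⟨r₁, hr₁, hball₁⟩ := Metric.isOpen_iff.1 e.open_source _ he.zero_mem
  obtain ⟨r₂, hr₂, hball₂⟩ := Metric.isOpen_iff.1 hV _ h0
  obtain ⟨r, hr, hrδ, hrr₁, hrr₂⟩ : ∃ r, 0 < r ∧ r ≤ δ ∧ r ≤ r₁ ∧ r ≤ r₂ :=
    ⟨min δ (min r₁ r₂), by positivity, min_le_left _ _,
      (min_le_right _ _).trans (min_le_left _ _), (min_le_right _ _).trans (min_le_right _ _)⟩
  obtain ⟨hsub, hB⟩ := hgood r hr hrδ
  set U := Metric.ball (0 : Fin n → ℂ) r with hU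
  have hsrc : ∀ x ∈ U, ∀ z ∈ U, (x, x, z) ∈ e.source := fun x hx z hz => by
    refine hball₁ ?_
    rw [hU, Metric.mem_ball] at hx hz
    rw [Metric.mem_ball, Prod.dist_eq, Prod.dist_eq]
    exact max_lt (hx.trans_le hrr₁) (max_lt (hx.trans_le hrr₁) (hz.trans_le hrr₁))
  refine ⟨U, Metric.isOpen_ball, Metric.mem_ball_self hr,
    (Metric.ball_subset_ball hrr₂).trans hball₂, hsrc, ?_⟩
  -- First run of the induction: all points of U × U, of order a + ε.
  obtain ⟨M, R, hM, hR, hbd⟩ := hB.coeff_bound he hsrc (S := BBS.dom2 U) (s := a + ε)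
    (by linarith) (fun v _ => BBS.flat_nonneg a b v) (fun v _ => BBS.flat_le_one hbpos.le v)
    ((D.isGev hε hχ).mono_set hsub hsub)
  -- Second run: diagonal points only, of order a. The weight is 0 there, which gives the vanishing
  -- of antiholomorphic derivatives.
  obtain ⟨M', R', hM', hR', hbd'⟩ := hB.coeff_bound he hsrc
    (S := BBS.dom2 U ∩ {v | BBS.cdist v = 0}) (s := a)
    ha.le (fun v _ => BBS.flat_nonneg a b v) (fun v _ => BBS.flat_le_one hbpos.le v)
    ((D.isGev_diag hε hχ b).mono_set hsub (Set.inter_subset_inter_left _ hsub))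
  set N : ℝ := 2 * 2 ^ (2 * Fintype.card (Fin n ⊕ Fin n)) with hN
  have hN0 : 0 < N := by positivity
  have hp1 : 0 ≤ M * 16 ^ (a + ε) := by positivity
  have hp2 : 0 ≤ R * N ^ (a + ε) := by positivity
  have hp3 : 0 ≤ M' * 16 ^ a := by positivity
  have hp4 : 0 ≤ R' * N ^ a := by positivity
  have hmem : ∀ x ∈ U, ∀ z ∈ U, Sum.elim x z ∈ BBS.dom2 U := fun x hx z hz => ⟨hx, hz⟩
  -- The four nonnegative summands are the lower bounds required by `Maj.wirtinger_le` in the two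
  -- runs; the final 1 ensures C > 0.
  set C : ℝ := M * 16 ^ (a + ε) + R * N ^ (a + ε) + M' * 16 ^ a + R' * N ^ a + 1 with hC
  have main : ∀ m : ℕ, ∀ α β : Fin n ⊕ Fin n → ℕ, ∀ x ∈ U, ∀ z ∈ U,
      ‖BBS.wirtinger α β
          (BBS.joint (BBS.bbsCoeff (BBS.ahe a C₁ χ (fun w => (φ w : ℂ))) e m))
          (Sum.elim x z)‖ ≤
        C ^ (m + BBS.size α + BBS.size β) * (m.factorial : ℝ) ^ (2 * a + 2 * ε) *
          (BBS.mfact α : ℝ) ^ (a + ε) * (BBS.mfact β : ℝ) ^ (a + ε) *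
          BBS.flatFactor a b β (BBS.conjDist x z) := fun m α β x hx z hz => by
    rw [← mul_add 2 a ε]
    exact ((hbd m).2 _ (hmem x hx z hz) (hmem x hx z hz)).wirtinger_le (by linarith) hM hR
      (by linarith) (by linarith) α β
  refine ⟨C, by linarith, fun m => ⟨(hbd m).1, fun x hx z hz => ?_, main m,
    fun α β x hx z hz hzx => ?_⟩⟩
  · have h := main m 0 0 x hx z hz
    have hs0 : BBS.size (0 : Fin n ⊕ Fin n → ℕ) = 0 := by simp [BBS.size]
    have hm0 : BBS.mfact (0 : Fin n ⊕ Fin n → ℕ) = 1 := by simp [BBS.mfact]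
    have hw : BBS.indexWord (0 : Fin n ⊕ Fin n → ℕ) 0 = [] :=
      List.length_eq_zero_iff.1 (by rw [BBS.length_indexWord, hs0])
    rw [BBS.wirtinger_eq_dWord, hw] at h
    simpa [hs0, hm0, BBS.flatFactor, BBS.joint] using h
  · have hd : BBS.cdist (Sum.elim x z) = 0 := by
      rw [hzx]; simp [BBS.cdist, BBS.conjDist]
    exact ((hbd' m).2 _ ⟨hmem x hx z hz, hd⟩ (hmem x hx z hz)).wirtinger_le (by linarith) hM' hR'
      (by linarith) (by linarith) α β
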